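/- For $d\in\{3,4,5,6\mathrm{I},6\mathrm{II},8\}$ let $(\kappa_d,\lambda_d,\mu_d)$ be $(27,6,0)$, $(16,4,0)$, $(11,3,1)$, $(7,2,8)$, $(10,3,-9)$, $(0,0,16)$ respectively. Let $\theta=P\frac{d}{dP}$ and $u_d=1+\kappa_dP-\mu_dP^2$, and let $f_d\in 1+P\,\mathbb C[[P]]$ be the unique power series solution with constant term $1$ of $$u_d\,\theta^2f_d+(\theta u_d)\,\theta f_d+(\lambda_dP-\mu_dP^2)f_d=0 .$$ Let $E_d=u_df_d^3$, regarded as a power series in the canonical modular coordinate $q=-P+O(P^2)$ determined by $\frac{d\log P}{d\log q}=u_df_d^2$ (equivalently, $\frac{d\log Q}{d\log q}=E_d$ and $q=-Q+O(Q^2)$, where $Q=Pe^{g_d}$ with $g_d\in P\,\mathbb C[[P]]$ and $f_d=1+\theta g_d$). Put $q=e^{2\pi i\tau}$. For Dirichlet characters $\chi,\psi$ modulo $N_\chi,N_\psi$ and a positive integer $n$, let $$E_3^{\chi,\psi,n}(\tau)=\tfrac12\delta_{\mathbf 1_1,\chi}L(-2,\psi)+\sum_{m\ge1}\psi(m)m^{2}\sum_{\nu=1}^{N_\chi}\frac{\chi(\nu)q^{\nu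 mn}}{1-q^{N_\chi mn}},$$ where $\mathbf 1_1$ is the trivial character modulo $1$ and $\delta_{\mathbf 1_1,\chi}$ is $1$ if $\chi=\mathbf 1_1$ and $0$ otherwise. Let $\chi_{3,2}$ and $\chi_{4,2}$ be the nontrivial Dirichlet characters modulo $3$ and $4$, let $\chi_{5,2}$ be the Dirichlet character modulo $5$ with $\chi_{5,2}(2)=i$, and let $\chi_{5,3}=\overline{\chi_{5,2}}=\chi_{5,2}^3$. Then the $q$-series $E_d$ converges for every $\tau$ in the upper half plane $\mathbb H$ (in all six cases). For $d\in\{3,4,5,6\}$ (in degree $6$ for both $6\mathrm{I}$ and $6\mathrm{II}$) the function $E_d(\tau)$ is a modular form of weight $3$ on $\Gamma_1(d)$, and it is the Eisenstein series of weight $3$ associated with the cusp $i\infty$ of $\Gamma_1(d)$: $$E_d(\tau)=\sum_{\substack{(a,c)\equiv(1,0)\bmod d\\ \gcd(a,c)=1}}\frac1{(-c\tau+a)^3}\qquad(\tau\in\mathbb H).$$ Moreover, on $\mathbb H$: 1. $E_3=-9E_3^{\mathbf 1_1,\chi_{3,2},1}$; 2. $E_4=-4E_3^{\mathbf 1_1,\chi_{4,2},1}$;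 3. $E_5=(-1+\frac i2)E_3^{\mathbf 1_1,\chi_{5,2},1}+(-1-\frac i2)E_3^{\mathbf 1_1,\chi_{5,3},1}$; 4. $E_{6\mathrm{I}}=E_{6\mathrm{II}}=-E_3^{\mathbf 1_1,\chi_{3,2},1}-8E_3^{\mathbf 1_1,\chi_{3,2},2}$; 5. $E_8=-4E_3^{\mathbf 1_1,\chi_{4,2},2}$. (On the left-hand sides, $E_3,E_4,\dots$ without superscripts denote the functions $E_d$.) -/

import Mathlib

open PowerSeries UpperHalfPlane
open scoped MatrixGroups

noncomputable section

namespace ExtremalFunction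

/-- The cases `d = 3, 4, 5, 6I, 6II, 8` of smoothable del Pezzo cones that are considered here
(degree six occurs with two different smoothings). -/
inductive Case
  | d3 | d4 | d5 | d6I | d6II | d8
  deriving DecidableEq

/-- The degree `d` of the del Pezzo surface. -/
def Case.degree : Case → ℕ
  | .d3 => 3
  | .d4 => 4
  | .d5 => 5
  | .d6I => 6
  | .d6II => 6
  | .d8 => 8

def kappa : Case → ℂ
  | .d3 => 27
  | .d4 => 16
  | .d5 => 11
  | .d6I => 7
  | .d6II => 10
  | .d8 => 0

def lam : Case → ℂ
  | .d3 => 6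
  | .d4 => 4
  | .d5 => 3
  | .d6I => 2
  | .d6II => 3
  | .d8 => 0

def mu : Case → ℂ
  | .d3 => 0
  | .d4 => 0
  | .d5 => 1
  | .d6I => 8
  | .d6II => -9
  | .d8 => 16

/-! ### Power series in the variable `P` -/

/-- The Euler operator `θ = P d/dP` on formal power series. -/
def theta (f : ℂ⟦X⟧) : ℂ⟦X⟧ := X * derivative ℂ f

/-- The power series without constant term whose image under `θ` is `f` minus its constant
term. -/
def thetaInv (f : ℂ⟦X⟧) : ℂ⟦X⟧ := PowerSeries.mk fun n => if n = 0 then 0 else coeff n f / n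

/-- `u_d = 1 + κ_d P - μ_d P ^ 2`. -/
def u (d : Case) : ℂ⟦X⟧ := 1 + C (kappa d) * X - C (mu d) * X ^ 2

/-- The coefficients of `f_d`. -/
def fCoeff (d : Case) : ℕ → ℂ
  | 0 => 1
  | 1 => -lam d
  | n + 2 =>
      (-(kappa d * (n + 2) * (n + 1) + lam d) * fCoeff d (n + 1)
        + mu d * (n + 1) ^ 2 * fCoeff d n) / (n + 2) ^ 2

/-- The power series `f_d`: the unique solution with constant term `1` of the differential
equation `u_d θ² f + (θ u_d) (θ f) + (λ_d P - μ_d P ^ 2) f = 0`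
(see `f_ode` and `f_unique`). -/
def f (d : Case) : ℂ⟦X⟧ := PowerSeries.mk (fCoeff d)

/-- `E_d = u_d f_d ^ 3` as a power series in `P`. -/
def extremalP (d : Case) : ℂ⟦X⟧ := u d * f d ^ 3

/-- The variable `Q` as a power series in `P`: `Q = P exp g` where `f_d = 1 + θ g`. -/
def mirrorMap (d : Case) : ℂ⟦X⟧ := X * (PowerSeries.exp ℂ).subst (thetaInv (f d))

/-- The canonical modular coordinate `q` as a power series in `P`.  It is characterised by
`d log q / d log Q = 1 / E_d` and `q = -Q + O(Q ^ 2)` or, equivalently, by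
`d log q / d log P = 1 / (u_d f_d ^ 2)` and `q = -P + O(P ^ 2)`
(see `modularCoordinate_theta` and `modularCoordinate_mirrorMap`). -/
def modularCoordinate (d : Case) : ℂ⟦X⟧ :=
  -X * (PowerSeries.exp ℂ).subst (thetaInv (u d * f d ^ 2)⁻¹)

theorem coeff_theta (h : ℂ⟦X⟧) (n : ℕ) : coeff n (theta h) = n * coeff n h := by
  cases n with
  | zero => simp [theta]
  | succ n =>
    rw [theta, coeff_succ_X_mul, coeff_derivative]
    push_cast
    ring

theorem theta_thetaInv (h : ℂ⟦X⟧) : theta (thetaInv h) = h - C (constantCoeff h) := by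
  ext n
  rw [coeff_theta, thetaInv, coeff_mk]
  cases n with
  | zero => simp
  | succ n =>
    have : ((n : ℂ) + 1) ≠ 0 := by exact_mod_cast Nat.succ_ne_zero n
    simp
    field_simp

theorem hasSubst_thetaInv (h : ℂ⟦X⟧) : HasSubst (thetaInv h) := by
  apply HasSubst.of_constantCoeff_zero'
  rw [← coeff_zero_eq_constantCoeff_apply, thetaInv, coeff_mk]
  simp

theorem constantCoeff_u (d : Case) : constantCoeff (u d) = 1 := by simp [u]

theorem constantCoeff_f (d : Case) : constantCoeff (f d) = 1 := by
  rw [← coeff_zero_eq_constantCoeff_apply, f, coeff_mk, fCoeff]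

theorem coeff_ode (d : Case) (h : ℂ⟦X⟧) (n : ℕ) :
    coeff (n + 2) (u d * theta (theta h) + theta (u d) * theta h
      + (C (lam d) * X - C (mu d) * X ^ 2) * h) =
    (n + 2) ^ 2 * coeff (n + 2) h
      + (kappa d * (n + 2) * (n + 1) + lam d) * coeff (n + 1) h
      - mu d * (n + 1) ^ 2 * coeff n h := by
  have hu : theta (u d) = C (kappa d) * X - C (2 * mu d) * X ^ 2 := by
    ext m
    rw [coeff_theta]
    rw [u]
    simp only [map_add, map_sub, coeff_C_mul, coeff_X, coeff_X_pow, coeff_one]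
    rcases m with _ | _ | _ | m <;> simp
  have e1 : ∀ (c : ℂ) (g : ℂ⟦X⟧), coeff (n + 2) (C c * X * g) = c * coeff (n + 1) g := by
    intro c g
    rw [mul_assoc, coeff_C_mul, coeff_succ_X_mul]
  have e2 : ∀ (c : ℂ) (g : ℂ⟦X⟧), coeff (n + 2) (C c * X ^ 2 * g) = c * coeff n g := by
    intro c g
    rw [mul_assoc, coeff_C_mul, coeff_X_pow_mul]
  rw [hu, u]
  simp only [add_mul, sub_mul, one_mul, map_add, map_sub, e1, e2, coeff_theta]
  push_cast
  ring

theorem coeff_ode_zero (d : Case) (h : ℂ⟦X⟧) :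
    coeff 0 (u d * theta (theta h) + theta (u d) * theta h
      + (C (lam d) * X - C (mu d) * X ^ 2) * h) = 0 := by
  simp [theta]

theorem coeff_ode_one (d : Case) (h : ℂ⟦X⟧) :
    coeff 1 (u d * theta (theta h) + theta (u d) * theta h
      + (C (lam d) * X - C (mu d) * X ^ 2) * h) = coeff 1 h + lam d * coeff 0 h := by
  have h01 : Finset.HasAntidiagonal.antidiagonal 1 = {((0 : ℕ), (1 : ℕ)), (1, 0)} := rfl
  simp [coeff_mul, h01, coeff_theta, u, coeff_X, coeff_X_pow]

theorem f_ode (d : Case) :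
    u d * theta (theta (f d)) + theta (u d) * theta (f d)
      + (C (lam d) * X - C (mu d) * X ^ 2) * f d = 0 := by
  ext n
  rcases n with _ | _ | n
  · rw [coeff_ode_zero]; simp
  · rw [zero_add, coeff_ode_one]; simp [f, fCoeff]
  · rw [coeff_ode]
    have : ((n : ℂ) + 2) ≠ 0 := by exact_mod_cast Nat.succ_ne_zero (n + 1)
    simp only [f, coeff_mk, fCoeff, map_zero]
    field_simp
    ring

theorem f_unique (d : Case) (h : ℂ⟦X⟧) (h0 : constantCoeff h = 1)
    (hode : u d * theta (theta h) + theta (u d) * theta h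
      + (C (lam d) * X - C (mu d) * X ^ 2) * h = 0) : h = f d := by
  have h0' : coeff 0 h = 1 := by rw [coeff_zero_eq_constantCoeff_apply, h0]
  have key : ∀ n, coeff n h = fCoeff d n ∧ coeff (n + 1) h = fCoeff d (n + 1) := by
    intro n
    induction n with
    | zero =>
      refine ⟨by rw [h0', fCoeff], ?_⟩
      have := coeff_ode_one d h
      rw [hode, h0', map_zero] at this
      rw [zero_add, fCoeff]
      linear_combination -this
    | succ n ih =>
      refine ⟨ih.2, ?_⟩
      have := coeff_ode d h n
      rw [hode, ih.1, ih.2, map_zero] at this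
      have hn : ((n : ℂ) + 2) ≠ 0 := by exact_mod_cast Nat.succ_ne_zero (n + 1)
      rw [show n + 1 + 1 = n + 2 from rfl, fCoeff, eq_div_iff (pow_ne_zero 2 hn)]
      linear_combination -this
  ext n
  rw [(key n).1, f, coeff_mk]

theorem theta_X_mul_exp (c : ℂ⟦X⟧) {g : ℂ⟦X⟧} (hg : HasSubst g) (hc : theta c = c) :
    theta (c * (PowerSeries.exp ℂ).subst g) = c * (PowerSeries.exp ℂ).subst g * (1 + theta g) := by
  have h1 : theta (c * (PowerSeries.exp ℂ).subst g) =
      theta c * (PowerSeries.exp ℂ).subst g + c * theta ((PowerSeries.exp ℂ).subst g) := by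
    simp only [theta, Derivation.leibniz, smul_eq_mul]
    ring
  have h2 : theta ((PowerSeries.exp ℂ).subst g) = (PowerSeries.exp ℂ).subst g * theta g := by
    simp only [theta, derivative_subst hg, derivative_exp]
    ring
  rw [h1, h2, hc]
  ring

theorem mirrorMap_theta (d : Case) : theta (mirrorMap d) = mirrorMap d * f d := by
  rw [mirrorMap, theta_X_mul_exp X (hasSubst_thetaInv _) (by simp [theta]), theta_thetaInv,
    constantCoeff_f, map_one]
  ring

theorem modularCoordinate_theta (d : Case) :
    u d * f d ^ 2 * theta (modularCoordinate d) = modularCoordinate d := by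
  have hc : constantCoeff (u d * f d ^ 2) = 1 := by simp [constantCoeff_u, constantCoeff_f]
  have hc' : constantCoeff (u d * f d ^ 2)⁻¹ = 1 := by
    rw [PowerSeries.constantCoeff_inv, hc, inv_one]
  have hi : u d * f d ^ 2 * (u d * f d ^ 2)⁻¹ = 1 :=
    PowerSeries.mul_inv_cancel _ (by rw [hc]; exact one_ne_zero)
  rw [modularCoordinate, theta_X_mul_exp (-X) (hasSubst_thetaInv _) (by simp [theta]),
    theta_thetaInv, hc', map_one, add_sub_cancel]
  linear_combination (-X * (PowerSeries.exp ℂ).subst (thetaInv (u d * f d ^ 2)⁻¹)) * hi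

/-- `d log q / d log Q = 1 / E_d`, all sides being expressed through `P`. -/
theorem modularCoordinate_mirrorMap (d : Case) :
    extremalP d * theta (modularCoordinate d) * mirrorMap d =
      modularCoordinate d * theta (mirrorMap d) := by
  rw [mirrorMap_theta, extremalP]
  linear_combination f d * mirrorMap d * modularCoordinate_theta d

theorem constantCoeff_modularCoordinate (d : Case) : constantCoeff (modularCoordinate d) = 0 := by
  simp [modularCoordinate]

theorem constantCoeff_exp_subst (h : ℂ⟦X⟧) :
    constantCoeff ((PowerSeries.exp ℂ).subst (thetaInv h)) = 1 := by
  have hg := hasSubst_thetaInv h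
  have h0 : constantCoeff (thetaInv h) = 0 := by
    rw [← coeff_zero_eq_constantCoeff_apply, thetaInv, coeff_mk]
    simp
  rw [← coeff_zero_eq_constantCoeff_apply, coeff_subst' hg, finsum_eq_single _ 0]
  · simp
  · intro n hn
    simp [h0, hn]

theorem coeff_one_modularCoordinate (d : Case) : coeff 1 (modularCoordinate d) = -1 := by
  have := coeff_succ_X_mul 0 ((PowerSeries.exp ℂ).subst (thetaInv (u d * f d ^ 2)⁻¹))
  rw [zero_add, coeff_zero_eq_constantCoeff_apply, constantCoeff_exp_subst] at this
  rw [modularCoordinate, neg_mul, map_neg, this]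

theorem isUnit_coeff_one_modularCoordinate (d : Case) :
    IsUnit (coeff 1 (modularCoordinate d)) := by
  rw [coeff_one_modularCoordinate]
  exact isUnit_one.neg

/-! ### The extremal function as a function of `q`, and of `τ` with `q = exp (2 π i τ)` -/

/-- `P = -q + O(q ^ 2)` as a power series in the canonical modular coordinate `q`
(the compositional inverse of `q = -P + O(P ^ 2)`). -/
def pSeries (d : Case) : ℂ⟦X⟧ :=
  substInvOfIsUnit (modularCoordinate d) (isUnit_coeff_one_modularCoordinate d)

/-- `E_d = u_d f_d ^ 3` as a power series in the canonical modular coordinate `q`. -/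
def extremalQ (d : Case) : ℂ⟦X⟧ := (extremalP d).subst (pSeries d)

/-- `q = exp (2 π i τ)`. -/
def qOf (τ : ℍ) : ℂ := Complex.exp (2 * Real.pi * Complex.I * τ)

/-- The extremal function `E_d` as a function of `τ` in the upper half plane. -/
def extremal (d : Case) (τ : ℍ) : ℂ := ∑' n : ℕ, coeff n (extremalQ d) * qOf τ ^ n

/-! ### Eisenstein series -/

/-- The Eisenstein series of weight `k` associated with the cusp `i∞` of `Γ₁(N)`: the sum of
`(-c τ + a) ^ (-k)` over all coprime pairs `(a, c)` congruent to `(1, 0)` modulo `N`. -/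
def cuspEisenstein (N k : ℕ) (τ : ℍ) : ℂ :=
  ∑' p : {p : ℤ × ℤ // IsCoprime p.1 p.2 ∧ p.1 ≡ 1 [ZMOD N] ∧ p.2 ≡ 0 [ZMOD N]},
    1 / (-(p.1.2 : ℂ) * τ + (p.1.1 : ℂ)) ^ k

/-- The normalized Eisenstein series of weight `k` with parameter `(χ, ψ, n)`, where `χ` and `ψ`
are Dirichlet characters modulo `M` and `N`.  The character `χ` is the trivial character modulo
`1` exactly when `M = 1`. -/
def normalizedEisenstein (k : ℕ) {M N : ℕ} [NeZero N] (χ : DirichletCharacter ℂ M)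
    (ψ : DirichletCharacter ℂ N) (n : ℕ) (τ : ℍ) : ℂ :=
  1 / 2 * (if M = 1 then 1 else 0) * ψ.LFunction (1 - k)
    + ∑' m : ℕ+, ψ (m : ℕ) * (m : ℂ) ^ (k - 1) *
      ∑ ν ∈ Finset.Icc 1 M,
        χ ν * qOf τ ^ (ν * m * n) / (1 - qOf τ ^ (M * m * n))

/-- The nontrivial Dirichlet character modulo `3`. -/
def chi3 : DirichletCharacter ℂ 3 := (quadraticChar (ZMod 3)).ringHomComp (Int.castRingHom ℂ)

/-- The nontrivial Dirichlet character modulo `4`. -/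
def chi4 : DirichletCharacter ℂ 4 := ZMod.χ₄.ringHomComp (Int.castRingHom ℂ)

/-- The values of `chi5`. -/
def chi5Fun : ZMod 5 → ℂ := ![0, 1, Complex.I, -Complex.I, -1]

/-- The Dirichlet character modulo `5` with value `i` at `2`. -/
def chi5 : DirichletCharacter ℂ 5 where
  toFun := chi5Fun
  map_one' := rfl
  map_mul' := by
    have h : ∀ a : ZMod 5, a = 0 ∨ a = 1 ∨ a = 2 ∨ a = 3 ∨ a = 4 := by decide
    have h0 : chi5Fun 0 = 0 := rfl
    have h1 : chi5Fun 1 = 1 := rfl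
    have h2 : chi5Fun 2 = Complex.I := rfl
    have h3 : chi5Fun 3 = -Complex.I := rfl
    have h4 : chi5Fun 4 = -1 := rfl
    have m22 : (2 * 2 : ZMod 5) = 4 := by decide
    have m23 : (2 * 3 : ZMod 5) = 1 := by decide
    have m24 : (2 * 4 : ZMod 5) = 3 := by decide
    have m32 : (3 * 2 : ZMod 5) = 1 := by decide
    have m33 : (3 * 3 : ZMod 5) = 4 := by decide
    have m34 : (3 * 4 : ZMod 5) = 2 := by decide
    have m42 : (4 * 2 : ZMod 5) = 3 := by decide
    have m43 : (4 * 3 : ZMod 5) = 2 := by decide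
    have m44 : (4 * 4 : ZMod 5) = 1 := by decide
    intro a b
    change chi5Fun (a * b) = chi5Fun a * chi5Fun b
    rcases h a with rfl | rfl | rfl | rfl | rfl <;>
      rcases h b with rfl | rfl | rfl | rfl | rfl <;>
      simp [h0, h1, h2, h3, h4, m22, m23, m24, m32, m33, m34, m42, m43, m44]
  map_nonunit' := by
    intro a ha
    have h : ∀ a : ZMod 5, a = 0 ∨ IsUnit a := by decide
    rcases h a with rfl | h
    · rfl
    · exact absurd h ha

/-- The Dirichlet character modulo `5` that is complex conjugate to `chi5`. -/
def chi5bar : DirichletCharacter ℂ 5 := chi5 ^ 3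

end ExtremalFunction

end

open ExtremalFunction

/-! The link between the differential equation and Eisenstein series is the formal series J₀(x) =
j(x) + ∑ (x^m - x^(-m)) q^m / (1 - q^m), with j(x) = (1 + x) / (2 (1 - x)), together with its
iterated derivatives J₁, J₂, … under x d/dx. At a root of unity x, J₀ is a weight one and J₂ a
weight three Eisenstein series.

Two identities drive everything. Ramanujan's formula (`TorusPoint.J₀_sq`) gives J₀(x)², and its
companion gives the mixed products when x₁x₂x₃ = 1. Together they form the addition theorem
(`TorusPoint.J₀_add_sq`): up to a series independent of the points, the square of a sum of three J₀
is the sum of the J₁, as for the Weierstrass ζ and ℘. Both are proved coefficientwise from a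
Skoruppa-type identity (`sum_quad_sub`) over solutions of mb + nd = N, which rests on one Euclidean
step.

Differentiating Ramanujan's formula in x yields a heat-type equation 2θJ₀ = J₂ - 2J₀J₁ with θ = q
d/dq. Differentiating the addition theorem in directions with r₁ + r₂ + r₃ = 0 yields algebraic
relations among the J_k. To differentiate at a fixed root of unity, the point is deformed to x
exp(rε) over ℂ⟦ε⟧ and ε is set to 0 afterwards. At torsion points of order 3, 4, 5, 6 these
relations determine the needed θ-derivatives algebraically.

On the other side, `extremalQ_eq` rewrites the definition of E_d in the coordinate q: it suffices to
exhibit F (the future f_d) and P, normalised, with θP = P U F² and a second order equation for F,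
where U = u_d(P); then E_d = U F³. At each level F is built from the J₀, P is a quotient H / F^k,
and U F³ comes out as a combination of J₂ at torsion points (`extremalQ_d3`, …, `extremalQ_d6`).
Level eight is level four with q replaced by q² (`extremalQ_d8`).

Expanding J₂ gives Lambert series with periodic coefficients, hence convergence, and comparison with
characters and with L(-2, χ) (Bernoulli polynomials) gives the five explicit formulas.

For the cusp at infinity, the Lipschitz formula shows that J₂ at exp(2πij/N) is, up to a constant,
the sum over c of ∑ₙ (cτ + j/N + n)^(-3). Weighting by an odd character and splitting off the gcd
produces L(3, χ) times a sum over primitive vectors. But L(3, χ) is the same combination of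
Lipschitz sums with c = 0, so the transcendental constant cancels and no value at 3 is needed.
Modularity is then invariance of (0, 1) modulo N under Γ₁(N). -/

noncomputable section

namespace ExtremalFunction

section

open Finset

/-! ### Sums over quadruples and Lambert series -/

/-- Quadruples `((m, b), (n, d))` of positive integers with `m * b + n * d = N`. -/
def quad (N : ℕ) : Finset ((ℕ × ℕ) × (ℕ × ℕ)) :=
  ((range (N + 1) ×ˢ range (N + 1)) ×ˢ (range (N + 1) ×ˢ range (N + 1))).filter fun p =>
    (0 < p.1.1 ∧ 0 < p.1.2) ∧ (0 < p.2.1 ∧ 0 < p.2.2) ∧ p.1.1 * p.1.2 + p.2.1 * p.2.2 = N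

theorem mem_quad {N : ℕ} {p : (ℕ × ℕ) × (ℕ × ℕ)} : p ∈ quad N ↔
    (0 < p.1.1 ∧ 0 < p.1.2) ∧ (0 < p.2.1 ∧ 0 < p.2.2) ∧
      p.1.1 * p.1.2 + p.2.1 * p.2.2 = N := by
  rw [quad, mem_filter, and_iff_right_iff_imp]
  rintro ⟨⟨h1, h2⟩, ⟨h3, h4⟩, h⟩
  simp only [mem_product, mem_range]
  refine ⟨⟨?_, ?_⟩, ?_, ?_⟩ <;> nlinarith

section Sums

variable {M : Type*} [AddCommGroup M]

theorem sum_quad_swap (N : ℕ) (c : ℕ → ℕ → ℕ → ℕ → Prop) [∀ m b n d, Decidable (c m b n d)]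
    (H : ℕ → ℕ → M) :
    ∑ p ∈ quad N with c p.1.1 p.1.2 p.2.1 p.2.2, H p.1.1 p.2.1 =
      ∑ p ∈ quad N with c p.2.1 p.2.2 p.1.1 p.1.2, H p.2.1 p.1.1 := by
  refine sum_nbij' Prod.swap Prod.swap ?_ ?_ ?_ ?_ ?_
  · rintro ⟨⟨m, b⟩, n, d⟩
    simp only [mem_filter, mem_quad, Prod.swap]
    rintro ⟨⟨h1, h2, h3⟩, h4⟩
    exact ⟨⟨h2, h1, by rw [← h3, add_comm]⟩, h4⟩
  · rintro ⟨⟨m, b⟩, n, d⟩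
    simp only [mem_filter, mem_quad, Prod.swap]
    rintro ⟨⟨h1, h2, h3⟩, h4⟩
    exact ⟨⟨h2, h1, by rw [← h3, add_comm]⟩, h4⟩
  · simp
  · simp
  · simp

/-- Since mb + nd = m(b - d) + (m + n)d, the Euclidean step (m, b, n, d) ↦ (m, b - d, m + n, d)
preserves N and turns the condition d < b into m < n. -/
theorem sum_quad_euclid (N : ℕ) (H : ℕ → ℕ → M) :
    ∑ p ∈ quad N with p.2.2 < p.1.2, H p.1.1 p.2.1 =
      ∑ p ∈ quad N with p.1.1 < p.2.1, H p.1.1 (p.2.1 - p.1.1) := by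
  refine sum_nbij' (fun p => ((p.1.1, p.1.2 - p.2.2), (p.1.1 + p.2.1, p.2.2)))
    (fun p => ((p.1.1, p.1.2 + p.2.2), (p.2.1 - p.1.1, p.2.2))) ?_ ?_ ?_ ?_ ?_
  · rintro ⟨⟨m, b⟩, n, d⟩
    simp only [mem_filter, mem_quad]
    rintro ⟨⟨h1, h2, h3⟩, h4⟩
    obtain ⟨e, rfl⟩ := Nat.exists_eq_add_of_lt h4
    refine ⟨⟨⟨h1.1, by omega⟩, ⟨by omega, h2.2⟩, ?_⟩, by omega⟩
    rw [← h3, show d + e + 1 - d = e + 1 by omega]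
    ring
  · rintro ⟨⟨m, b⟩, n, d⟩
    simp only [mem_filter, mem_quad]
    rintro ⟨⟨h1, h2, h3⟩, h4⟩
    obtain ⟨e, rfl⟩ := Nat.exists_eq_add_of_lt h4
    refine ⟨⟨⟨h1.1, by omega⟩, ⟨by omega, h2.2⟩, ?_⟩, by omega⟩
    rw [← h3, show m + e + 1 - m = e + 1 by omega]
    ring
  · rintro ⟨⟨m, b⟩, n, d⟩
    simp only [mem_filter, mem_quad, Prod.mk.injEq, true_and, and_true]
    omega
  · rintro ⟨⟨m, b⟩, n, d⟩
    simp only [mem_filter, mem_quad, Prod.mk.injEq, true_and, and_true]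
    omega
  · rintro ⟨⟨m, b⟩, n, d⟩
    simp

theorem sum_quad_split (s : Finset ((ℕ × ℕ) × (ℕ × ℕ))) (a b : (ℕ × ℕ) × (ℕ × ℕ) → ℕ)
    (g : (ℕ × ℕ) × (ℕ × ℕ) → M) :
    ∑ p ∈ s, g p = ∑ p ∈ s with a p < b p, g p + ∑ p ∈ s with b p < a p, g p +
      ∑ p ∈ s with a p = b p, g p := by
  simp only [sum_filter]
  rw [← sum_add_distrib, ← sum_add_distrib]
  refine sum_congr rfl fun p _ => ?_
  rcases lt_trichotomy (a p) (b p) with h | h | h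
  · simp [h, h.not_gt, h.ne]
  · simp [h]
  · simp [h, h.not_gt, h.ne']

/-- A version of Skoruppa's identity. -/
theorem sum_quad_sub (N : ℕ) (Op Om : ℕ → ℕ → M) (hp : ∀ m n, Op m n = Op n m)
    (hm : ∀ m n, Om m n = Om n m) (h : ∀ m n, m < n → Om m (n - m) = Op m n) :
    ∑ p ∈ quad N, (Op p.1.1 p.2.1 - Om p.1.1 p.2.1) =
      ∑ p ∈ quad N with p.1.1 = p.2.1, Op p.1.1 p.2.1 -
        ∑ p ∈ quad N with p.1.2 = p.2.2, Om p.1.1 p.2.1 := by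
  -- `Op` is split by comparing m with n, `Om` by comparing b with d. The off-diagonal parts agree
  -- through the Euclidean step and the swap, so only the two diagonals survive.
  have e1 := sum_quad_split (quad N) (fun p => p.1.1) (fun p => p.2.1) (fun p => Op p.1.1 p.2.1)
  have e2 := sum_quad_split (quad N) (fun p => p.1.2) (fun p => p.2.2) (fun p => Om p.1.1 p.2.1)
  have e3 := sum_quad_swap N (fun m _ n _ => n < m) Op
  have e4 := sum_quad_swap N (fun _ b _ d => b < d) Om
  have e5 := sum_quad_euclid N Om
  have e6 : ∑ p ∈ quad N with p.1.1 < p.2.1, Om p.1.1 (p.2.1 - p.1.1) =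
      ∑ p ∈ quad N with p.1.1 < p.2.1, Op p.1.1 p.2.1 :=
    sum_congr rfl fun p hp => h _ _ (mem_filter.1 hp).2
  simp only [hp _ (Prod.fst (Prod.fst _))] at e3
  simp only [hm _ (Prod.fst (Prod.fst _))] at e4
  rw [sum_sub_distrib, e1, e2, e4, e5, e6]
  have e3' : ∑ p ∈ quad N with p.2.1 < p.1.1, Op p.1.1 p.2.1 =
      ∑ p ∈ quad N with p.1.1 < p.2.1, Op p.1.1 p.2.1 := by
    rw [sum_quad_swap N (fun m _ n _ => n < m) Op]
    exact sum_congr rfl fun p _ => hp _ _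
  rw [e3']
  abel

/-- On the diagonal m = n the equation reads m(b + d) = N, and a cofactor k = b + d splits in k - 1
ways. -/
theorem sum_quad_left_eq (N : ℕ) (g : ℕ → M) :
    ∑ p ∈ quad N with p.1.1 = p.2.1, g p.1.1 =
      ∑ p ∈ N.divisorsAntidiagonal, (p.2 - 1) • g p.1 := by
  have : ∀ p ∈ N.divisorsAntidiagonal, (p.2 - 1) • g p.1 = ∑ _i ∈ Ico 1 p.2, g p.1 := by
    intro p _
    simp
  rw [sum_congr rfl this, sum_sigma']
  refine sum_bij' (fun p _ => ⟨(p.1.1, p.1.2 + p.2.2), p.1.2⟩)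
    (fun p _ => ((p.1.1, p.2), (p.1.1, p.1.2 - p.2))) ?_ ?_ ?_ ?_ ?_
  · rintro ⟨⟨m, b⟩, n, d⟩
    simp only [mem_filter, mem_quad, mem_sigma, Nat.mem_divisorsAntidiagonal, mem_Ico]
    rintro ⟨⟨h1, h2, h3⟩, rfl⟩
    refine ⟨⟨by rw [← h3]; ring, ?_⟩, by omega⟩
    have := Nat.mul_pos h1.1 h1.2
    omega
  · rintro ⟨⟨m, k⟩, i⟩
    simp only [mem_filter, mem_quad, mem_sigma, Nat.mem_divisorsAntidiagonal, mem_Ico]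
    rintro ⟨⟨h1, h2⟩, h3, h4⟩
    have hm : 0 < m := by
      rcases Nat.eq_zero_or_pos m with rfl | h
      · simp at h1; omega
      · exact h
    refine ⟨⟨⟨hm, by omega⟩, ⟨hm, by omega⟩, ?_⟩, trivial⟩
    rw [← mul_add, ← h1]
    congr 1
    omega
  · rintro ⟨⟨m, b⟩, n, d⟩
    simp only [mem_filter, mem_quad, Prod.mk.injEq, true_and]
    omega
  · rintro ⟨⟨m, k⟩, i⟩
    simp only [mem_sigma, mem_Ico, Sigma.mk.injEq, Prod.mk.injEq, heq_eq_eq, true_and, and_true]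
    omega
  · simp

/-- On the diagonal b = d the equation reads (m + n)b = N, so m runs over 1, …, k - 1 for each
divisor k = m + n. -/
theorem sum_quad_right_eq (N : ℕ) (H : ℕ → ℕ → M) :
    ∑ p ∈ quad N with p.1.2 = p.2.2, H p.1.1 p.2.1 =
      ∑ p ∈ N.divisorsAntidiagonal, ∑ i ∈ Ico 1 p.1, H i (p.1 - i) := by
  rw [sum_sigma']
  refine sum_bij' (fun p _ => ⟨(p.1.1 + p.2.1, p.1.2), p.1.1⟩)
    (fun p _ => ((p.2, p.1.2), (p.1.1 - p.2, p.1.2))) ?_ ?_ ?_ ?_ ?_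
  · rintro ⟨⟨m, b⟩, n, d⟩
    simp only [mem_filter, mem_quad, mem_sigma, Nat.mem_divisorsAntidiagonal, mem_Ico]
    rintro ⟨⟨h1, h2, h3⟩, rfl⟩
    refine ⟨⟨by rw [← h3]; ring, ?_⟩, by omega⟩
    have := Nat.mul_pos h1.1 h1.2
    omega
  · rintro ⟨⟨k, b⟩, i⟩
    simp only [mem_filter, mem_quad, mem_sigma, Nat.mem_divisorsAntidiagonal, mem_Ico]
    rintro ⟨⟨h1, h2⟩, h3, h4⟩
    have hm : 0 < b := by
      rcases Nat.eq_zero_or_pos b with rfl | h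
      · simp at h1; omega
      · exact h
    refine ⟨⟨⟨by omega, hm⟩, ⟨by omega, hm⟩, ?_⟩, trivial⟩
    rw [← add_mul, ← h1]
    congr 1
    omega
  · rintro ⟨⟨m, b⟩, n, d⟩
    simp only [mem_filter, mem_quad, Prod.mk.injEq, true_and]
    omega
  · rintro ⟨⟨m, k⟩, i⟩
    simp only [mem_sigma, mem_Ico, Sigma.mk.injEq, Prod.mk.injEq, heq_eq_eq, and_true]
    omega
  · rintro ⟨⟨m, b⟩, n, d⟩ _
    simp

end Sums

section Lambert

variable {R : Type*} [CommRing R]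

/-- The Lambert series `∑ g(m) q ^ m / (1 - q ^ m)`. -/
def lambert (g : ℕ → R) : R⟦X⟧ := mk fun N => ∑ p ∈ N.divisorsAntidiagonal, g p.1

/-- The series `∑ g(m) q ^ m / (1 - q ^ m) ^ 2`. -/
def lambertSq (g : ℕ → R) : R⟦X⟧ := mk fun N => ∑ p ∈ N.divisorsAntidiagonal, (p.2 : R) * g p.1

theorem coeff_lambert_mul (g h : ℕ → R) (N : ℕ) :
    coeff N (lambert g * lambert h) = ∑ p ∈ quad N, g p.1.1 * h p.2.1 := by
  rw [coeff_mul]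
  simp only [lambert, coeff_mk, sum_mul_sum, ← sum_product']
  rw [sum_sigma']
  refine sum_bij' (fun p _ => p.2) (fun p _ => ⟨(p.1.1 * p.1.2, p.2.1 * p.2.2), p⟩) ?_ ?_ ?_ ?_ ?_
  · rintro ⟨⟨i, j⟩, ⟨m, b⟩, n, d⟩
    simp only [mem_sigma, HasAntidiagonal.mem_antidiagonal, mem_product, Nat.mem_divisorsAntidiagonal, mem_quad]
    rintro ⟨rfl, ⟨rfl, h1⟩, rfl, h2⟩
    rw [mul_ne_zero_iff] at h1 h2
    exact ⟨⟨h1.1.bot_lt, h1.2.bot_lt⟩, ⟨h2.1.bot_lt, h2.2.bot_lt⟩, rfl⟩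
  · rintro ⟨⟨m, b⟩, n, d⟩
    simp only [mem_sigma, HasAntidiagonal.mem_antidiagonal, mem_product, Nat.mem_divisorsAntidiagonal, mem_quad]
    rintro ⟨⟨h1, h2⟩, ⟨h3, h4⟩, rfl⟩
    exact ⟨rfl, ⟨trivial, by positivity⟩, trivial, by positivity⟩
  · rintro ⟨⟨i, j⟩, ⟨m, b⟩, n, d⟩
    simp only [mem_sigma, HasAntidiagonal.mem_antidiagonal, mem_product, Nat.mem_divisorsAntidiagonal]
    rintro ⟨rfl, ⟨rfl, h1⟩, rfl, h2⟩
    rfl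
  · simp
  · simp

end Lambert

/-! ### Eisenstein series at torus points -/

/-- A point `x ≠ 1` of the multiplicative group over `R`, with its inverse and the values
`j = (1 + x) / (2 (1 - x))` and `j₁ = x / (1 - x) ^ 2`. -/
structure TorusPoint (R : Type*) [CommRing R] where
  x : R
  xi : R
  j : R
  j₁ : R
  mul_inv : x * xi = 1
  two_mul_j : 2 * j * (1 - x) = 1 + x
  four_mul_j₁ : 4 * j₁ = 4 * j ^ 2 - 1
  isUnit_one_sub : IsUnit (1 - x)

variable {R : Type*} [CommRing R]

namespace TorusPoint

variable (t : TorusPoint R)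

def s (m : ℕ) : R := t.x ^ m - t.xi ^ m

def c (m : ℕ) : R := t.x ^ m + t.xi ^ m

/-- The weight one Eisenstein series at the point `t`. -/
def J₀ : R⟦X⟧ := C t.j + lambert t.s

/-- The logarithmic derivative of `J₀` in the direction of `t`. -/
def J₁ : R⟦X⟧ := C t.j₁ + lambert fun m => (m : R) * t.c m

theorem mul_inv_pow (m : ℕ) : t.x ^ m * t.xi ^ m = 1 := by
  rw [← mul_pow, t.mul_inv, one_pow]

theorem two_mul_j_inv : 2 * t.j * (1 - t.xi) = -(1 + t.xi) := by
  linear_combination -t.xi * t.two_mul_j - (1 + 2 * t.j) * t.mul_inv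

theorem geom_aux (y : R) {k : ℕ} (hk : 0 < k) :
    (1 + y) * ∑ i ∈ range k, y ^ i = 1 + 2 * ∑ i ∈ Ico 1 k, y ^ i + y ^ k := by
  have h1 : ∑ i ∈ range k, y ^ i = 1 + ∑ i ∈ Ico 1 k, y ^ i := by
    rw [range_eq_Ico, sum_eq_sum_Ico_succ_bot hk, pow_zero]
  have h2 := geom_sum_mul y k
  linear_combination 2 * h1 + h2

theorem two_mul_j_mul {k : ℕ} (hk : 0 < k) :
    2 * t.j * (1 - t.x ^ k) = 1 + 2 * ∑ i ∈ Ico 1 k, t.x ^ i + t.x ^ k := by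
  rw [← geom_aux t.x hk, ← t.two_mul_j]
  linear_combination 2 * t.j * (geom_sum_mul t.x k)

theorem two_mul_j_mul_inv {k : ℕ} (hk : 0 < k) :
    2 * t.j * (1 - t.xi ^ k) = -(1 + 2 * ∑ i ∈ Ico 1 k, t.xi ^ i + t.xi ^ k) := by
  rw [← geom_aux t.xi hk, ← neg_mul, ← t.two_mul_j_inv]
  linear_combination 2 * t.j * (geom_sum_mul t.xi k)

/-- Subtract the geometric sums for x and its inverse. This is the cross term between the constant j
and the Lambert part in the square of J₀; it absorbs the inner sums of `lambert_s_sq`. -/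
theorem two_mul_j_mul_s {k : ℕ} (hk : 0 < k) :
    2 * t.j * t.s k = -(t.c k + 2 * ∑ i ∈ Ico 1 k, t.c i + 2) := by
  simp only [s, c, sum_add_distrib]
  linear_combination t.two_mul_j_mul_inv hk - t.two_mul_j_mul hk

theorem sum_Ico_reflect' {M : Type*} [AddCommMonoid M] (g : ℕ → ℕ → M) (k : ℕ) :
    ∑ i ∈ Ico 1 k, g i (k - i) = ∑ i ∈ Ico 1 k, g (k - i) i := by
  refine sum_nbij' (fun i => k - i) (fun i => k - i) ?_ ?_ ?_ ?_ ?_ <;> intro i <;>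
    simp only [mem_Ico] <;> intro hi
  · omega
  · omega
  · omega
  · omega
  · rw [show k - (k - i) = i by omega]

theorem coeff_lambert (g : ℕ → R) (N : ℕ) :
    coeff N (lambert g) = ∑ p ∈ N.divisorsAntidiagonal, g p.1 := coeff_mk _ _

theorem coeff_lambertSq (g : ℕ → R) (N : ℕ) :
    coeff N (lambertSq g) = ∑ p ∈ N.divisorsAntidiagonal, (p.2 : R) * g p.1 := coeff_mk _ _

theorem fst_pos {N : ℕ} {p : ℕ × ℕ} (hp : p ∈ N.divisorsAntidiagonal) : 0 < p.1 := by
  rw [Nat.mem_divisorsAntidiagonal] at hp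
  rcases Nat.eq_zero_or_pos p.1 with h | h
  · rw [h, zero_mul] at hp; exact absurd hp.1.symm hp.2
  · exact h

theorem snd_pos {N : ℕ} {p : ℕ × ℕ} (hp : p ∈ N.divisorsAntidiagonal) : 0 < p.2 := by
  rw [Nat.mem_divisorsAntidiagonal] at hp
  rcases Nat.eq_zero_or_pos p.2 with h | h
  · rw [h, mul_zero] at hp; exact absurd hp.1.symm hp.2
  · exact h

theorem lambert_s_sq (N : ℕ) : coeff N (lambert t.s * lambert t.s) =
    ∑ p ∈ N.divisorsAntidiagonal, (∑ i ∈ Ico 1 p.1, (t.c p.1 + 2 * t.c i)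
      - ((p.2 : R) - 1) * (2 + 2 * t.c p.1)) := by
  have hx := t.mul_inv_pow
  -- The common summand c m + c n leaves the difference unchanged, but it makes the hypothesis hold:
  -- both sides become c m + c n + c (n - m).
  have key := sum_quad_sub N
    (fun m n => t.x ^ m * t.xi ^ n + t.xi ^ m * t.x ^ n + t.c m + t.c n)
    (fun m n => t.x ^ (m + n) + t.xi ^ (m + n) + t.c m + t.c n)
    (fun m n => by ring) (fun m n => by ring) (fun m n hmn => by
      obtain ⟨e, rfl⟩ := Nat.exists_eq_add_of_le hmn.le
      rw [Nat.add_sub_cancel_left]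
      simp only [c, pow_add]
      linear_combination -(t.x ^ e + t.xi ^ e) * hx m)
  have h1 := sum_quad_left_eq N (fun m => t.x ^ m * t.xi ^ m + t.xi ^ m * t.x ^ m + t.c m + t.c m)
  have h1' : ∑ p ∈ quad N with p.1.1 = p.2.1,
      (t.x ^ p.1.1 * t.xi ^ p.2.1 + t.xi ^ p.1.1 * t.x ^ p.2.1 + t.c p.1.1 + t.c p.2.1) =
      ∑ p ∈ quad N with p.1.1 = p.2.1,
      (t.x ^ p.1.1 * t.xi ^ p.1.1 + t.xi ^ p.1.1 * t.x ^ p.1.1 + t.c p.1.1 + t.c p.1.1) :=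
    sum_congr rfl fun p hp => by rw [← (mem_filter.1 hp).2]
  have h2 := sum_quad_right_eq N (fun m n => t.x ^ (m + n) + t.xi ^ (m + n) + t.c m + t.c n)
  rw [h1', h1, h2] at key
  rw [coeff_lambert_mul]
  have e : ∑ p ∈ quad N, t.s p.1.1 * t.s p.2.1 = -∑ p ∈ quad N,
      (t.x ^ p.1.1 * t.xi ^ p.2.1 + t.xi ^ p.1.1 * t.x ^ p.2.1 + t.c p.1.1 + t.c p.2.1
      - (t.x ^ (p.1.1 + p.2.1) + t.xi ^ (p.1.1 + p.2.1) + t.c p.1.1 + t.c p.2.1)) := by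
    rw [← sum_neg_distrib]
    refine sum_congr rfl fun p _ => ?_
    simp only [s, pow_add]
    ring
  rw [e, key, neg_sub, ← sum_sub_distrib]
  refine sum_congr rfl fun p hp => ?_
  congr 1
  · have : ∀ i ∈ Ico 1 p.1, t.x ^ (i + (p.1 - i)) + t.xi ^ (i + (p.1 - i)) + t.c i
        + t.c (p.1 - i) = t.c p.1 + t.c i + t.c (p.1 - i) := by
      intro i hi
      rw [mem_Ico] at hi
      rw [show i + (p.1 - i) = p.1 by omega]
      simp only [c]
    rw [sum_congr rfl this, sum_add_distrib, sum_Ico_reflect' (fun _ b => t.c b) p.1,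
      ← sum_add_distrib]
    exact sum_congr rfl fun i _ => by ring
  · rw [nsmul_eq_mul, Nat.cast_sub (snd_pos hp), Nat.cast_one]
    linear_combination 2 * ((p.2 : R) - 1) * hx p.1

/-- Ramanujan's identity. -/
theorem J₀_sq : 4 * t.J₀ ^ 2 =
    4 * t.J₁ - 8 * lambertSq t.c + 1 - 8 * lambertSq (fun _ => (1 : R)) := by
  have h : 4 * t.J₀ ^ 2 = C (4 * t.j ^ 2) + C (8 * t.j) * lambert t.s
      + C 4 * (lambert t.s * lambert t.s) := by
    rw [J₀]
    simp only [map_mul, map_pow, map_ofNat]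
    ring
  have h' : 4 * t.J₁ - 8 * lambertSq t.c + 1 - 8 * lambertSq (fun _ => (1 : R)) =
      C (4 * t.j ^ 2) + C 4 * lambert (fun m => (m : R) * t.c m) - C 8 * lambertSq t.c
      - C 8 * lambertSq (fun _ => (1 : R)) := by
    rw [show 4 * t.j ^ 2 = 4 * t.j₁ + 1 by linear_combination -t.four_mul_j₁, J₁]
    simp only [map_add, map_mul, map_ofNat, map_one]
    ring
  rw [h, h']
  ext N
  simp only [map_add, map_sub, coeff_C_mul, lambert_s_sq, coeff_lambertSq, coeff_lambert, mul_sum]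
  rw [add_assoc, ← sum_add_distrib, add_sub_assoc, add_sub_assoc, ← sum_sub_distrib,
    ← sum_sub_distrib]
  congr 1
  refine sum_congr rfl fun p hp => ?_
  have h1 := t.two_mul_j_mul_s (fst_pos hp)
  have h2 : ((p.1 - 1 : ℕ) : R) = p.1 - 1 := by rw [Nat.cast_sub (fst_pos hp), Nat.cast_one]
  simp only [sum_add_distrib, sum_const, Nat.card_Ico, nsmul_eq_mul, h2, ← mul_sum]
  linear_combination 4 * h1

/-- When x₁x₂x₃ = 1, one has xᵢ^m xⱼ^(-(n - m)) = xₖ^(-m) xⱼ^(-n). Summing over all ordered pairs of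
indices therefore gives functions to which `sum_quad_sub` applies. -/
theorem coeff_lambert_mul_cyclic (t₁ t₂ t₃ : TorusPoint R) (h : t₁.x * t₂.x * t₃.x = 1) (N : ℕ) :
    coeff N (2 * (lambert t₁.s * lambert t₂.s + lambert t₂.s * lambert t₃.s
      + lambert t₃.s * lambert t₁.s)) =
    ∑ p ∈ N.divisorsAntidiagonal, (2 * ((p.2 : R) - 1) * (t₁.c p.1 + t₂.c p.1 + t₃.c p.1)
      - 2 * ∑ i ∈ Ico 1 p.1, (t₁.x ^ (p.1 - i) * t₃.xi ^ i + t₁.xi ^ (p.1 - i) * t₃.x ^ i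
        + (t₂.x ^ (p.1 - i) * t₁.xi ^ i + t₂.xi ^ (p.1 - i) * t₁.x ^ i)
        + (t₃.x ^ (p.1 - i) * t₂.xi ^ i + t₃.xi ^ (p.1 - i) * t₂.x ^ i))) := by
  have hxi : t₁.xi = t₂.x * t₃.x := by
    linear_combination (t₂.x * t₃.x) * t₁.mul_inv - t₁.xi * h
  have hyi : t₂.xi = t₁.x * t₃.x := by
    linear_combination (t₁.x * t₃.x) * t₂.mul_inv - t₂.xi * h
  have hzi : t₃.xi = t₁.x * t₂.x := by
    linear_combination (t₁.x * t₂.x) * t₃.mul_inv - t₃.xi * h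
  have hx : t₁.x = t₂.xi * t₃.xi := by
    rw [hyi, hzi]; linear_combination -t₁.x * h
  have hy : t₂.x = t₁.xi * t₃.xi := by
    rw [hxi, hzi]; linear_combination -t₂.x * h
  have hz : t₃.x = t₁.xi * t₂.xi := by
    rw [hxi, hyi]; linear_combination -t₃.x * h
  have pw : ∀ {a b c : R}, a = b * c → ∀ m : ℕ, a ^ m = b ^ m * c ^ m := by
    rintro a b c rfl m
    exact mul_pow _ _ _
  set Op : ℕ → ℕ → R := fun m n =>
    t₁.x ^ m * t₂.x ^ n + t₁.xi ^ m * t₂.xi ^ n + (t₂.x ^ m * t₁.x ^ n + t₂.xi ^ m * t₁.xi ^ n)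
    + (t₂.x ^ m * t₃.x ^ n + t₂.xi ^ m * t₃.xi ^ n)
    + (t₃.x ^ m * t₂.x ^ n + t₃.xi ^ m * t₂.xi ^ n)
    + (t₃.x ^ m * t₁.x ^ n + t₃.xi ^ m * t₁.xi ^ n)
    + (t₁.x ^ m * t₃.x ^ n + t₁.xi ^ m * t₃.xi ^ n) with hOp
  set Om : ℕ → ℕ → R := fun m n =>
    t₁.x ^ m * t₂.xi ^ n + t₁.xi ^ m * t₂.x ^ n + (t₂.x ^ m * t₁.xi ^ n + t₂.xi ^ m * t₁.x ^ n)
    + (t₂.x ^ m * t₃.xi ^ n + t₂.xi ^ m * t₃.x ^ n)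
    + (t₃.x ^ m * t₂.xi ^ n + t₃.xi ^ m * t₂.x ^ n)
    + (t₃.x ^ m * t₁.xi ^ n + t₃.xi ^ m * t₁.x ^ n)
    + (t₁.x ^ m * t₃.xi ^ n + t₁.xi ^ m * t₃.x ^ n) with hOm
  have key := sum_quad_sub N Op Om (fun m n => by simp only [hOp]; ring)
    (fun m n => by simp only [hOm]; ring) (fun m n hmn => by
      obtain ⟨e, rfl⟩ := Nat.exists_eq_add_of_le hmn.le
      rw [Nat.add_sub_cancel_left]
      simp only [hOp, hOm, pow_add]
      linear_combination (t₂.xi ^ e + t₃.xi ^ e) * pw hx m + (t₁.xi ^ e + t₃.xi ^ e) * pw hy m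
        + (t₁.xi ^ e + t₂.xi ^ e) * pw hz m + (t₂.x ^ e + t₃.x ^ e) * pw hxi m
        + (t₁.x ^ e + t₃.x ^ e) * pw hyi m + (t₁.x ^ e + t₂.x ^ e) * pw hzi m)
  have h1 : ∑ p ∈ quad N with p.1.1 = p.2.1, Op p.1.1 p.2.1 =
      ∑ p ∈ quad N with p.1.1 = p.2.1, 2 * (t₁.c p.1.1 + t₂.c p.1.1 + t₃.c p.1.1) := by
    refine sum_congr rfl fun p hp => ?_
    rw [← (mem_filter.1 hp).2]
    simp only [hOp, c]
    linear_combination -2 * (pw hx p.1.1 + pw hy p.1.1 + pw hz p.1.1 + pw hxi p.1.1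
      + pw hyi p.1.1 + pw hzi p.1.1)
  rw [h1, sum_quad_left_eq N (fun m => 2 * (t₁.c m + t₂.c m + t₃.c m)),
    sum_quad_right_eq N Om, ← sum_sub_distrib] at key
  have e : coeff N (2 * (lambert t₁.s * lambert t₂.s + lambert t₂.s * lambert t₃.s
      + lambert t₃.s * lambert t₁.s)) = ∑ p ∈ quad N, (Op p.1.1 p.2.1 - Om p.1.1 p.2.1) := by
    rw [show 2 * (lambert t₁.s * lambert t₂.s + lambert t₂.s * lambert t₃.s
      + lambert t₃.s * lambert t₁.s) = lambert t₁.s * lambert t₂.s + lambert t₂.s * lambert t₁.s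
      + lambert t₂.s * lambert t₃.s + lambert t₃.s * lambert t₂.s + lambert t₃.s * lambert t₁.s
      + lambert t₁.s * lambert t₃.s by ring]
    simp only [map_add, coeff_lambert_mul, ← sum_add_distrib]
    refine sum_congr rfl fun p _ => ?_
    simp only [hOp, hOm, s]
    ring
  rw [e, key]
  refine sum_congr rfl fun p hp => ?_
  congr 1
  · rw [nsmul_eq_mul, Nat.cast_sub (snd_pos hp), Nat.cast_one]
    ring
  · have r : ∀ a b : R, ∑ i ∈ Ico 1 p.1, a ^ i * b ^ (p.1 - i) =
        ∑ i ∈ Ico 1 p.1, a ^ (p.1 - i) * b ^ i :=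
      fun a b => sum_Ico_reflect' (fun i k => a ^ i * b ^ k) p.1
    simp only [hOm, sum_add_distrib, r]
    have r' : ∀ a b : R, ∑ i ∈ Ico 1 p.1, a ^ (p.1 - i) * b ^ i =
        ∑ i ∈ Ico 1 p.1, b ^ (p.1 - i) * a ^ i := by
      intro a b
      rw [← r]
      exact sum_congr rfl fun i _ => mul_comm _ _
    rw [r' t₁.x t₂.xi, r' t₁.xi t₂.x, r' t₂.x t₃.xi, r' t₂.xi t₃.x, r' t₃.x t₁.xi,
      r' t₃.xi t₁.x]
    ring

/-- As x₃⁻¹ = x₁x₂, the sum on the right is geometric in x₂. It serves to cancel the inner sums of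
`coeff_lambert_mul_cyclic` against the terms linear in the Lambert series. -/
theorem two_mul_j_mul_s_add (t₁ t₂ t₃ : TorusPoint R) (h : t₁.x * t₂.x * t₃.x = 1) {k : ℕ}
    (hk : 0 < k) : 2 * t₂.j * (t₁.s k + t₃.s k) = t₁.c k + t₃.c k
      + 2 * ∑ i ∈ Ico 1 k, (t₁.x ^ (k - i) * t₃.xi ^ i + t₁.xi ^ (k - i) * t₃.x ^ i) := by
  have hxi : t₁.xi = t₂.x * t₃.x := by
    linear_combination (t₂.x * t₃.x) * t₁.mul_inv - t₁.xi * h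
  have hyi : t₂.xi = t₁.x * t₃.x := by
    linear_combination (t₁.x * t₃.x) * t₂.mul_inv - t₂.xi * h
  have hzi : t₃.xi = t₁.x * t₂.x := by
    linear_combination (t₁.x * t₂.x) * t₃.mul_inv - t₃.xi * h
  have hz : t₃.x = t₁.xi * t₂.xi := by
    rw [hxi, hyi]; linear_combination -t₃.x * h
  have e : ∑ i ∈ Ico 1 k, (t₁.x ^ (k - i) * t₃.xi ^ i + t₁.xi ^ (k - i) * t₃.x ^ i) =
      t₁.x ^ k * ∑ i ∈ Ico 1 k, t₂.x ^ i + t₁.xi ^ k * ∑ i ∈ Ico 1 k, t₂.xi ^ i := by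
    rw [mul_sum, mul_sum, ← sum_add_distrib]
    refine sum_congr rfl fun i hi => ?_
    rw [mem_Ico] at hi
    rw [hzi, hz, mul_pow, mul_pow, ← mul_assoc, ← mul_assoc, ← pow_add, ← pow_add,
      Nat.sub_add_cancel hi.2.le]
  have hz' : t₃.x ^ k = t₁.xi ^ k * t₂.xi ^ k := by rw [hz, mul_pow]
  have hzi' : t₃.xi ^ k = t₁.x ^ k * t₂.x ^ k := by rw [hzi, mul_pow]
  rw [e]
  simp only [s, c]
  rw [hz', hzi']
  linear_combination t₁.x ^ k * t₂.two_mul_j_mul hk - t₁.xi ^ k * t₂.two_mul_j_mul_inv hk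

/-- For x = exp(2iα) one has j = (i/2) cot α, so this is the cotangent identity for three angles
with sum in πℤ. Algebraically it follows by clearing the unit denominators. -/
theorem j_cyclic (t₁ t₂ t₃ : TorusPoint R) (h : t₁.x * t₂.x * t₃.x = 1) :
    4 * (t₁.j * t₂.j + t₂.j * t₃.j + t₃.j * t₁.j) = -1 := by
  have hu := (t₁.isUnit_one_sub.mul t₂.isUnit_one_sub).mul t₃.isUnit_one_sub
  refine hu.mul_left_cancel ?_
  have h1 := t₁.two_mul_j
  have h2 := t₂.two_mul_j
  have h3 := t₃.two_mul_j
  linear_combination (1 - t₃.x) * (h1 * (2 * t₂.j * (1 - t₂.x)) + (1 + t₁.x) * h2)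
    + (1 - t₁.x) * (h2 * (2 * t₃.j * (1 - t₃.x)) + (1 + t₂.x) * h3)
    + (1 - t₂.x) * (h3 * (2 * t₁.j * (1 - t₁.x)) + (1 + t₃.x) * h1) - 4 * h

theorem J₀_mul_cyclic (t₁ t₂ t₃ : TorusPoint R) (h : t₁.x * t₂.x * t₃.x = 1) :
    4 * (t₁.J₀ * t₂.J₀ + t₂.J₀ * t₃.J₀ + t₃.J₀ * t₁.J₀) =
      4 * (lambertSq t₁.c + lambertSq t₂.c + lambertSq t₃.c) - 1 := by
  have e : 4 * (t₁.J₀ * t₂.J₀ + t₂.J₀ * t₃.J₀ + t₃.J₀ * t₁.J₀) =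
      C (4 * (t₁.j * t₂.j + t₂.j * t₃.j + t₃.j * t₁.j))
      + (C (4 * t₂.j) * (lambert t₁.s + lambert t₃.s) + C (4 * t₃.j) * (lambert t₂.s + lambert t₁.s)
        + C (4 * t₁.j) * (lambert t₃.s + lambert t₂.s))
      + C 2 * (2 * (lambert t₁.s * lambert t₂.s + lambert t₂.s * lambert t₃.s
        + lambert t₃.s * lambert t₁.s)) := by
    simp only [J₀, map_add, map_mul, map_ofNat]
    ring
  rw [e, j_cyclic t₁ t₂ t₃ h, map_neg, map_one, neg_add_eq_sub, sub_add_eq_add_sub]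
  congr 1
  rw [← map_ofNat (C (R := R)) 4]
  ext N
  simp only [map_add, coeff_C_mul, coeff_lambert_mul_cyclic t₁ t₂ t₃ h, coeff_lambertSq,
    coeff_lambert, mul_sum, ← sum_add_distrib]
  refine sum_congr rfl fun p hp => ?_
  have h1 := two_mul_j_mul_s_add t₁ t₂ t₃ h (fst_pos hp)
  have h2 := two_mul_j_mul_s_add t₂ t₃ t₁ (by rw [← h]; ring) (fst_pos hp)
  have h3 := two_mul_j_mul_s_add t₃ t₁ t₂ (by rw [← h]; ring) (fst_pos hp)
  simp only [← mul_sum, sum_add_distrib] at h1 h2 h3 ⊢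
  linear_combination 2 * h1 + 2 * h2 + 2 * h3

/-- The addition theorem of the Weierstrass zeta function. -/
theorem J₀_add_sq (t₁ t₂ t₃ : TorusPoint R) (h : t₁.x * t₂.x * t₃.x = 1) :
    4 * (t₁.J₀ + t₂.J₀ + t₃.J₀) ^ 2 = 4 * (t₁.J₁ + t₂.J₁ + t₃.J₁)
      + 1 - 24 * lambertSq (fun _ => (1 : R)) := by
  -- The series `lambertSq t.c` of the three squares cancel against those of the mixed products.
  linear_combination t₁.J₀_sq + t₂.J₀_sq + t₃.J₀_sq + 2 * J₀_mul_cyclic t₁ t₂ t₃ h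

end TorusPoint

/-! ### Derivations of the coefficients -/

section Derivation

variable {R : Type*} [CommRing R] [Algebra ℂ R]

/-- The coefficientwise extension of a derivation to power series. -/
def coeffDeriv (D : Derivation ℂ R R) : Derivation ℂ R⟦X⟧ R⟦X⟧ :=
  Derivation.mk'
    { toFun := fun f => mk fun n => D (coeff n f)
      map_add' := fun f g => by ext n; simp
      map_smul' := fun a f => by ext n; simp }
    (fun f g => by
      ext n
      simp only [LinearMap.coe_mk, AddHom.coe_mk, coeff_mk, coeff_mul, map_sum, map_add,
        smul_eq_mul, Derivation.leibniz, sum_add_distrib]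
      congr 1
      rw [← Finset.Nat.sum_antidiagonal_swap]
      rfl)

theorem coeff_coeffDeriv (D : Derivation ℂ R R) (f : R⟦X⟧) (n : ℕ) :
    coeff n (coeffDeriv D f) = D (coeff n f) := by
  change coeff n (mk fun n => D (coeff n f)) = _
  rw [coeff_mk]

theorem coeffDeriv_C (D : Derivation ℂ R R) (a : R) : coeffDeriv D (C a) = C (D a) := by
  ext n
  rw [coeff_coeffDeriv, coeff_C, coeff_C]
  split <;> simp

theorem coeffDeriv_lambert (D : Derivation ℂ R R) (g : ℕ → R) :
    coeffDeriv D (lambert g) = lambert fun m => D (g m) := by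
  ext n
  rw [coeff_coeffDeriv, TorusPoint.coeff_lambert, TorusPoint.coeff_lambert, map_sum]

theorem coeffDeriv_lambertSq (D : Derivation ℂ R R) (g : ℕ → R) :
    coeffDeriv D (lambertSq g) = lambertSq fun m => D (g m) := by
  ext n
  rw [coeff_coeffDeriv, TorusPoint.coeff_lambertSq, TorusPoint.coeff_lambertSq, map_sum]
  refine sum_congr rfl fun p _ => ?_
  simp [Derivation.leibniz]

/-- The Euler operator on power series. -/
def euler (f : R⟦X⟧) : R⟦X⟧ := mk fun n => (n : R) * coeff n f

omit [Algebra ℂ R] in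
theorem coeff_euler (f : R⟦X⟧) (n : ℕ) : coeff n (euler f) = n * coeff n f := coeff_mk _ _

theorem coeffDeriv_euler (D : Derivation ℂ R R) (f : R⟦X⟧) :
    coeffDeriv D (euler f) = euler (coeffDeriv D f) := by
  ext n
  simp [coeff_coeffDeriv, coeff_euler, Derivation.leibniz]

end Derivation

/-! ### Differentiating Ramanujan's identity and the addition theorem along the torus -/

namespace TorusPoint

section Ring

variable {R : Type*} [CommRing R] (t : TorusPoint R)

/-- These constants are the successive derivatives of `j₁` under x d/dx, from the rule that the
derivative of `j₁` is 2 j j₁, itself read off from 4 j₁ = 4 j² - 1. -/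
def j₂ : R := 2 * t.j * t.j₁
def j₃ : R := 2 * t.j₁ ^ 2 + 2 * t.j * t.j₂
def j₄ : R := 6 * t.j₁ * t.j₂ + 2 * t.j * t.j₃
def J₂ : R⟦X⟧ := C t.j₂ + lambert fun m => (m : R) ^ 2 * t.s m
def J₃ : R⟦X⟧ := C t.j₃ + lambert fun m => (m : R) ^ 3 * t.c m
def J₄ : R⟦X⟧ := C t.j₄ + lambert fun m => (m : R) ^ 4 * t.s m

end Ring

section

variable {R : Type*} [CommRing R] [Algebra ℂ R] (t : TorusPoint R) {D : Derivation ℂ R R} {r : ℂ}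

theorem D_xi (h : D t.x = r • t.x) : D t.xi = -(r • t.xi) := by
  have h1 : D (t.x * t.xi) = 0 := by rw [t.mul_inv, D.map_one_eq_zero]
  rw [D.leibniz, h, smul_eq_mul, smul_eq_mul] at h1
  simp only [Algebra.smul_def] at h1 ⊢
  linear_combination t.xi * h1 - (D t.xi + algebraMap ℂ R r * t.xi) * t.mul_inv

theorem D_j (h : D t.x = r • t.x) : D t.j = r • t.j₁ := by
  have h4 : IsUnit (4 : R) := by
    rw [← map_ofNat (algebraMap ℂ R) 4]
    exact IsUnit.map _ (by norm_num)
  refine (h4.mul t.isUnit_one_sub).mul_left_cancel ?_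
  have h1 := congrArg D t.two_mul_j
  have h2 : D (2 : R) = 0 := by simpa using D.map_natCast 2
  simp only [Derivation.leibniz, map_sub, map_add, D.map_one_eq_zero, h, h2, smul_eq_mul] at h1
  have h3 := t.four_mul_j₁
  have h5 := t.two_mul_j
  simp only [Algebra.smul_def] at h1 ⊢
  linear_combination 2 * h1 - algebraMap ℂ R r * (1 - t.x) * h3
    - algebraMap ℂ R r * (2 * t.j + 1) * h5

theorem D_j₁ (h : D t.x = r • t.x) : D t.j₁ = r • t.j₂ := by
  have h4 : IsUnit (4 : R) := by
    rw [← map_ofNat (algebraMap ℂ R) 4]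
    exact IsUnit.map _ (by norm_num)
  refine h4.mul_left_cancel ?_
  have h1 := congrArg D t.four_mul_j₁
  have h2 : D (4 : R) = 0 := by simpa using D.map_natCast 4
  simp only [Derivation.leibniz, map_sub, D.map_one_eq_zero, h2, smul_eq_mul, pow_two,
    t.D_j h] at h1
  rw [j₂]
  simp only [Algebra.smul_def] at h1 ⊢
  linear_combination h1

theorem D_ofNat (D : Derivation ℂ R R) (n : ℕ) [n.AtLeastTwo] :
    D (no_index (OfNat.ofNat n : R)) = 0 := by
  rw [← Nat.cast_ofNat (R := R)]
  exact D.map_natCast _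

theorem D_j₂ (h : D t.x = r • t.x) : D t.j₂ = r • t.j₃ := by
  rw [j₂, j₃]
  simp only [Derivation.leibniz, smul_eq_mul, t.D_j h, t.D_j₁ h, D_ofNat, Algebra.smul_def]
  ring

theorem D_j₃ (h : D t.x = r • t.x) : D t.j₃ = r • t.j₄ := by
  rw [j₃, j₄, pow_two]
  simp only [Derivation.leibniz, smul_eq_mul, t.D_j h, t.D_j₁ h, t.D_j₂ h, D_ofNat,
    Algebra.smul_def, map_add]
  ring

theorem D_s (h : D t.x = r • t.x) (m : ℕ) : D (t.s m) = r • (m * t.c m) := by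
  rw [s, c, map_sub, D.leibniz_pow, D.leibniz_pow, h, t.D_xi h]
  rcases m with _ | m
  · simp
  · simp only [nsmul_eq_mul, smul_eq_mul, Nat.add_sub_cancel, pow_succ]
    simp only [Algebra.smul_def]
    ring

theorem D_c (h : D t.x = r • t.x) (m : ℕ) : D (t.c m) = r • (m * t.s m) := by
  rw [s, c, map_add, D.leibniz_pow, D.leibniz_pow, h, t.D_xi h]
  rcases m with _ | m
  · simp
  · simp only [nsmul_eq_mul, smul_eq_mul, Nat.add_sub_cancel, pow_succ]
    simp only [Algebra.smul_def]
    ring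

theorem smul_lambert (g : ℕ → R) : r • lambert g = lambert fun m => r • g m := by
  ext n
  simp only [coeff_smul, coeff_lambert, smul_sum]

theorem smul_C (a : R) : r • (C a : R⟦X⟧) = C (r • a) := by
  ext n
  rw [coeff_smul, coeff_C, coeff_C]
  split <;> simp

theorem D_natCast_pow_mul (D : Derivation ℂ R R) (m k : ℕ) (a : R) :
    D ((m : R) ^ k * a) = (m : R) ^ k * D a := by
  rw [← Nat.cast_pow, D.leibniz, D.map_natCast]
  simp

theorem coeffDeriv_J₀ (h : D t.x = r • t.x) : coeffDeriv D t.J₀ = r • t.J₁ := by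
  rw [J₀, J₁, map_add, coeffDeriv_C, coeffDeriv_lambert, smul_add, smul_lambert, smul_C, t.D_j h]
  simp only [t.D_s h]

theorem coeffDeriv_J₁ (h : D t.x = r • t.x) : coeffDeriv D t.J₁ = r • t.J₂ := by
  rw [J₁, J₂, map_add, coeffDeriv_C, coeffDeriv_lambert, smul_add, smul_lambert, smul_C, t.D_j₁ h]
  congr 2
  funext m
  have := D_natCast_pow_mul D m 1 (t.c m)
  rw [pow_one] at this
  rw [this, t.D_c h]
  simp only [Algebra.smul_def]
  ring

theorem coeffDeriv_J₂ (h : D t.x = r • t.x) : coeffDeriv D t.J₂ = r • t.J₃ := by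
  rw [J₂, J₃, map_add, coeffDeriv_C, coeffDeriv_lambert, smul_add, smul_lambert, smul_C, t.D_j₂ h]
  congr 2
  funext m
  rw [D_natCast_pow_mul, t.D_s h]
  simp only [Algebra.smul_def]
  ring

theorem coeffDeriv_J₃ (h : D t.x = r • t.x) : coeffDeriv D t.J₃ = r • t.J₄ := by
  rw [J₃, J₄, map_add, coeffDeriv_C, coeffDeriv_lambert, smul_add, smul_lambert, smul_C, t.D_j₃ h]
  congr 2
  funext m
  rw [D_natCast_pow_mul, t.D_c h]
  simp only [Algebra.smul_def]
  ring

omit [Algebra ℂ R] in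
-- In the coefficient of order n = m b, the weight b times the factor m is n: this is how
-- x-derivatives turn into q-derivatives. The constant `a` is free because the Euler operator kills
-- it.
theorem lambertSq_mul (g : ℕ → R) (a : R) :
    lambertSq (fun m => (m : R) * g m) = euler (C a + lambert g) := by
  ext n
  rw [coeff_euler, coeff_lambertSq, map_add, coeff_lambert, coeff_C, mul_add]
  have : (n : R) * (if n = 0 then a else 0) = 0 := by
    split_ifs with h
    · simp [h]
    · simp
  rw [this, zero_add, mul_sum]
  refine sum_congr rfl fun p hp => ?_
  rw [← (Nat.mem_divisorsAntidiagonal.1 hp).1]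
  push_cast
  ring

theorem isUnit_natCast {n : ℕ} (hn : n ≠ 0) : IsUnit (n : R⟦X⟧) := by
  rw [← map_natCast (algebraMap ℂ R⟦X⟧) n]
  exact IsUnit.map _ (by simpa using hn)

/-- The x-derivative of Ramanujan's identity: the term `lambertSq t.c` becomes q d/dq of J₀ and the
term independent of x disappears. The formulas for J₁ and J₂ follow by differentiating again in x,
which commutes with the Euler operator. -/
theorem euler_J₀ (h : D t.x = t.x) : 2 * euler t.J₀ = t.J₂ - 2 * t.J₀ * t.J₁ := by
  have h' : D t.x = (1 : ℂ) • t.x := by rw [one_smul, h]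
  have h1 := congrArg (coeffDeriv D) t.J₀_sq
  simp only [map_sub, map_add, Derivation.leibniz, smul_eq_mul, pow_two, t.coeffDeriv_J₀ h',
    t.coeffDeriv_J₁ h', one_smul, D_ofNat, coeffDeriv_lambertSq, Derivation.map_one_eq_zero,
    t.D_c h'] at h1
  have h2 := lambertSq_mul t.s t.j
  have h3 : lambertSq (fun _ => (0 : R)) = 0 := by
    ext n; simp [coeff_lambertSq]
  rw [h3] at h1
  rw [← J₀] at h2
  rw [h2] at h1
  refine (isUnit_natCast (R := R) (n := 4) (by norm_num)).mul_left_cancel ?_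
  push_cast
  linear_combination h1

theorem euler_J₁ (h : D t.x = t.x) :
    2 * euler t.J₁ = t.J₃ - 2 * t.J₁ ^ 2 - 2 * t.J₀ * t.J₂ := by
  have h' : D t.x = (1 : ℂ) • t.x := by rw [one_smul, h]
  have h1 := congrArg (coeffDeriv D) (t.euler_J₀ h)
  simp only [map_sub, Derivation.leibniz, smul_eq_mul, t.coeffDeriv_J₀ h', t.coeffDeriv_J₂ h',
    t.coeffDeriv_J₁ h', one_smul, D_ofNat, coeffDeriv_euler] at h1
  linear_combination h1

theorem euler_J₂ (h : D t.x = t.x) :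
    2 * euler t.J₂ = t.J₄ - 6 * t.J₁ * t.J₂ - 2 * t.J₀ * t.J₃ := by
  have h' : D t.x = (1 : ℂ) • t.x := by rw [one_smul, h]
  have h1 := congrArg (coeffDeriv D) (t.euler_J₁ h)
  simp only [map_sub, Derivation.leibniz, smul_eq_mul, t.coeffDeriv_J₀ h', t.coeffDeriv_J₂ h',
    t.coeffDeriv_J₁ h', t.coeffDeriv_J₃ h', one_smul, D_ofNat, coeffDeriv_euler, pow_two] at h1
  linear_combination h1

end

section Addition

variable {R : Type*} [CommRing R] [Algebra ℂ R] {t₁ t₂ t₃ : TorusPoint R} {D : Derivation ℂ R R}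
  {r₁ r₂ r₃ : ℂ}

/-- The weight two series `lambertSq 1` in the addition theorem does not depend on the points, so
one derivative removes it. Two further derivatives give the relations involving J₃ and J₄. -/
theorem addition_deriv (h : t₁.x * t₂.x * t₃.x = 1) (h₁ : D t₁.x = r₁ • t₁.x)
    (h₂ : D t₂.x = r₂ • t₂.x) (h₃ : D t₃.x = r₃ • t₃.x) :
    2 * (t₁.J₀ + t₂.J₀ + t₃.J₀) * (r₁ • t₁.J₁ + r₂ • t₂.J₁ + r₃ • t₃.J₁) =
      r₁ • t₁.J₂ + r₂ • t₂.J₂ + r₃ • t₃.J₂ := by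
  have h0 := congrArg (coeffDeriv D) (J₀_add_sq t₁ t₂ t₃ h)
  have h3 : lambertSq (fun _ => (0 : R)) = 0 := by
    ext n; simp [coeff_lambertSq]
  simp only [map_sub, map_add, Derivation.leibniz, smul_eq_mul, pow_two, t₁.coeffDeriv_J₀ h₁,
    t₂.coeffDeriv_J₀ h₂, t₃.coeffDeriv_J₀ h₃, t₁.coeffDeriv_J₁ h₁, t₂.coeffDeriv_J₁ h₂,
    t₃.coeffDeriv_J₁ h₃, D_ofNat, coeffDeriv_lambertSq, Derivation.map_one_eq_zero, h3] at h0
  refine (isUnit_natCast (R := R) (n := 4) (by norm_num)).mul_left_cancel ?_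
  push_cast
  linear_combination h0

theorem addition_deriv₂ (h : t₁.x * t₂.x * t₃.x = 1) (h₁ : D t₁.x = r₁ • t₁.x)
    (h₂ : D t₂.x = r₂ • t₂.x) (h₃ : D t₃.x = r₃ • t₃.x) :
    2 * (r₁ • t₁.J₁ + r₂ • t₂.J₁ + r₃ • t₃.J₁) ^ 2 + 2 * (t₁.J₀ + t₂.J₀ + t₃.J₀) *
      (r₁ • r₁ • t₁.J₂ + r₂ • r₂ • t₂.J₂ + r₃ • r₃ • t₃.J₂) =
      r₁ • r₁ • t₁.J₃ + r₂ • r₂ • t₂.J₃ + r₃ • r₃ • t₃.J₃ := by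
  have h0 := congrArg (coeffDeriv D) (addition_deriv h h₁ h₂ h₃)
  simp only [map_add, Derivation.leibniz, smul_eq_mul, t₁.coeffDeriv_J₀ h₁,
    t₂.coeffDeriv_J₀ h₂, t₃.coeffDeriv_J₀ h₃, t₁.coeffDeriv_J₁ h₁, t₂.coeffDeriv_J₁ h₂,
    t₃.coeffDeriv_J₁ h₃, t₁.coeffDeriv_J₂ h₁, t₂.coeffDeriv_J₂ h₂, t₃.coeffDeriv_J₂ h₃,
    D_ofNat, Derivation.map_smul] at h0
  linear_combination h0

theorem addition_deriv₃ (h : t₁.x * t₂.x * t₃.x = 1) (h₁ : D t₁.x = r₁ • t₁.x)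
    (h₂ : D t₂.x = r₂ • t₂.x) (h₃ : D t₃.x = r₃ • t₃.x) :
    6 * (r₁ • t₁.J₁ + r₂ • t₂.J₁ + r₃ • t₃.J₁) *
      (r₁ • r₁ • t₁.J₂ + r₂ • r₂ • t₂.J₂ + r₃ • r₃ • t₃.J₂)
      + 2 * (t₁.J₀ + t₂.J₀ + t₃.J₀) *
      (r₁ • r₁ • r₁ • t₁.J₃ + r₂ • r₂ • r₂ • t₂.J₃ + r₃ • r₃ • r₃ • t₃.J₃) =
      r₁ • r₁ • r₁ • t₁.J₄ + r₂ • r₂ • r₂ • t₂.J₄ + r₃ • r₃ • r₃ • t₃.J₄ := by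
  have h0 := congrArg (coeffDeriv D) (addition_deriv₂ h h₁ h₂ h₃)
  simp only [map_add, Derivation.leibniz, smul_eq_mul, t₁.coeffDeriv_J₀ h₁,
    t₂.coeffDeriv_J₀ h₂, t₃.coeffDeriv_J₀ h₃, t₁.coeffDeriv_J₁ h₁, t₂.coeffDeriv_J₁ h₂,
    t₃.coeffDeriv_J₁ h₃, t₁.coeffDeriv_J₂ h₁, t₂.coeffDeriv_J₂ h₂, t₃.coeffDeriv_J₂ h₃,
    t₁.coeffDeriv_J₃ h₁, t₂.coeffDeriv_J₃ h₂, t₃.coeffDeriv_J₃ h₃,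
    D_ofNat, Derivation.map_smul, pow_two] at h0
  linear_combination h0

end Addition

end TorusPoint

/-! ### Formal deformation of complex points and specialisation at ε = 0 -/

namespace TorusPoint

/-- `exp (r ε)` as a power series in `ε`. -/
def expScale (r : ℂ) : ℂ⟦X⟧ := rescale r (PowerSeries.exp ℂ)

theorem expScale_mul (r s : ℂ) : expScale r * expScale s = expScale (r + s) :=
  exp_mul_exp_eq_exp_add r s

theorem expScale_zero : expScale 0 = 1 := by
  rw [expScale, rescale_zero_apply, constantCoeff_exp, map_one]

theorem constantCoeff_expScale (r : ℂ) : constantCoeff (expScale r) = 1 := by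
  rw [expScale, ← coeff_zero_eq_constantCoeff_apply, coeff_rescale]
  simp

theorem derivative_expScale (r : ℂ) : derivative ℂ (expScale r) = r • expScale r := by
  ext n
  have h := congrArg (coeff n) (derivative_exp ℂ)
  rw [coeff_derivative] at h
  rw [coeff_derivative, expScale, coeff_rescale, coeff_smul, coeff_rescale, ← h, smul_eq_mul]
  ring

/-- The deformation `x exp (r ε)` of the point `t = x`. -/
def deform (t : TorusPoint ℂ) (r : ℂ) : TorusPoint ℂ⟦X⟧ where
  x := C t.x * expScale r
  xi := C t.xi * expScale (-r)
  j := C (1 / 2) * (1 + C t.x * expScale r) * (1 - C t.x * expScale r)⁻¹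
  j₁ := (C (1 / 2) * (1 + C t.x * expScale r) * (1 - C t.x * expScale r)⁻¹) ^ 2 - C (1 / 4)
  mul_inv := by
    have h1 := expScale_mul r (-r)
    rw [add_neg_cancel, expScale_zero] at h1
    have h2 : (C t.x * C t.xi : ℂ⟦X⟧) = 1 := by rw [← map_mul, t.mul_inv, map_one]
    linear_combination C t.x * C t.xi * h1 + h2
  two_mul_j := by
    have h : (1 - C t.x * expScale r)⁻¹ * (1 - C t.x * expScale r) = 1 := by
      refine PowerSeries.inv_mul_cancel _ ?_
      simp only [map_sub, map_one, map_mul, constantCoeff_C, constantCoeff_expScale, mul_one]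
      exact t.isUnit_one_sub.ne_zero
    have h2 : (2 * C (1 / 2) : ℂ⟦X⟧) = 1 := by
      rw [← map_ofNat C, ← map_mul]
      norm_num
    linear_combination 2 * C (1 / 2) * (1 + C t.x * expScale r) * h
      + (1 + C t.x * expScale r) * h2
  four_mul_j₁ := by
    have h2 : (4 * C (1 / 4) : ℂ⟦X⟧) = 1 := by
      rw [← map_ofNat C, ← map_mul]
      norm_num
    linear_combination -h2
  isUnit_one_sub := by
    rw [PowerSeries.isUnit_iff_constantCoeff]
    simpa [constantCoeff_expScale] using t.isUnit_one_sub

theorem derivative_deform_x (t : TorusPoint ℂ) (r : ℂ) :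
    derivative ℂ (t.deform r).x = r • (t.deform r).x := by
  rw [deform]
  simp only [Derivation.leibniz, derivative_expScale, derivative_C, smul_eq_mul, mul_zero,
    add_zero, mul_smul_comm]

section Map

variable {R S : Type*} [CommRing R] [CommRing S] (φ : R →+* S)

theorem map_lambert (g : ℕ → R) :
    PowerSeries.map φ (lambert g) = lambert fun m => φ (g m) := by
  ext n
  rw [coeff_map, coeff_lambert, coeff_lambert, map_sum]

theorem map_euler (f : R⟦X⟧) : PowerSeries.map φ (euler f) = euler (PowerSeries.map φ f) := by
  ext n
  simp [coeff_euler]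

variable {t : TorusPoint R} {t' : TorusPoint S}

theorem map_J (hx : φ t.x = t'.x) (hxi : φ t.xi = t'.xi) (hj : φ t.j = t'.j)
    (hj₁ : φ t.j₁ = t'.j₁) : PowerSeries.map φ t.J₀ = t'.J₀ ∧ PowerSeries.map φ t.J₁ = t'.J₁ ∧
    PowerSeries.map φ t.J₂ = t'.J₂ ∧ PowerSeries.map φ t.J₃ = t'.J₃ ∧
    PowerSeries.map φ t.J₄ = t'.J₄ := by
  have hs (m : ℕ) : φ (t.s m) = t'.s m := by simp only [s, map_sub, map_pow, hx, hxi]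
  have hc (m : ℕ) : φ (t.c m) = t'.c m := by simp only [c, map_add, map_pow, hx, hxi]
  have hj₂ : φ t.j₂ = t'.j₂ := by simp only [j₂, map_mul, map_ofNat, hj, hj₁]
  have hj₃ : φ t.j₃ = t'.j₃ := by simp only [j₃, map_add, map_pow, map_mul, map_ofNat, hj, hj₁, hj₂]
  have hj₄ : φ t.j₄ = t'.j₄ := by simp only [j₄, map_add, map_mul, map_ofNat, hj, hj₁, hj₂, hj₃]
  refine ⟨?_, ?_, ?_, ?_, ?_⟩ <;>
  simp only [J₀, J₁, J₂, J₃, J₄, map_add, map_C, map_lambert, map_mul, map_pow, map_natCast,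
    hs, hc, hj, hj₁, hj₂, hj₃, hj₄]

end Map

/-- Setting ε = 0 recovers the series of the undeformed point, so identities obtained with d/dε over
ℂ⟦ε⟧ descend to ℂ. -/
theorem map_deform (t : TorusPoint ℂ) (r : ℂ) :
    PowerSeries.map constantCoeff (t.deform r).J₀ = t.J₀ ∧
    PowerSeries.map constantCoeff (t.deform r).J₁ = t.J₁ ∧
    PowerSeries.map constantCoeff (t.deform r).J₂ = t.J₂ ∧
    PowerSeries.map constantCoeff (t.deform r).J₃ = t.J₃ ∧
    PowerSeries.map constantCoeff (t.deform r).J₄ = t.J₄ := by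
  have hj : constantCoeff (t.deform r).j = t.j := by
    have h := congrArg constantCoeff (t.deform r).two_mul_j
    have hx : constantCoeff (t.deform r).x = t.x := by simp [deform, constantCoeff_expScale]
    simp only [map_mul, map_sub, map_add, map_one, map_ofNat, hx] at h
    rw [← t.two_mul_j] at h
    have := t.isUnit_one_sub.mul_right_cancel h
    exact mul_left_cancel₀ two_ne_zero this
  refine map_J _ ?_ ?_ hj ?_
  · simp [deform, constantCoeff_expScale]
  · simp [deform, constantCoeff_expScale]
  · have h := congrArg constantCoeff (t.deform r).four_mul_j₁
    simp only [map_mul, map_sub, map_pow, map_one, map_ofNat, hj] at h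
    rw [← t.four_mul_j₁] at h
    exact mul_left_cancel₀ (by norm_num) h

theorem euler_eq_theta (f : ℂ⟦X⟧) : euler f = theta f := by
  ext n
  rw [coeff_euler, coeff_theta]

theorem map_smul_deform (r : ℂ) (f : ℂ⟦X⟧⟦X⟧) :
    PowerSeries.map (constantCoeff (R := ℂ)) (r • f) = r • PowerSeries.map constantCoeff f := by
  ext n
  simp

variable (t t₁ t₂ t₃ : TorusPoint ℂ)

theorem theta_J : 2 * theta t.J₀ = t.J₂ - 2 * t.J₀ * t.J₁ ∧
    2 * theta t.J₁ = t.J₃ - 2 * t.J₁ ^ 2 - 2 * t.J₀ * t.J₂ ∧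
    2 * theta t.J₂ = t.J₄ - 6 * t.J₁ * t.J₂ - 2 * t.J₀ * t.J₃ := by
  have h := t.derivative_deform_x 1
  rw [one_smul] at h
  have h0 := congrArg (PowerSeries.map constantCoeff) ((t.deform 1).euler_J₀ h)
  have h1 := congrArg (PowerSeries.map constantCoeff) ((t.deform 1).euler_J₁ h)
  have h2 := congrArg (PowerSeries.map constantCoeff) ((t.deform 1).euler_J₂ h)
  obtain ⟨e0, e1, e2, e3, e4⟩ := t.map_deform 1
  simp only [map_mul, map_sub, map_pow, map_ofNat, map_euler, e0, e1, e2, e3, e4,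
    euler_eq_theta] at h0 h1 h2
  exact ⟨h0, h1, h2⟩

variable {t₁ t₂ t₃}

/-- The condition on the exponents keeps the deformed triple on the surface x₁x₂x₃ = 1, where the
addition theorem applies. -/
theorem deform_mul (h : t₁.x * t₂.x * t₃.x = 1) {r₁ r₂ r₃ : ℂ} (hr : r₁ + r₂ + r₃ = 0) :
    (t₁.deform r₁).x * (t₂.deform r₂).x * (t₃.deform r₃).x = 1 := by
  have h1 := expScale_mul (r₁ + r₂) r₃
  rw [hr, expScale_zero, ← expScale_mul] at h1
  have h2 : (C t₁.x * C t₂.x * C t₃.x : ℂ⟦X⟧) = 1 := by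
    rw [← map_mul, ← map_mul, h, map_one]
  change C t₁.x * expScale r₁ * (C t₂.x * expScale r₂) * (C t₃.x * expScale r₃) = 1
  linear_combination C t₁.x * C t₂.x * C t₃.x * h1 + h2

/-- The direction (r₁, r₂, r₃) is free in a plane. When points coincide or are mutually inverse,
well-chosen directions make terms vanish and isolate single J_k. -/
theorem addition (h : t₁.x * t₂.x * t₃.x = 1) (r₁ r₂ r₃ : ℂ) (hr : r₁ + r₂ + r₃ = 0) :
    2 * (t₁.J₀ + t₂.J₀ + t₃.J₀) * (r₁ • t₁.J₁ + r₂ • t₂.J₁ + r₃ • t₃.J₁) =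
      r₁ • t₁.J₂ + r₂ • t₂.J₂ + r₃ • t₃.J₂ := by
  have h0 := congrArg (PowerSeries.map constantCoeff) (addition_deriv (deform_mul h hr)
    (derivative_deform_x t₁ r₁) (derivative_deform_x t₂ r₂) (derivative_deform_x t₃ r₃))
  obtain ⟨a0, a1, a2, a3, a4⟩ := t₁.map_deform r₁
  obtain ⟨b0, b1, b2, b3, b4⟩ := t₂.map_deform r₂
  obtain ⟨c0, c1, c2, c3, c4⟩ := t₃.map_deform r₃
  simpa only [map_mul, map_add, map_ofNat, map_smul_deform, a0, a1, a2, b0, b1, b2, c0, c1, c2]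
    using h0

theorem addition₂ (h : t₁.x * t₂.x * t₃.x = 1) (r₁ r₂ r₃ : ℂ) (hr : r₁ + r₂ + r₃ = 0) :
    2 * (r₁ • t₁.J₁ + r₂ • t₂.J₁ + r₃ • t₃.J₁) ^ 2 + 2 * (t₁.J₀ + t₂.J₀ + t₃.J₀) *
      (r₁ • r₁ • t₁.J₂ + r₂ • r₂ • t₂.J₂ + r₃ • r₃ • t₃.J₂) =
      r₁ • r₁ • t₁.J₃ + r₂ • r₂ • t₂.J₃ + r₃ • r₃ • t₃.J₃ := by
  have h0 := congrArg (PowerSeries.map constantCoeff) (addition_deriv₂ (deform_mul h hr)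
    (derivative_deform_x t₁ r₁) (derivative_deform_x t₂ r₂) (derivative_deform_x t₃ r₃))
  obtain ⟨a0, a1, a2, a3, a4⟩ := t₁.map_deform r₁
  obtain ⟨b0, b1, b2, b3, b4⟩ := t₂.map_deform r₂
  obtain ⟨c0, c1, c2, c3, c4⟩ := t₃.map_deform r₃
  simpa only [map_mul, map_pow, map_add, map_ofNat, map_smul_deform, a0, a1, a2, a3, b0, b1, b2,
    b3, c0, c1, c2, c3] using h0

theorem addition₃ (h : t₁.x * t₂.x * t₃.x = 1) (r₁ r₂ r₃ : ℂ) (hr : r₁ + r₂ + r₃ = 0) :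
    6 * (r₁ • t₁.J₁ + r₂ • t₂.J₁ + r₃ • t₃.J₁) *
      (r₁ • r₁ • t₁.J₂ + r₂ • r₂ • t₂.J₂ + r₃ • r₃ • t₃.J₂)
      + 2 * (t₁.J₀ + t₂.J₀ + t₃.J₀) *
      (r₁ • r₁ • r₁ • t₁.J₃ + r₂ • r₂ • r₂ • t₂.J₃ + r₃ • r₃ • r₃ • t₃.J₃) =
      r₁ • r₁ • r₁ • t₁.J₄ + r₂ • r₂ • r₂ • t₂.J₄ + r₃ • r₃ • r₃ • t₃.J₄ := by
  have h0 := congrArg (PowerSeries.map constantCoeff) (addition_deriv₃ (deform_mul h hr)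
    (derivative_deform_x t₁ r₁) (derivative_deform_x t₂ r₂) (derivative_deform_x t₃ r₃))
  obtain ⟨a0, a1, a2, a3, a4⟩ := t₁.map_deform r₁
  obtain ⟨b0, b1, b2, b3, b4⟩ := t₂.map_deform r₂
  obtain ⟨c0, c1, c2, c3, c4⟩ := t₃.map_deform r₃
  simpa only [map_mul, map_add, map_ofNat, map_smul_deform, a0, a1, a2, a3, a4, b0, b1, b2,
    b3, b4, c0, c1, c2, c3, c4] using h0

/-- The inverse of a point. -/
def symm {R : Type*} [CommRing R] (t : TorusPoint R) : TorusPoint R where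
  x := t.xi
  xi := t.x
  j := -t.j
  j₁ := t.j₁
  mul_inv := by rw [mul_comm, t.mul_inv]
  two_mul_j := by linear_combination -t.two_mul_j_inv
  four_mul_j₁ := by linear_combination t.four_mul_j₁
  isUnit_one_sub := by
    have h : (1 - t.xi) = (1 - t.x) * (-t.xi) := by linear_combination -t.mul_inv
    rw [h]
    exact t.isUnit_one_sub.mul (IsUnit.neg (IsUnit.of_mul_eq_one t.x (by
      rw [mul_comm, t.mul_inv])))

theorem J_symm : t.symm.J₀ = -t.J₀ ∧ t.symm.J₁ = t.J₁ ∧ t.symm.J₂ = -t.J₂ ∧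
    t.symm.J₃ = t.J₃ := by
  refine ⟨?_, ?_, ?_, ?_⟩ <;> ext n <;>
  simp only [J₀, J₁, J₂, J₃, map_add, map_neg, coeff_lambert, coeff_C, neg_add, ← sum_neg_distrib]
  all_goals
    refine congrArg₂ (· + ·) ?_ ?_
    · by_cases hn : n = 0 <;> simp [symm, j₂, j₃, hn]
    · refine sum_congr rfl fun p _ => ?_
      simp only [symm, s, c]
      ring

/-- The point with coordinate `x ≠ 0, 1`. -/
def ofNe (x : ℂ) (h0 : x ≠ 0) (h1 : x ≠ 1) : TorusPoint ℂ where
  x := x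
  xi := x⁻¹
  j := (1 + x) / (2 * (1 - x))
  j₁ := x / (1 - x) ^ 2
  mul_inv := mul_inv_cancel₀ h0
  two_mul_j := by
    have : 1 - x ≠ 0 := sub_ne_zero.2 h1.symm
    field_simp
  four_mul_j₁ := by
    have : 1 - x ≠ 0 := sub_ne_zero.2 h1.symm
    field_simp
    ring
  isUnit_one_sub := (sub_ne_zero.2 h1.symm).isUnit

end TorusPoint

/-! ### Characterization of the extremal series -/

theorem theta_add (f g : ℂ⟦X⟧) : theta (f + g) = theta f + theta g := by
  simp only [theta, map_add]; ring

theorem theta_sub (f g : ℂ⟦X⟧) : theta (f - g) = theta f - theta g := by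
  simp only [theta, map_sub]; ring

theorem theta_mul (f g : ℂ⟦X⟧) : theta (f * g) = theta f * g + f * theta g := by
  simp only [theta, Derivation.leibniz, smul_eq_mul]; ring

theorem theta_C (a : ℂ) : theta (C a) = 0 := by
  simp only [theta, derivative_C, mul_zero]

theorem theta_X : theta X = X := by
  simp [theta]

theorem theta_C_mul (a : ℂ) (f : ℂ⟦X⟧) : theta (C a * f) = C a * theta f := by
  rw [theta_mul, theta_C, zero_mul, zero_add]

theorem theta_ofNat_mul (n : ℕ) [n.AtLeastTwo] (f : ℂ⟦X⟧) :
    theta (no_index (OfNat.ofNat n : ℂ⟦X⟧) * f) = no_index (OfNat.ofNat n) * theta f := by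
  rw [← map_ofNat C, theta_C_mul]

theorem theta_sq (f : ℂ⟦X⟧) : theta (f ^ 2) = 2 * f * theta f := by
  rw [pow_two, theta_mul]; ring

theorem theta_cube (f : ℂ⟦X⟧) : theta (f ^ 3) = 3 * f ^ 2 * theta f := by
  rw [pow_succ, theta_mul, theta_sq]; ring

theorem theta_subst {r : ℂ⟦X⟧} (hr : HasSubst r) (g : ℂ⟦X⟧) :
    theta (g.subst r) = (derivative ℂ g).subst r * theta r := by
  rw [theta, theta, derivative_subst hr]
  ring

theorem subst_theta {r : ℂ⟦X⟧} (hr : HasSubst r) (g : ℂ⟦X⟧) :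
    (theta g).subst r = r * (derivative ℂ g).subst r := by
  rw [theta, subst_mul hr, subst_X hr]

/-- Solutions of `w θ y = k y` are determined by their coefficient of order `k`. -/
theorem eq_zero_of_theta {w y : ℂ⟦X⟧} (k : ℕ) (hw : constantCoeff w = 1)
    (h : w * theta y = C (k : ℂ) * y) (hk : coeff k y = 0) : y = 0 := by
  ext n
  rw [map_zero]
  induction n using Nat.strong_induction_on with
  | _ n ih =>
    have h1 := congrArg (coeff n) h
    rw [coeff_mul, sum_eq_single (0, n), coeff_zero_eq_constantCoeff_apply, hw, coeff_C_mul,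
      coeff_theta, one_mul] at h1
    · rcases eq_or_ne n k with rfl | hn
      · exact hk
      · have h2 : ((n : ℂ) - k) * coeff n y = 0 := by linear_combination h1
        exact (mul_eq_zero.1 h2).resolve_left (sub_ne_zero.2 (by exact_mod_cast hn))
    · rintro ⟨a, b⟩ hab hne
      rw [HasAntidiagonal.mem_antidiagonal] at hab
      have hb : b < n := by
        rcases Nat.eq_zero_or_pos a with rfl | ha
        · simp at hab; exact absurd (by rw [hab]) hne
        · simp only at hab; omega
      simp only [coeff_theta, ih b hb, mul_zero]
    · intro hn
      exact absurd (by simp) hn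

theorem eq_modularCoordinate (d : Case) {y : ℂ⟦X⟧} (h : u d * f d ^ 2 * theta y = y)
    (h1 : coeff 1 y = -1) : y = modularCoordinate d := by
  rw [← sub_eq_zero]
  refine eq_zero_of_theta 1 (w := u d * f d ^ 2) (by simp [constantCoeff_u, constantCoeff_f]) ?_ ?_
  · rw [theta_sub, Nat.cast_one, map_one]
    linear_combination h - modularCoordinate_theta d
  · rw [map_sub, h1, coeff_one_modularCoordinate, sub_self]

theorem eq_pSeries (d : Case) {P : ℂ⟦X⟧} (hP : constantCoeff P = 0)
    (h : (modularCoordinate d).subst P = X) : P = pSeries d := by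
  have hP' : HasSubst P := HasSubst.of_constantCoeff_zero' hP
  have hm : HasSubst (modularCoordinate d) :=
    HasSubst.of_constantCoeff_zero' (constantCoeff_modularCoordinate d)
  have h1 : (pSeries d).subst (modularCoordinate d) = X :=
    subst_substInvOfIsUnit_left _ (constantCoeff_modularCoordinate d) _
  have h2 := subst_comp_subst_apply hm hP' (pSeries d)
  rw [h1, h, subst_X hP', ← map_algebraMap_eq_subst_X] at h2
  simpa using h2

/-- If `P` and `F` satisfy the differential equations that express, in the coordinate `q`, the
definitions of the modular coordinate and of `f_d`, then `E_d = u_d(P) F ^ 3`. -/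
theorem extremalQ_eq (d : Case) {F P U : ℂ⟦X⟧} (hU : U = 1 + C (kappa d) * P - C (mu d) * P ^ 2)
    (hF : constantCoeff F = 1) (hP0 : constantCoeff P = 0) (hP1 : coeff 1 P = -1)
    (hA : theta P = P * U * F ^ 2)
    (hB : F * theta (theta F) - 2 * theta F ^ 2
      + (C (lam d) * P - C (mu d) * P ^ 2) * U * F ^ 6 = 0) :
    extremalQ d = U * F ^ 3 := by
  have hPu : IsUnit (coeff 1 P) := by rw [hP1]; exact isUnit_one.neg
  have hPs : HasSubst P := HasSubst.of_constantCoeff_zero' hP0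
  -- Here r is q as a power series in P, and substituting r rewrites identities in q in the
  -- coordinate P.
  set r := substInvOfIsUnit P hPu with hr
  have hr0 : constantCoeff r = 0 := constantCoeff_substInvOfIsUnit _ _
  have hrs : HasSubst r := HasSubst.of_constantCoeff_zero' hr0
  have hPr : P.subst r = X := subst_substInvOfIsUnit_right _ hP0 _
  have hrP : r.subst P = X := subst_substInvOfIsUnit_left _ hP0 _
  have hC : ∀ a : ℂ, (C a).subst r = (C a : ℂ⟦X⟧) := fun a => subst_C a
  set F' := F.subst r with hF'
  have hU' : U.subst r = u d := by
    rw [hU, subst_sub hrs, subst_add hrs, subst_mul hrs, subst_mul hrs, subst_pow hrs, hPr, hC, hC,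
      ← map_one C, hC, map_one, u]
  have hA' := congrArg (subst r) hA
  rw [subst_theta hrs, subst_mul hrs, subst_mul hrs, subst_pow hrs, hPr, hU', ← hF'] at hA'
  have hX := theta_subst hrs P
  rw [hPr, theta_X] at hX
  have hrθ : u d * F' ^ 2 * theta r = r := by
    refine mul_left_cancel₀ (X_ne_zero (R := ℂ)) ?_
    linear_combination -theta r * hA' - r * hX
  -- The chain rule q d/dq = u F'² P d/dP, by the first differential equation.
  have hθ : ∀ g : ℂ⟦X⟧, (theta g).subst r = u d * F' ^ 2 * theta (g.subst r) := by
    intro g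
    rw [subst_theta hrs, theta_subst hrs]
    linear_combination -((derivative ℂ g).subst r) * hrθ
  have hF0 : constantCoeff F' = 1 := by
    have h1 : constantCoeff ((F - 1).subst r) = 0 :=
      constantCoeff_subst_eq_zero hr0 _ (by rw [map_sub, hF, map_one, sub_self])
    rw [subst_sub hrs, ← map_one C, hC, map_one] at h1
    have h2 : constantCoeff (F' - 1) = 0 := h1
    rw [map_sub, map_one] at h2
    linear_combination h2
  have hB' := congrArg (subst r) hB
  have h0 : (0 : ℂ⟦X⟧).subst r = 0 := by rw [← map_zero C, hC]
  have h2 : (2 : ℂ⟦X⟧).subst r = 2 := by rw [← map_ofNat C, hC]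
  rw [subst_add hrs, subst_sub hrs, subst_mul hrs, subst_mul hrs, subst_mul hrs, subst_mul hrs,
    subst_sub hrs, subst_mul hrs, subst_mul hrs, subst_pow hrs, subst_pow hrs, subst_pow hrs, hPr,
    hC, hC, hθ, hθ, hU', ← hF', h0, h2, theta_mul, theta_mul, theta_sq] at hB'
  have hu0 : u d ≠ 0 := by
    intro h
    have := constantCoeff_u d
    rw [h, map_zero] at this
    exact zero_ne_one this
  have hF'0 : F' ≠ 0 := by
    intro h
    rw [h, map_zero] at hF0
    exact zero_ne_one hF0
  -- Expanding the second q-derivative, the subtracted 2(θF)² cancels the term in which F'² is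
  -- differentiated. What remains is u F'⁵ times the defining equation of `f d`.
  have hode : u d * theta (theta F') + theta (u d) * theta F'
      + (C (lam d) * X - C (mu d) * X ^ 2) * F' = 0 := by
    refine mul_left_cancel₀ (mul_ne_zero hu0 (pow_ne_zero 5 hF'0)) ?_
    linear_combination hB'
  have hFf : F' = f d := f_unique d F' hF0 hode
  rw [hFf] at hrθ
  have hr1 : coeff 1 r = -1 := by
    have h1 := congrArg (coeff 1) hX
    have h2 : coeff 1 r * hPu.unit = 1 := by
      rw [hr, coeff_one_substInvOfIsUnit]
      exact hPu.unit.inv_mul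
    rw [IsUnit.unit_spec, hP1] at h2
    linear_combination -h2
  have hrm := eq_modularCoordinate d hrθ hr1
  have hPp : P = pSeries d := eq_pSeries d hP0 (by rw [← hrm, hrP])
  have hFP : (f d).subst P = F := by
    rw [← hFf, hF', subst_comp_subst_apply hrs hPs, hrP, ← map_algebraMap_eq_subst_X]
    simp
  have hC' : ∀ a : ℂ, (C a).subst P = (C a : ℂ⟦X⟧) := fun a => subst_C a
  rw [extremalQ, ← hPp, extremalP, subst_mul hPs, subst_pow hPs, hFP, hU, u, subst_sub hPs,
    subst_add hPs, subst_mul hPs, subst_mul hPs, subst_pow hPs, subst_X hPs, hC', hC',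
    ← map_one C, hC', map_one]

theorem mul_theta_pow (F : ℂ⟦X⟧) (k : ℕ) : F * theta (F ^ k) = C (k : ℂ) * F ^ k * theta F := by
  induction k with
  | zero => simp [theta]
  | succ k ih =>
    rw [pow_succ, theta_mul, Nat.cast_succ, map_add, map_one]
    linear_combination F * ih

theorem coeff_one_mul' (f g : ℂ⟦X⟧) :
    coeff 1 (f * g) = coeff 1 f * constantCoeff g + constantCoeff f * coeff 1 g := by
  have h01 : Finset.HasAntidiagonal.antidiagonal 1 = {((0 : ℕ), (1 : ℕ)), (1, 0)} := rfl
  rw [coeff_mul, h01, sum_pair (by simp)]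
  simp only [coeff_zero_eq_constantCoeff_apply]
  ring

/-- A homogeneous version of `extremalQ_eq`, where `H = P F ^ k`. -/
theorem extremalQ_eq_of_homogeneous (d : Case) (k : ℕ) {F H E : ℂ⟦X⟧}
    (hF : constantCoeff F = 1) (hH0 : constantCoeff H = 0) (hH1 : coeff 1 H = -1)
    (hE : E * F ^ (2 * k) = F ^ 3 * (F ^ (2 * k) + C (kappa d) * F ^ k * H - C (mu d) * H ^ 2))
    (hA : F * theta H - C (k : ℂ) * H * theta F = H * E)
    (hB : F ^ (2 * k) * (F * theta (theta F) - 2 * theta F ^ 2)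
      + (C (lam d) * F ^ k * H - C (mu d) * H ^ 2) * E * F ^ 3 = 0) :
    extremalQ d = E := by
  have hFi : F * F⁻¹ = 1 := PowerSeries.mul_inv_cancel _ (by rw [hF]; exact one_ne_zero)
  have hF0 : F ≠ 0 := left_ne_zero_of_mul_eq_one hFi
  have hFk : F ^ k ≠ 0 := pow_ne_zero k hF0
  -- F plays the role of a form of weight one and H of a form of weight k, while P is the modular
  -- function H / F^k; the inverse exists because F has constant term 1.
  set P : ℂ⟦X⟧ := H * F⁻¹ ^ k with hP
  have hPF : P * F ^ k = H := by
    rw [hP, mul_assoc, ← mul_pow, mul_comm F⁻¹, hFi, one_pow, mul_one]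
  have hP0 : constantCoeff P = 0 := by rw [hP, map_mul, hH0, zero_mul]
  have hP1 : coeff 1 P = -1 := by
    rw [hP, coeff_one_mul', hH0, hH1, map_pow, PowerSeries.constantCoeff_inv, hF]
    simp
  set U : ℂ⟦X⟧ := 1 + C (kappa d) * P - C (mu d) * P ^ 2 with hU
  have hUF : U * F ^ 3 = E := by
    refine mul_right_cancel₀ (pow_ne_zero (2 * k) hF0) ?_
    rw [hE, hU, ← hPF, two_mul, pow_add]
    ring
  have hθ := mul_theta_pow F k
  have hPθ : theta P * F ^ k + P * theta (F ^ k) = theta H := by rw [← theta_mul, hPF]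
  rw [← hUF]
  refine extremalQ_eq d hU hF hP0 hP1 ?_ ?_
  · refine mul_right_cancel₀ (mul_ne_zero hFk hF0) ?_
    rw [← hUF, ← hPF] at hA
    rw [← hPF] at hPθ
    linear_combination hA - P * hθ + F * hPθ
  · refine mul_right_cancel₀ (pow_ne_zero (2 * k) hF0) ?_
    rw [← hUF, ← hPF] at hB
    rw [two_mul k, pow_add] at hB ⊢
    linear_combination hB

instance : CharZero ℂ⟦X⟧ := charZero_of_injective_ringHom (C_injective (R := ℂ))

/-! ### The extremal series at levels three, four, five and six -/

namespace TorusPoint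

variable (t : TorusPoint ℂ)

theorem constantCoeff_lambert (g : ℕ → ℂ) : constantCoeff (lambert g) = 0 := by
  rw [← coeff_zero_eq_constantCoeff_apply, coeff_lambert]
  simp

theorem coeff_one_lambert (g : ℕ → ℂ) : coeff 1 (lambert g) = g 1 := by
  rw [coeff_lambert]
  simp

theorem constantCoeff_J₀ : constantCoeff t.J₀ = t.j := by
  simp [J₀, constantCoeff_lambert]

theorem constantCoeff_J₁ : constantCoeff t.J₁ = t.j₁ := by
  simp [J₁, constantCoeff_lambert]

theorem constantCoeff_J₂ : constantCoeff t.J₂ = t.j₂ := by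
  simp [J₂, constantCoeff_lambert]

theorem coeff_one_J₀ : coeff 1 t.J₀ = t.s 1 := by
  simp [J₀, coeff_one_lambert]

theorem coeff_one_J₁ : coeff 1 t.J₁ = t.c 1 := by
  simp [J₁, coeff_one_lambert]

theorem coeff_one_J₂ : coeff 1 t.J₂ = t.s 1 := by
  simp [J₂, coeff_one_lambert]

theorem j_mul_s_one : 2 * t.j * t.s 1 = -(t.x + t.xi + 2) := by
  rw [t.two_mul_j_mul_s one_pos]
  simp [c]

variable {t}

/-- The point -1 is its own inverse, so the series that are odd under inversion vanish there. -/
theorem isHalf_J (h : t.x = -1) : t.J₀ = 0 ∧ t.J₂ = 0 ∧ t.j₁ = -1 / 4 ∧ t.c 1 = -2 := by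
  have hxi : t.xi = -1 := by
    have := t.mul_inv
    rw [h] at this
    linear_combination -this
  have hj : t.j = 0 := by
    have := t.two_mul_j
    rw [h] at this
    linear_combination (1 / 4 : ℂ) * this
  have hs : t.s = fun _ => 0 := by
    funext m
    rw [s, h, hxi, sub_self]
  have h0 : lambert (fun _ => (0 : ℂ)) = 0 := by
    ext n; simp [coeff_lambert]
  refine ⟨?_, ?_, ?_, ?_⟩
  · rw [J₀, hj, hs, h0, map_zero, add_zero]
  · simp only [J₂, j₂, hj, hs, mul_zero, zero_mul, h0, map_zero, add_zero]
  · have := t.four_mul_j₁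
    rw [hj] at this
    linear_combination (1 / 4 : ℂ) * this
  · rw [c, h, hxi]
    norm_num

/-- Level three. -/
theorem extremalQ_d3 (h : t.x ^ 2 + t.x + 1 = 0) : extremalQ Case.d3 = C (18 * t.j) * t.J₂ := by
  have h3 : t.x * t.x * t.x = 1 := by linear_combination (t.x - 1) * h
  have hxi : t.xi = -1 - t.x := by linear_combination t.xi * h - (t.x + 1) * t.mul_inv
  have hj : 12 * t.j ^ 2 = -1 := by
    have := j_cyclic t t t h3
    linear_combination this
  have hs := t.j_mul_s_one
  rw [hxi] at hs
  have hc : 12 * (C t.j : ℂ⟦X⟧) ^ 2 = -1 := by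
    rw [← map_ofNat C, ← map_pow, ← map_mul, hj, map_neg, map_one]
  -- The triple (t, t, t) is used. Both this direction and (1, 1, -2) annihilate the J₁ terms; they
  -- express J₃ and then J₄ through J₀ and J₂.
  have hV := addition₂ h3 1 (-1) 0 (by norm_num)
  have hX := addition₃ h3 1 1 (-2) (by norm_num)
  simp only [smul_eq_C_mul, map_neg, map_one, map_zero, map_ofNat] at hV hX
  obtain ⟨h0, h1, h2⟩ := t.theta_J
  set J := t.J₀ with hJ
  set W := t.J₁
  set T := t.J₂ with hT
  have hV' : t.J₃ = 6 * J * T := by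
    refine mul_left_cancel₀ (two_ne_zero (α := ℂ⟦X⟧)) ?_
    linear_combination -hV
  have hX' : t.J₄ = 36 * J ^ 2 * T := by
    refine mul_left_cancel₀ (show (6 : ℂ⟦X⟧) ≠ 0 by norm_num) ?_
    rw [hV'] at hX
    linear_combination hX
  rw [hV'] at h1 h2
  rw [hX'] at h2
  have h00 := congrArg theta h0
  simp only [theta_sub, theta_ofNat_mul, theta_mul, theta_ofNat_mul, mul_assoc] at h00
  have h27 : (27 : ℂ⟦X⟧) * C (1 / 27) = 1 := by rw [← map_ofNat C, ← map_mul]; norm_num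
  -- The factor -12 j normalises the constant term, since 12 j² = -1 at a primitive cube root of
  -- unity.
  have hF0 : constantCoeff (C (-12 * t.j) * J) = 1 := by
    rw [map_mul, constantCoeff_C, hJ, constantCoeff_J₀]
    linear_combination -hj
  have hF1 : coeff 1 (C (-12 * t.j) * J) = 6 := by
    rw [coeff_C_mul, hJ, coeff_one_J₀]
    linear_combination -6 * hs
  have hE0 : constantCoeff (C (18 * t.j) * T) = 1 := by
    rw [map_mul, constantCoeff_C, hT, constantCoeff_J₂, j₂]
    linear_combination 9 * t.j ^ 2 * t.four_mul_j₁ + (3 * t.j ^ 2 - 1) * hj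
  have hE1 : coeff 1 (C (18 * t.j) * T) = -9 := by
    rw [coeff_C_mul, hT, coeff_one_J₂]
    linear_combination 9 * hs
  have hF : C (-12 * t.j) * J = -12 * C t.j * J := by rw [map_mul, map_neg, map_ofNat]
  have hE : C (18 * t.j) * T = 18 * C t.j * T := by rw [map_mul, map_ofNat]
  have hθF : theta (C (-12 * t.j) * J) = -12 * C t.j * theta J := by
    rw [theta_C_mul, map_mul, map_neg, map_ofNat]
  have hθθF : theta (theta (C (-12 * t.j) * J)) = -12 * C t.j * theta (theta J) := by
    rw [theta_C_mul, theta_C_mul, map_mul, map_neg, map_ofNat]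
  have hθE : theta (C (18 * t.j) * T) = 18 * C t.j * theta T := by
    rw [theta_C_mul, map_mul, map_ofNat]
  generalize C (-12 * t.j) * J = F at *
  generalize C (18 * t.j) * T = E at *
  -- As u = 1 + 27 P, the desired relation E = F³ + 27 H leaves only this choice of H.
  refine extremalQ_eq_of_homogeneous Case.d3 3 (F := F) (H := C (1 / 27) * (E - F ^ 3)) hF0
    ?_ ?_ ?_ ?_ ?_
  · rw [map_mul, map_sub, map_pow, hE0, hF0]
    norm_num
  · rw [coeff_C_mul, map_sub, pow_succ, pow_two, coeff_one_mul', coeff_one_mul', map_mul constantCoeff, hF0,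
      hF1, hE1]
    norm_num
  · simp only [kappa, mu, map_zero, map_ofNat]
    linear_combination (-(F ^ 6 * (E - F ^ 3))) * h27
  · rw [theta_C_mul, theta_sub, theta_cube, Nat.cast_ofNat, map_ofNat]
    have key : F * theta E - 3 * E * theta F = (E - F ^ 3) * E := by
      rw [hθF, hθE, hE, hF]
      linear_combination (-108) * C t.j ^ 2 * J * h2 + 324 * C t.j ^ 2 * T * h0
        - 2592 * C t.j ^ 2 * J ^ 3 * T * hc
    linear_combination C (1 / 27) * key
  · simp only [lam, mu, map_zero, map_ofNat]
    have key : 9 * (F * theta (theta F) - 2 * theta F ^ 2) + 2 * (E - F ^ 3) * E = 0 := by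
      rw [hθθF, hθF, hE, hF]
      linear_combination 648 * C t.j ^ 2 * J * h00 + 324 * C t.j ^ 2 * J * h2
        - 648 * C t.j ^ 2 * J ^ 2 * h1
        + (-1296 * C t.j ^ 2 * theta J - 648 * C t.j ^ 2 * T + 648 * C t.j ^ 2 * J * W) * h0
        + 5184 * C t.j ^ 2 * J ^ 3 * T * hc
    linear_combination 3 * C (1 / 27) * F ^ 6 * key
      - F ^ 6 * (F * theta (theta F) - 2 * theta F ^ 2) * h27

theorem two_mul_cancel {a b : ℂ⟦X⟧} (h : 2 * a = 2 * b) : a = b :=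
  mul_left_cancel₀ two_ne_zero h

/-- Level four. -/
theorem extremalQ_d4 {t' : TorusPoint ℂ} (h : t.x ^ 2 = -1) (h' : t'.x = -1) :
    extremalQ Case.d4 = C (4 * t.j) * t.J₂ := by
  have h3 : t.x * t.x * t'.x = 1 := by rw [h']; linear_combination -h
  have hxi : t.xi = -t.x := by linear_combination t.xi * h - t.x * t.mul_inv
  obtain ⟨z0, z2, zj, zc⟩ := isHalf_J h'
  have hj : 4 * t.j ^ 2 = -1 := by
    have := j_cyclic t t t' h3
    have hj' : t'.j = 0 := by
      have := constantCoeff_J₀ t'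
      rw [z0, map_zero] at this
      exact this.symm
    rw [hj'] at this
    linear_combination this
  have hs := t.j_mul_s_one
  rw [hxi] at hs
  have hc : 4 * (C t.j : ℂ⟦X⟧) ^ 2 = -1 := by
    rw [← map_ofNat C, ← map_pow, ← map_mul, hj, map_neg, map_one]
  -- With the triple (t, t, -1), these three relations express J₂ and J₃ at t, and J₃ at -1, through
  -- J₀ and J₁ at t and J₁ at -1. With `theta_J` the ring generated by the latter three is closed
  -- under θ.
  have hT := addition h3 1 0 (-1) (by norm_num)
  have hV := addition₂ h3 1 (-1) 0 (by norm_num)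
  have hV' := addition₂ h3 1 0 (-1) (by norm_num)
  simp only [smul_eq_C_mul, map_neg, map_one, map_zero, z0, z2] at hT hV hV'
  obtain ⟨h0, h1, -⟩ := t.theta_J
  obtain ⟨-, h2, -⟩ := t'.theta_J
  rw [z2] at h2
  -- This H is forced by E = F³ + 16 F H once J₂ is written through J₀ and the J₁.
  have c0 : constantCoeff (C (1 / 4) * (t.J₀ ^ 2 - t.J₁ + t'.J₁)) = 0 := by
    simp only [map_mul, map_add, map_sub, map_pow, constantCoeff_J₀, constantCoeff_J₁,
      constantCoeff_C, zj]
    linear_combination -(1 / 16 : ℂ) * t.four_mul_j₁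
  have c1 : coeff 1 (C (1 / 4) * (t.J₀ ^ 2 - t.J₁ + t'.J₁)) = -1 := by
    rw [coeff_C_mul, map_add, map_sub, pow_two, coeff_one_mul', constantCoeff_J₀, coeff_one_J₀,
      coeff_one_J₁, coeff_one_J₁, zc, c, hxi]
    linear_combination (1 / 4 : ℂ) * hs
  have hF0 : constantCoeff (C (-4 * t.j) * t.J₀) = 1 := by
    rw [map_mul, constantCoeff_C, constantCoeff_J₀]
    linear_combination -hj
  have h4 : (4 : ℂ⟦X⟧) * C (1 / 4) = 1 := by rw [← map_ofNat C, ← map_mul]; norm_num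
  have hF : C (-4 * t.j) * t.J₀ = -4 * C t.j * t.J₀ := by rw [map_mul, map_neg, map_ofNat]
  have hθF : theta (C (-4 * t.j) * t.J₀) = -4 * C t.j * theta t.J₀ := by
    rw [theta_C_mul, map_mul, map_neg, map_ofNat]
  have hθθF : theta (theta (C (-4 * t.j) * t.J₀)) = -4 * C t.j * theta (theta t.J₀) := by
    rw [theta_C_mul, theta_C_mul, map_mul, map_neg, map_ofNat]
  have hE : C (4 * t.j) * t.J₂ = 4 * C t.j * t.J₂ := by rw [map_mul, map_ofNat]
  have hθH : theta (C (1 / 4) * (t.J₀ ^ 2 - t.J₁ + t'.J₁)) =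
      C (1 / 4) * (2 * t.J₀ * theta t.J₀ - theta t.J₁ + theta t'.J₁) := by
    rw [theta_C_mul, theta_add, theta_sub, theta_sq]
  generalize hH : C (1 / 4) * (t.J₀ ^ 2 - t.J₁ + t'.J₁) = H at *
  generalize C (-4 * t.j) * t.J₀ = F at *
  generalize C (4 * t.j) * t.J₂ = E at *
  generalize t.J₀ = J at *
  generalize t.J₁ = W at *
  generalize t'.J₁ = W' at *
  have hT' : t.J₂ = 4 * J * (W - W') := by linear_combination -hT
  rw [hT'] at hV hV' h0 h1 hE
  have hV1 : t.J₃ = 16 * J ^ 2 * (W - W') := by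
    apply two_mul_cancel
    linear_combination -hV
  rw [hV1] at hV' h1
  have hV2 : t'.J₃ = 2 * (W - W') ^ 2 := by linear_combination -hV'
  rw [hV2] at h2
  have hJ : theta J = J * W - 2 * J * W' := by
    apply two_mul_cancel
    linear_combination h0
  have hW : theta W = 4 * J ^ 2 * (W - W') - W ^ 2 := by
    apply two_mul_cancel
    linear_combination h1
  have hW' : theta W' = (W - W') ^ 2 - W' ^ 2 := by
    apply two_mul_cancel
    linear_combination h2
  have hJJ : theta (theta J) = theta J * W + J * theta W - 2 * (theta J * W' + J * theta W') := by
    rw [hJ, theta_sub, theta_mul, mul_assoc, theta_ofNat_mul, theta_mul, hJ]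
    ring
  refine extremalQ_eq_of_homogeneous Case.d4 2 hF0 c0 c1 ?_ ?_ ?_
  · simp only [kappa, mu, map_zero, map_ofNat]
    have key : E = F ^ 3 + 16 * F * H := by
      rw [hE, hF, ← hH]
      linear_combination 16 * C t.j * J ^ 3 * hc + 16 * C t.j * J * (J ^ 2 - W + W') * h4
    rw [key]
    ring
  · rw [hθF, hθH, hE, hF, Nat.cast_ofNat, map_ofNat, hJ, hW, hW', ← hH]
    ring
  · simp only [lam, mu, map_zero, map_ofNat]
    have key : F * theta (theta F) - 2 * theta F ^ 2 + 4 * H * E * F = 0 := by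
      rw [hθθF, hθF, hE, hF, hJJ, hJ, hW, hW', ← hH]
      linear_combination (-64) * C t.j ^ 2 * J ^ 2 * (W - W') * (J ^ 2 - W + W') * h4
    linear_combination F ^ 4 * key

/-- A version of `extremalQ_eq_of_homogeneous` in terms of logarithmic derivatives. -/
theorem extremalQ_eq_of_logDeriv (d : Case) {F H v w G : ℂ⟦X⟧}
    (hF : constantCoeff F = 1) (hH0 : constantCoeff H = 0) (hH1 : coeff 1 H = -1)
    (hG : G = F ^ 2 + C (kappa d) * F * H - C (mu d) * H ^ 2)
    (hv : theta F = F * v) (hw : theta H = H * w) (hvw : w - v = G)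
    (h : theta v - v ^ 2 = -((C (lam d) * F * H - C (mu d) * H ^ 2) * G)) :
    extremalQ d = F * G := by
  refine extremalQ_eq_of_homogeneous d 1 hF hH0 hH1 ?_ ?_ ?_
  · rw [hG]
    ring
  · rw [hv, hw, ← hvw, Nat.cast_one, map_one]
    ring
  · have hvv : theta (theta F) = F * v * v + F * theta v := by rw [hv, theta_mul, hv]
    rw [hvv, hv]
    linear_combination F ^ 4 * h

/-- Level five. -/
theorem extremalQ_d5 {t' : TorusPoint ℂ} (h : t.x ^ 4 + t.x ^ 3 + t.x ^ 2 + t.x + 1 = 0)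
    (h' : t'.x = t.x ^ 2) : extremalQ Case.d5 =
      C ((7 * t.j + t'.j) / 5) * t.J₂ + C ((7 * t'.j - t.j) / 5) * t'.J₂ := by
  have hx5 : t.x ^ 5 = 1 := by linear_combination (t.x - 1) * h
  have hxi : t.xi = t.x ^ 4 := by linear_combination t.x ^ 4 * t.mul_inv - t.xi * hx5
  have hxi' : t'.xi = t.x ^ 3 := by
    have := t'.mul_inv
    rw [h'] at this
    linear_combination t.x ^ 3 * this - t'.xi * hx5
  have e1 : t.x * t.x * t'.symm.x = 1 := by
    change t.x * t.x * t'.xi = 1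
    rw [hxi']
    linear_combination hx5
  have e2 : t'.x * t'.x * t.x = 1 := by
    rw [h']
    linear_combination hx5
  obtain ⟨s0, s1, s2, s3⟩ := t'.J_symm
  have ha : 4 * t.j ^ 2 - 8 * (t.j * t'.j) = -1 := by
    have := j_cyclic _ _ _ e1
    change 4 * (t.j * t.j + t.j * -t'.j + -t'.j * t.j) = -1 at this
    linear_combination this
  have hb : 4 * t'.j ^ 2 + 8 * (t.j * t'.j) = -1 := by
    have := j_cyclic _ _ _ e2
    linear_combination this
  have hs1 : 2 * t'.j * t.s 1 = -t.c 1 := by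
    have := two_mul_j_mul_s_add t t'.symm t (by rw [← e1]; ring) one_pos
    change 2 * (-t'.j) * (t.s 1 + t.s 1) = _ at this
    rw [Ico_self, sum_empty] at this
    linear_combination -(1 / 2 : ℂ) * this
  have hs2 : 2 * t.j * t'.s 1 = t'.c 1 := by
    have := two_mul_j_mul_s_add t' t t' (by rw [← e2]; ring) one_pos
    rw [Ico_self, sum_empty] at this
    linear_combination (1 / 2 : ℂ) * this
  have hcc : t.c 1 + t'.c 1 = -1 := by
    simp only [c, pow_one, hxi, hxi', h']
    linear_combination h
  -- Among combinations of the two J₀, this H has no constant term; the one named F below has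
  -- constant term -2(j² + j'²) = 1.
  have c0 : constantCoeff (C (-2 * t'.j) * t.J₀ + C (2 * t.j) * t'.J₀) = 0 := by
    simp only [map_mul, map_add, constantCoeff_J₀, constantCoeff_C]
    ring
  have c1 : coeff 1 (C (-2 * t'.j) * t.J₀ + C (2 * t.j) * t'.J₀) = -1 := by
    rw [map_add, coeff_C_mul, coeff_C_mul, coeff_one_J₀, coeff_one_J₀]
    linear_combination hcc - hs1 + hs2
  have hF0 : constantCoeff (C (-2 * t.j) * t.J₀ + C (-2 * t'.j) * t'.J₀) = 1 := by
    simp only [map_mul, map_add, constantCoeff_J₀, constantCoeff_C]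
    linear_combination -(1 / 2 : ℂ) * (ha + hb)
  have hT := addition e1 1 0 (-1) (by norm_num)
  have hT' := addition e2 1 0 (-1) (by norm_num)
  have hV := addition₂ e1 1 (-1) 0 (by norm_num)
  have hV' := addition₂ e2 1 (-1) 0 (by norm_num)
  have hS := J₀_add_sq _ _ _ e1
  have hS' := J₀_add_sq _ _ _ e2
  simp only [smul_eq_C_mul, map_neg, map_one, map_zero, s0, s1, s2, s3] at hT hT' hV hV' hS hS'
  obtain ⟨h0, h1, -⟩ := t.theta_J
  obtain ⟨h0', h1', -⟩ := t'.theta_J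
  have hF : C (-2 * t.j) * t.J₀ + C (-2 * t'.j) * t'.J₀ =
      -2 * C t.j * t.J₀ - 2 * C t'.j * t'.J₀ := by
    simp only [map_mul, map_neg, map_ofNat]
    ring
  have hH : C (-2 * t'.j) * t.J₀ + C (2 * t.j) * t'.J₀ =
      -2 * C t'.j * t.J₀ + 2 * C t.j * t'.J₀ := by
    simp only [map_mul, map_neg, map_ofNat]
  have hθF : theta (C (-2 * t.j) * t.J₀ + C (-2 * t'.j) * t'.J₀) =
      -2 * C t.j * theta t.J₀ - 2 * C t'.j * theta t'.J₀ := by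
    rw [theta_add, theta_C_mul, theta_C_mul]
    simp only [map_mul, map_neg, map_ofNat]
    ring
  have hθH : theta (C (-2 * t'.j) * t.J₀ + C (2 * t.j) * t'.J₀) =
      -2 * C t'.j * theta t.J₀ + 2 * C t.j * theta t'.J₀ := by
    rw [theta_add, theta_C_mul, theta_C_mul]
    simp only [map_mul, map_neg, map_ofNat]
  have hE : C ((7 * t.j + t'.j) / 5) * t.J₂ + C ((7 * t'.j - t.j) / 5) * t'.J₂ =
      C (1 / 5) * ((7 * C t.j + C t'.j) * t.J₂ + (7 * C t'.j - C t.j) * t'.J₂) := by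
    simp only [div_eq_mul_inv, map_mul, map_add, map_sub, map_ofNat, one_mul]
    ring
  have h5 : (5 : ℂ⟦X⟧) * C (1 / 5) = 1 := by rw [← map_ofNat C, ← map_mul]; norm_num
  rw [hE]
  have hA : 4 * (C t.j : ℂ⟦X⟧) ^ 2 - 8 * (C t.j * C t'.j) = -1 := by
    have := congrArg (C (R := ℂ)) ha
    simpa only [map_sub, map_mul, map_pow, map_ofNat, map_neg, map_one] using this
  have hB : 4 * (C t'.j : ℂ⟦X⟧) ^ 2 + 8 * (C t.j * C t'.j) = -1 := by
    have := congrArg (C (R := ℂ)) hb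
    simpa only [map_add, map_mul, map_pow, map_ofNat, map_neg, map_one] using this
  generalize C (-2 * t.j) * t.J₀ + C (-2 * t'.j) * t'.J₀ = F at *
  generalize C (-2 * t'.j) * t.J₀ + C (2 * t.j) * t'.J₀ = H at *
  have hθA := theta_C t.j
  have hθB := theta_C t'.j
  generalize (C t.j : ℂ⟦X⟧) = A at *
  generalize (C t'.j : ℂ⟦X⟧) = B at *
  generalize t.J₀ = J at *
  generalize t'.J₀ = J' at *
  generalize t.J₁ = W at *
  generalize t'.J₁ = W' at *
  -- Subtracting the addition theorems of (t, t, t'⁻¹) and (t', t', t) eliminates the common weight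
  -- two series. Thus W - W' is a product of two linear forms in J and J'.
  have hY : W' = W - (3 * J + J') * (J - 3 * J') := by
    refine mul_left_cancel₀ (show (4 : ℂ⟦X⟧) ≠ 0 by norm_num) ?_
    linear_combination hS - hS'
  have hT1 : t.J₂ = (3 * J + J') * (W - W') := by
    apply two_mul_cancel
    linear_combination hT' - hT
  have hT2 : t'.J₂ = (J - 3 * J') * (W - W') := by
    apply two_mul_cancel
    linear_combination -hT' - hT
  have hV1 : t.J₃ = 2 * (2 * J - J') * t.J₂ := by
    apply two_mul_cancel
    linear_combination -hV
  have hV2 : t'.J₃ = 2 * (J + 2 * J') * t'.J₂ := by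
    apply two_mul_cancel
    linear_combination -hV'
  rw [hV1] at h1
  rw [hV2] at h1'
  rw [hT1] at h0 h1
  rw [hT2] at h0' h1'
  rw [hT1, hT2]
  have hW : theta W = (J - J') * ((3 * J + J') * (W - W')) - W ^ 2 := by
    apply two_mul_cancel
    linear_combination h1
  have hW' : theta W' = (J + J') * ((J - 3 * J') * (W - W')) - W' ^ 2 := by
    apply two_mul_cancel
    linear_combination h1'
  have r1 : 20 * A ^ 2 * B + 2 * A + B = 0 := by linear_combination B * hA + 2 * A * hB
  have r2 : 20 * A * B ^ 2 + A - 2 * B = 0 := by linear_combination A * hB - 2 * B * hA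
  have r3 : 80 * (A * B) ^ 2 = 1 := by linear_combination 4 * B * r1 - hB
  have r4 : A ^ 2 - B ^ 2 = 4 * (A * B) := by
    refine mul_left_cancel₀ (show (4 : ℂ⟦X⟧) ≠ 0 by norm_num) ?_
    linear_combination hA - hB
  have r5 : 2 * (A ^ 2 + B ^ 2) = -1 := by
    apply two_mul_cancel
    linear_combination hA + hB
  set Y := W - W' with hYd
  have hG : F ^ 2 + 11 * F * H - H ^ 2 = 20 * (A * B) * Y := by
    rw [hYd, hY, hF, hH]
    linear_combination (4 * J ^ 2 - 4 * J' ^ 2 - 44 * J * J') * r4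
  -- K is a constant with K² + K = 1, hence of golden ratio type. It makes -W - K Y and -W + (1 + K)
  -- Y the logarithmic derivatives of F and H; their difference is G because 1 + 2K = 20 A B.
  set K := 10 * (A * B) + A ^ 2 + B ^ 2 with hK
  have hK2 : 2 * K = 20 * (A * B) - 1 := by linear_combination r5
  have hKK : K ^ 2 + K = 1 := by
    refine mul_left_cancel₀ (show (4 : ℂ⟦X⟧) ≠ 0 by norm_num) ?_
    linear_combination (2 * K + 20 * (A * B) + 1) * hK2 + 5 * r3
  have hE' : C (1 / 5) * ((7 * A + B) * ((3 * J + J') * Y) + (7 * B - A) * ((J - 3 * J') * Y)) =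
      F * (20 * (A * B) * Y) := by
    rw [hF]
    linear_combination (4 * A * J + 2 * B * J - 4 * B * J' + 2 * A * J') * Y * h5
      + 2 * (J * r1 + J' * r2) * Y
  rw [hE']
  refine extremalQ_eq_of_logDeriv Case.d5 hF0 c0 c1 (v := -W - K * Y) (w := -W + (1 + K) * Y)
    ?_ ?_ ?_ ?_ ?_
  · simp only [kappa, mu, map_one, map_ofNat]
    linear_combination -hG
  · rw [hθF, hF]
    linear_combination -A * h0 - B * h0' + 2 * B * J' * hYd - (A * J + B * J') * Y * hK2
      - Y * (J * r1 + J' * r2)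
  · rw [hθH, hH]
    linear_combination -B * h0 + A * h0' - 2 * A * J' * hYd + (B * J - A * J') * Y * hK2
      + Y * (J * r2 - J' * r1)
  · linear_combination Y * hK2
  · simp only [lam, mu, map_one, map_ofNat]
    have hFH : 3 * F * H - 1 * H ^ 2 = (20 * (A * B) + 1) * J ^ 2 - 40 * (A * B) * J * J'
        + (1 - 20 * (A * B)) * J' ^ 2 := by
      rw [hF, hH]
      linear_combination -J ^ 2 * hB - 12 * J * J' * r4 - J' ^ 2 * hA
    have hθK : theta K = 0 := by
      rw [hK, mul_comm, theta_add, theta_add, theta_mul, theta_mul, theta_sq, theta_sq, hθA, hθB,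
        ← map_ofNat C, theta_C]
      ring
    have hθ : theta (-W - K * Y) = -theta W - K * (theta W - theta W') := by
      rw [show -W - K * Y = 0 - W - K * Y by ring, theta_sub, theta_sub, theta_mul, hθK, hYd,
        theta_sub, ← map_zero C, theta_C, map_zero]
      ring
    have hW'Y : W' = W - Y := by rw [hYd]; ring
    have hYJ : Y = (3 * J + J') * (J - 3 * J') := by rw [hYd, hY]; ring
    rw [hθ, hW, hW', hFH, hW'Y]
    linear_combination -Y ^ 2 * hKK - Y * hYJ - Y * (J ^ 2 + J' ^ 2) * hK2
      + 5 * (J ^ 2 - 2 * J * J' - J' ^ 2) * Y * r3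

/-- Level six. -/
theorem extremalQ_d6 {t' t'' : TorusPoint ℂ} (h : t.x ^ 2 - t.x + 1 = 0)
    (h' : t'.x = t.x ^ 2) (h'' : t''.x = -1) :
    extremalQ Case.d6I = C (2 / 3 * t.j) * t.J₂ ∧ extremalQ Case.d6II = C (2 / 3 * t.j) * t.J₂ := by
  have hx3 : t.x ^ 3 = -1 := by linear_combination (t.x + 1) * h
  have hxi : t.xi = -t.x ^ 2 := by linear_combination -t.x ^ 2 * t.mul_inv + t.xi * hx3
  have hxi' : t'.xi = -t.x := by
    have := t'.mul_inv
    rw [h'] at this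
    linear_combination -t.x * this + t'.xi * hx3
  have e1 : t.x * t.x * t'.symm.x = 1 := by
    change t.x * t.x * t'.xi = 1
    rw [hxi']
    linear_combination -hx3
  have e2 : t'.x * t'.x * t'.x = 1 := by
    rw [h']
    linear_combination (t.x ^ 3 - 1) * hx3
  have e3 : t.x * t'.x * t''.x = 1 := by
    rw [h', h'']
    linear_combination -hx3
  obtain ⟨z0, z2, -, -⟩ := isHalf_J h''
  obtain ⟨s0, s1, s2, s3⟩ := t'.J_symm
  have hb : 12 * t'.j ^ 2 = -1 := by
    have := j_cyclic _ _ _ e2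
    linear_combination this
  have ha : t.j = 3 * t'.j := by
    have h1 := j_cyclic _ _ _ e1
    change 4 * (t.j * t.j + t.j * -t'.j + -t'.j * t.j) = -1 at h1
    have h2 := j_cyclic _ _ _ e3
    have hj'' : t''.j = 0 := by
      have := constantCoeff_J₀ t''
      rw [z0, map_zero] at this
      exact this.symm
    rw [hj''] at h2
    have hj0 : t'.j ≠ 0 := by
      rintro h0
      rw [h0] at hb
      norm_num at hb
    have h3 : (4 * t'.j) * (t.j - 3 * t'.j) = 0 := by
      linear_combination h2 - hb
    exact sub_eq_zero.1 ((mul_eq_zero.1 h3).resolve_left (mul_ne_zero (by norm_num) hj0))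
  have hs := t.j_mul_s_one
  have hss : t'.s 1 = t.s 1 := by
    simp only [s, pow_one, hxi, hxi', h']
    ring
  rw [hxi] at hs
  have c0 : constantCoeff (C (-(1 / 3) * t.j) * t.J₀ + C t.j * t'.J₀) = 0 := by
    simp only [map_mul, map_add, constantCoeff_J₀, constantCoeff_C]
    linear_combination -(1 / 3 : ℂ) * t.j * ha
  have c1 : coeff 1 (C (-(1 / 3) * t.j) * t.J₀ + C t.j * t'.J₀) = -1 := by
    rw [map_add, coeff_C_mul, coeff_C_mul, coeff_one_J₀, coeff_one_J₀, hss]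
    linear_combination (1 / 3 : ℂ) * hs + (1 / 3 : ℂ) * h
  have hF0 : constantCoeff (C (-(4 / 3) * t.j) * t.J₀) = 1 := by
    simp only [map_mul, constantCoeff_J₀, constantCoeff_C]
    linear_combination -hb - (4 / 3 : ℂ) * (t.j + 3 * t'.j) * ha
  have hT := addition e1 1 0 (-1) (by norm_num)
  have hT' := addition e3 1 (-1) 0 (by norm_num)
  have hV := addition₂ e1 1 (-1) 0 (by norm_num)
  have hS := J₀_add_sq _ _ _ e1
  have hS' := J₀_add_sq _ _ _ e2
  simp only [smul_eq_C_mul, map_neg, map_one, map_zero, s0, s1, s2, z0] at hT hT' hV hS hS'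
  obtain ⟨h0, h1, -⟩ := t.theta_J
  obtain ⟨h0', -, -⟩ := t'.theta_J
  have hF : C (-(4 / 3) * t.j) * t.J₀ = -4 * C (1 / 3 * t.j) * t.J₀ := by
    rw [show -(4 / 3) * t.j = -4 * (1 / 3 * t.j) by ring]
    simp only [map_mul, map_neg, map_ofNat]
  have hH : C (-(1 / 3) * t.j) * t.J₀ + C t.j * t'.J₀ =
      C (1 / 3 * t.j) * (3 * t'.J₀ - t.J₀) := by
    rw [show -(1 / 3) * t.j = -(1 / 3 * t.j) by ring]
    nth_rw 2 [show t.j = 3 * (1 / 3 * t.j) by ring]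
    simp only [map_mul, map_neg, map_ofNat]
    ring
  have hE : C (2 / 3 * t.j) * t.J₂ = 2 * C (1 / 3 * t.j) * t.J₂ := by
    rw [show 2 / 3 * t.j = 2 * (1 / 3 * t.j) by ring]
    simp only [map_mul, map_ofNat]
  have hc : 12 * (C (1 / 3 * t.j) : ℂ⟦X⟧) ^ 2 = -1 := by
    have := congrArg (C (R := ℂ)) hb
    rw [show t'.j = 1 / 3 * t.j by linear_combination -(1 / 3 : ℂ) * ha] at this
    simpa only [map_mul, map_pow, map_ofNat, map_neg, map_one] using this
  have hθF : theta (C (-(4 / 3) * t.j) * t.J₀) = -4 * C (1 / 3 * t.j) * theta t.J₀ := by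
    rw [hF, mul_assoc, mul_left_comm, theta_C_mul, ← map_ofNat C, ← map_neg, theta_C_mul]
    ring
  have hθH : theta (C (-(1 / 3) * t.j) * t.J₀ + C t.j * t'.J₀) =
      C (1 / 3 * t.j) * (3 * theta t'.J₀ - theta t.J₀) := by
    rw [hH, theta_C_mul, theta_sub, theta_ofNat_mul]
  rw [hE]
  generalize C (-(4 / 3) * t.j) * t.J₀ = F at *
  generalize C (-(1 / 3) * t.j) * t.J₀ + C t.j * t'.J₀ = H at *
  generalize (C (1 / 3 * t.j) : ℂ⟦X⟧) = A at *
  generalize t.J₀ = J at *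
  generalize t'.J₀ = J' at *
  generalize t.J₁ = W at *
  generalize t'.J₁ = W' at *
  -- Comparing the triples (t, t, t'⁻¹) and (t', t', t') removes the common weight two series;
  -- everything then lives in the ring generated by J, J' and W.
  have hY : W' = W - 2 * ((J - 2 * J') * (J + J')) := by
    refine mul_left_cancel₀ (show (8 : ℂ⟦X⟧) ≠ 0 by norm_num) ?_
    linear_combination hS - hS'
  rw [hY] at hT hT' h0'
  have hT1 : t.J₂ = 6 * J * ((J - 2 * J') * (J + J')) := by
    apply two_mul_cancel
    linear_combination -hT - hT'
  have hT2 : t'.J₂ = 2 * (J - 2 * J') * ((J - 2 * J') * (J + J')) := by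
    apply two_mul_cancel
    linear_combination -hT + hT'
  have hV1 : t.J₃ = 2 * (2 * J - J') * t.J₂ := by
    apply two_mul_cancel
    linear_combination -hV
  rw [hV1] at h1
  rw [hT1] at h0 h1
  rw [hT2] at h0'
  rw [hT1]
  have hJ : theta J = J * (3 * ((J - 2 * J') * (J + J')) - W) := by
    apply two_mul_cancel
    linear_combination h0
  have hJ' : theta J' = J * ((J - 2 * J') * (J + J')) - J' * W := by
    apply two_mul_cancel
    linear_combination h0'
  have hW : theta W = 6 * J * (J - J') * ((J - 2 * J') * (J + J')) - W ^ 2 := by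
    apply two_mul_cancel
    linear_combination h1
  have hw : theta H = H * (-W) := by
    rw [hθH, hH, hJ, hJ']
    ring
  -- The two smoothings share H and use F and F - H respectively. In type I, u = (1 + 8P)(1 - P); in
  -- type II, u = (1 + P)(1 + 9P). Either way E is the same product F (F - H)(F + 8H).
  constructor
  · have hE' : 2 * A * (6 * J * ((J - 2 * J') * (J + J'))) =
        F * (-3 * ((J - 2 * J') * (J + J'))) := by
      rw [hF]
      ring
    rw [hE']
    refine extremalQ_eq_of_logDeriv Case.d6I hF0 c0 c1
      (v := 3 * ((J - 2 * J') * (J + J')) - W) (w := -W) ?_ ?_ hw ?_ ?_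
    · simp only [kappa, mu, map_ofNat]
      rw [hF, hH]
      linear_combination -3 * ((J - 2 * J') * (J + J')) * hc
    · rw [hθF, hF, hJ]
      ring
    · ring
    · simp only [lam, mu, map_ofNat]
      rw [theta_sub, theta_ofNat_mul, theta_mul, theta_add, theta_sub, theta_ofNat_mul, hJ, hJ',
        hW, hF, hH]
      linear_combination 6 * J' * (3 * J' - J) * ((J - 2 * J') * (J + J')) * hc
  · have hE' : 2 * A * (6 * J * ((J - 2 * J') * (J + J'))) =
        (F - H) * (-4 * J * (J - 2 * J')) := by
      rw [hF, hH]
      ring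
    rw [hE']
    refine extremalQ_eq_of_logDeriv Case.d6II ?_ c0 c1
      (v := 4 * (J * (J - 2 * J')) - W) (w := -W) ?_ ?_ hw ?_ ?_
    · rw [map_sub, hF0, c0, sub_zero]
    · simp only [kappa, mu, map_ofNat, map_neg]
      rw [hF, hH]
      linear_combination -4 * J * (J - 2 * J') * hc
    · rw [theta_sub, hw, hθF, hF, hH, hJ]
      ring
    · ring
    · simp only [lam, mu, map_ofNat, map_neg]
      rw [theta_sub, theta_ofNat_mul, theta_mul, theta_sub, theta_ofNat_mul, hJ, hJ',
        hW, hF, hH]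
      linear_combination -6 * (3 * J' - J) * (J' - J) * J * (J - 2 * J') * hc

end TorusPoint

end

/-! ### Level eight from level four -/

theorem constantCoeff_subst_of_constantCoeff_zero {r : ℂ⟦X⟧} (hr : constantCoeff r = 0)
    (g : ℂ⟦X⟧) : constantCoeff (g.subst r) = constantCoeff g := by
  have hrs : HasSubst r := HasSubst.of_constantCoeff_zero' hr
  have h1 : constantCoeff ((g - C (constantCoeff g)).subst r) = 0 :=
    constantCoeff_subst_eq_zero hr _ (by rw [map_sub, constantCoeff_C, sub_self])
  have hC : (C (constantCoeff g)).subst r = (C (constantCoeff g) : ℂ⟦X⟧) := subst_C _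
  rw [subst_sub hrs, hC] at h1
  have h2 : constantCoeff (g.subst r - C (constantCoeff g)) = 0 := h1
  rw [map_sub, constantCoeff_C] at h2
  exact sub_eq_zero.1 h2

/-- The level eight series is obtained from the level four series by doubling `τ`. -/
theorem extremalQ_d8 : extremalQ Case.d8 = (extremalQ Case.d4).subst (X ^ 2 : ℂ⟦X⟧) := by
  have hC : ∀ (r : ℂ⟦X⟧) (a : ℂ), (C a).subst r = (C a : ℂ⟦X⟧) := fun r a => subst_C a
  -- The substitution P ↦ -P² carries u and f of level four to those of level eight, because θ
  -- doubles on series in -P².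
  set r : ℂ⟦X⟧ := C (-1) * X ^ 2 with hr
  have hr0 : constantCoeff r = 0 := by simp [hr]
  have hrs : HasSubst r := HasSubst.of_constantCoeff_zero' hr0
  have hθr : theta r = 2 * r := by
    rw [hr, theta_C_mul, theta_sq, theta_X]
    ring
  have hθ : ∀ g : ℂ⟦X⟧, theta (g.subst r) = 2 * (theta g).subst r := by
    intro g
    rw [subst_theta hrs, theta_subst hrs, hθr]
    ring
  have hu : (u Case.d4).subst r = u Case.d8 := by
    rw [u, u, subst_sub hrs, subst_add hrs, subst_mul hrs, subst_mul hrs, subst_X hrs, hC, hC,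
      ← map_one C, hC, hr]
    simp only [kappa, mu, map_zero, map_one, map_ofNat, map_neg]
    ring
  have h4 : (4 : ℂ⟦X⟧) ≠ 0 := by norm_num
  have hf : (f Case.d4).subst r = f Case.d8 := by
    apply f_unique
    · rw [constantCoeff_subst_of_constantCoeff_zero hr0, constantCoeff_f]
    · have h := congrArg (subst r) (f_ode Case.d4)
      have h0 : (0 : ℂ⟦X⟧).subst r = 0 := by rw [← map_zero C, hC]
      rw [subst_add hrs, subst_add hrs, subst_mul hrs, subst_mul hrs, subst_mul hrs,
        subst_sub hrs, subst_mul hrs, subst_mul hrs, hC, hC, subst_X hrs, h0, hu] at h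
      have h1 : theta (u Case.d8) = 2 * (theta (u Case.d4)).subst r := by rw [← hu, hθ]
      have h2 : theta (theta ((f Case.d4).subst r)) =
          4 * (theta (theta (f Case.d4))).subst r := by
        rw [hθ, theta_ofNat_mul, hθ]
        ring
      rw [h1, h2, hθ]
      simp only [lam, mu, map_zero, map_ofNat, hr, map_neg, map_one] at h ⊢
      linear_combination 4 * h
  set M := (modularCoordinate Case.d4).subst r with hM
  -- The level four coordinate at -P² and the square of the level eight coordinate solve the same
  -- equation u f² θy = 2y. Their coefficients of P² agree, so they coincide.
  have hMθ : u Case.d8 * f Case.d8 ^ 2 * theta M = 2 * M := by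
    have h := congrArg (subst r) (modularCoordinate_theta Case.d4)
    rw [subst_mul hrs, subst_mul hrs, subst_pow hrs, hu, hf] at h
    rw [hM, hθ]
    linear_combination 2 * h
  have hc2 : coeff 2 M = 1 := by
    obtain ⟨g, hg⟩ := X_dvd_iff.2 (constantCoeff_modularCoordinate Case.d4)
    have hg1 : constantCoeff g = -1 := by
      have := coeff_one_modularCoordinate Case.d4
      rw [hg, ← zero_add 1, coeff_succ_X_mul, coeff_zero_eq_constantCoeff_apply] at this
      exact this
    rw [hM, hg, subst_mul hrs, subst_X hrs, hr, mul_assoc, coeff_C_mul, ← zero_add 2,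
      coeff_X_pow_mul, coeff_zero_eq_constantCoeff_apply, ← hr,
      constantCoeff_subst_of_constantCoeff_zero hr0, hg1]
    norm_num
  have hc2' : coeff 2 (modularCoordinate Case.d8 ^ 2) = 1 := by
    obtain ⟨g, hg⟩ := X_dvd_iff.2 (constantCoeff_modularCoordinate Case.d8)
    have hg1 : constantCoeff g = -1 := by
      have := coeff_one_modularCoordinate Case.d8
      rw [hg, ← zero_add 1, coeff_succ_X_mul, coeff_zero_eq_constantCoeff_apply] at this
      exact this
    rw [hg, mul_pow, ← zero_add 2, coeff_X_pow_mul, coeff_zero_eq_constantCoeff_apply, zero_add,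
      map_pow, hg1]
    norm_num
  have hMM : M = modularCoordinate Case.d8 ^ 2 := by
    rw [← sub_eq_zero]
    refine eq_zero_of_theta 2 (w := u Case.d8 * f Case.d8 ^ 2)
      (by simp [constantCoeff_u, constantCoeff_f]) ?_ ?_
    · rw [theta_sub, theta_sq, Nat.cast_ofNat, map_ofNat]
      linear_combination hMθ - 2 * modularCoordinate Case.d8 * modularCoordinate_theta Case.d8
    · rw [map_sub, hc2, hc2', sub_self]
  have hp0 : ∀ d, HasSubst (pSeries d) := fun d =>
    HasSubst.of_constantCoeff_zero' (constantCoeff_substInvOfIsUnit _ _)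
  have hMp : ∀ d, (modularCoordinate d).subst (pSeries d) = X := fun d =>
    subst_substInvOfIsUnit_right _ (constantCoeff_modularCoordinate d) _
  have hX2 : HasSubst (X ^ 2 : ℂ⟦X⟧) := HasSubst.X_pow two_ne_zero
  have hrp0 : constantCoeff (r.subst (pSeries Case.d8)) = 0 :=
    constantCoeff_subst_eq_zero (constantCoeff_substInvOfIsUnit _ _) _ hr0
  have hrp : HasSubst (r.subst (pSeries Case.d8)) := HasSubst.of_constantCoeff_zero' hrp0
  have hrM : (modularCoordinate Case.d4).subst (r.subst (pSeries Case.d8)) = X ^ 2 := by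
    rw [← subst_comp_subst_apply hrs (hp0 _), ← hM, hMM, subst_pow (hp0 _), hMp]
  have hm4 : HasSubst (modularCoordinate Case.d4) :=
    HasSubst.of_constantCoeff_zero' (constantCoeff_modularCoordinate _)
  have hrp4 : r.subst (pSeries Case.d8) = (pSeries Case.d4).subst (X ^ 2 : ℂ⟦X⟧) := by
    have h := subst_comp_subst_apply hm4 hrp (pSeries Case.d4)
    have h1 : (pSeries Case.d4).subst (modularCoordinate Case.d4) = X :=
      subst_substInvOfIsUnit_left _ (constantCoeff_modularCoordinate _) _
    rw [h1, hrM, subst_X hrp] at h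
    exact h
  have hE : extremalP Case.d8 = (extremalP Case.d4).subst r := by
    rw [extremalP, extremalP, subst_mul hrs, subst_pow hrs, hu, hf]
  rw [extremalQ, extremalQ, hE, subst_comp_subst_apply hrs (hp0 _), hrp4,
    subst_comp_subst_apply (hp0 _) hX2]

/-! ### Lambert series as functions -/

section Lambert

variable {g : ℕ → ℂ} {B : ℝ} {k : ℕ} {r : ℂ}

theorem summable_lambert (hg : ∀ m, ‖g m‖ ≤ B * m ^ k) (hr : ‖r‖ < 1) :
    Summable fun c : ℕ+ × ℕ+ => g c.1 * r ^ (c.1 * c.2 : ℕ) := by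
  have h := ((summable_prod_mul_pow k hr).norm.mul_left B).prod_symm
  refine Summable.of_norm_bounded h fun c => ?_
  rcases c with ⟨m, b⟩
  simp only [Prod.swap, norm_mul, norm_pow, Complex.norm_natCast]
  rw [mul_comm (b : ℕ), ← mul_assoc]
  exact mul_le_mul_of_nonneg_right (hg m) (by positivity)

/-- The polynomial bound gives absolute convergence of the double sum over (m, b), which may then be
regrouped by n = m b. -/
theorem hasSum_lambert (hg : ∀ m, ‖g m‖ ≤ B * m ^ k) (hr : ‖r‖ < 1) :
    HasSum (fun n : ℕ => coeff n (lambert g) * r ^ n)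
      (∑' c : ℕ+ × ℕ+, g c.1 * r ^ (c.1 * c.2 : ℕ)) := by
  have h := (summable_lambert hg hr).hasSum
  rw [← sigmaAntidiagonalEquivProd.hasSum_iff] at h
  have h1 := h.sigma fun n => hasSum_fintype _
  rw [← PNat.coe_injective.hasSum_iff]
  · convert! h1 using 1
    funext n
    simp only [Function.comp_apply, TorusPoint.coeff_lambert, sigmaAntidiagonalEquivProd,
      divisorsAntidiagonalFactors, PNat.mk_coe, Equiv.coe_fn_mk, Finset.univ_eq_attach]
    rw [(n : ℕ).divisorsAntidiagonal.sum_attach fun x : ℕ × ℕ => g x.1 * r ^ (x.1 * x.2),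
      Finset.sum_mul]
    exact Finset.sum_congr rfl fun p hp => by rw [(Nat.mem_divisorsAntidiagonal.1 hp).1]
  · intro n hn
    have : n = 0 := by
      by_contra h0
      exact hn ⟨⟨n, Nat.pos_of_ne_zero h0⟩, rfl⟩
    subst this
    simp [TorusPoint.coeff_lambert]

theorem tsum_lambert_fiber (hr : ‖r‖ < 1) (m : ℕ+) :
    ∑' b : ℕ+, g m * r ^ (m * b : ℕ) = g m * (r ^ (m : ℕ) / (1 - r ^ (m : ℕ))) := by
  rw [tsum_mul_left]
  congr 1
  have hm : ‖r ^ (m : ℕ)‖ < 1 := by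
    rw [norm_pow]
    exact pow_lt_one₀ (norm_nonneg _) hr m.ne_zero
  have := tsum_geometric_of_norm_lt_one hm
  rw [div_eq_mul_inv, ← this, ← tsum_mul_left, tsum_pnat_eq_tsum_succ (f := fun b => r ^ (m * b))]
  exact tsum_congr fun b => by ring

theorem tsum_lambert (hg : ∀ m, ‖g m‖ ≤ B * m ^ k) (hr : ‖r‖ < 1) :
    ∑' c : ℕ+ × ℕ+, g c.1 * r ^ (c.1 * c.2 : ℕ) =
      ∑' m : ℕ+, g m * (r ^ (m : ℕ) / (1 - r ^ (m : ℕ))) := by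
  rw [(summable_lambert hg hr).tsum_prod]
  exact tsum_congr fun m => tsum_lambert_fiber hr m

end Lambert

theorem norm_qOf_lt_one (τ : ℍ) : ‖qOf τ‖ < 1 := UpperHalfPlane.norm_exp_two_pi_I_lt_one τ

/-! ### Values of L-functions at `-2` -/

theorem eval_bernoulli_three (x : ℂ) :
    ((Polynomial.bernoulli 3).map (algebraMap ℚ ℂ)).eval x = x ^ 3 - 3 / 2 * x ^ 2 + 1 / 2 * x := by
  have h3 : bernoulli 3 = 0 := by
    rw [bernoulli_eq_bernoulli'_of_ne_one (by norm_num), bernoulli'_three]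
  have h2 : bernoulli 2 = 1 / 6 := by
    rw [bernoulli_eq_bernoulli'_of_ne_one (by norm_num), bernoulli'_two]
  rw [Polynomial.bernoulli_def]
  simp [Finset.sum_range_succ, h2, h3, bernoulli_one, Nat.choose]
  ring

theorem sum_zmod_eq_sum_range {N : ℕ} [NeZero N] (F : ZMod N → ℕ → ℂ) :
    ∑ j : ZMod N, F j j.val = ∑ i ∈ Finset.range N, F i i := by
  refine Finset.sum_nbij' (fun j => j.val) (fun i => (i : ZMod N)) ?_ ?_ ?_ ?_ ?_
  · intro j _
    exact Finset.mem_range.2 (ZMod.val_lt j)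
  · intro i _
    exact Finset.mem_univ _
  · intro j _
    exact ZMod.natCast_zmod_val j
  · intro i hi
    exact ZMod.val_cast_of_lt (Finset.mem_range.1 hi)
  · intro j _
    rw [ZMod.natCast_zmod_val]

/-- The L-function is a combination of Hurwitz zeta functions at j/N, and the value at -2 of the
Hurwitz zeta function is -B₃(j/N)/3. -/
theorem LFunction_neg_two {N : ℕ} [NeZero N] (χ : DirichletCharacter ℂ N) :
    χ.LFunction (-2) = -(N : ℂ) ^ 2 / 3 * ∑ i ∈ Finset.range N, χ (i : ZMod N) *
      (((i : ℂ) / N) ^ 3 - 3 / 2 * ((i : ℂ) / N) ^ 2 + 1 / 2 * ((i : ℂ) / N)) := by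
  have hN : (N : ℝ) ≠ 0 := Nat.cast_ne_zero.2 (NeZero.ne N)
  rw [← sum_zmod_eq_sum_range fun j i => χ j *
    (((i : ℂ) / N) ^ 3 - 3 / 2 * ((i : ℂ) / N) ^ 2 + 1 / 2 * ((i : ℂ) / N)),
    DirichletCharacter.LFunction, ZMod.LFunction, neg_neg, show (2 : ℂ) = (2 : ℕ) by norm_num,
    Complex.cpow_natCast, Finset.mul_sum, Finset.mul_sum]
  refine Finset.sum_congr rfl fun j _ => ?_
  have hx : (j.val : ℝ) / N ∈ Set.Icc (0 : ℝ) 1 := by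
    refine ⟨by positivity, (div_le_one (by positivity)).2 ?_⟩
    exact_mod_cast (ZMod.val_lt j).le
  rw [ZMod.toAddCircle_apply, HurwitzZeta.hurwitzZeta_neg_nat two_ne_zero hx, eval_bernoulli_three]
  push_cast
  ring

theorem chi3_two : chi3 2 = -1 := by
  have : quadraticChar (ZMod 3) 2 = -1 := by decide
  simp [chi3, this]

theorem chi4_zero : chi4 0 = 0 := by
  have : ZMod.χ₄ 0 = 0 := by decide
  simp [chi4, this]

theorem chi4_two : chi4 2 = 0 := by
  have : ZMod.χ₄ 2 = 0 := by decide
  simp [chi4, this]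

theorem chi4_three : chi4 3 = -1 := by
  have : ZMod.χ₄ 3 = -1 := by decide
  simp [chi4, this]

theorem chi5_apply : chi5 0 = 0 ∧ chi5 1 = 1 ∧ chi5 2 = Complex.I ∧ chi5 3 = -Complex.I ∧
    chi5 4 = -1 := ⟨rfl, rfl, rfl, rfl, rfl⟩

theorem chi5bar_apply : chi5bar 0 = 0 ∧ chi5bar 1 = 1 ∧ chi5bar 2 = -Complex.I ∧
    chi5bar 3 = Complex.I ∧ chi5bar 4 = -1 := by
  obtain ⟨h0, h1, h2, h3, h4⟩ := chi5_apply
  have h : ∀ a, chi5bar a = chi5 a ^ 3 := fun a => MulChar.pow_apply' _ three_ne_zero a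
  simp only [h, h0, h1, h2, h3, h4]
  have hI : Complex.I ^ 3 = -Complex.I := Complex.I_pow_three
  refine ⟨by norm_num, by norm_num, hI, ?_, by norm_num⟩
  rw [neg_pow, hI]
  norm_num

theorem LFunction_chi3 : chi3.LFunction (-2) = -2 / 9 := by
  have h0 : chi3 0 = 0 := MulChar.map_zero _
  simp only [LFunction_neg_two, Finset.sum_range_succ, Finset.sum_range_zero, Nat.cast_zero,
    Nat.cast_one, Nat.cast_ofNat, h0, map_one, chi3_two]
  norm_num

theorem LFunction_chi4 : chi4.LFunction (-2) = -1 / 2 := by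
  simp only [LFunction_neg_two, Finset.sum_range_succ, Finset.sum_range_zero, Nat.cast_zero,
    Nat.cast_one, Nat.cast_ofNat, chi4_zero, map_one, chi4_two, chi4_three]
  norm_num

theorem LFunction_chi5 : chi5.LFunction (-2) = -(4 + 2 * Complex.I) / 5 := by
  obtain ⟨h0, h1, h2, h3, h4⟩ := chi5_apply
  simp only [LFunction_neg_two, Finset.sum_range_succ, Finset.sum_range_zero, Nat.cast_zero,
    Nat.cast_one, Nat.cast_ofNat, h0, h1, h2, h3, h4]
  ring

theorem LFunction_chi5bar : chi5bar.LFunction (-2) = -(4 - 2 * Complex.I) / 5 := by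
  obtain ⟨h0, h1, h2, h3, h4⟩ := chi5bar_apply
  simp only [LFunction_neg_two, Finset.sum_range_succ, Finset.sum_range_zero, Nat.cast_zero,
    Nat.cast_one, Nat.cast_ofNat, h0, h1, h2, h3, h4]
  ring

/-! ### The coefficients of the extremal series -/

theorem C_mul_lambert (a : ℂ) (g : ℕ → ℂ) : C a * lambert g = lambert fun m => a * g m := by
  ext n
  simp only [coeff_C_mul, TorusPoint.coeff_lambert, Finset.mul_sum]

theorem lambert_add (g h : ℕ → ℂ) : lambert g + lambert h = lambert fun m => g m + h m := by
  ext n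
  simp only [map_add, TorusPoint.coeff_lambert, Finset.sum_add_distrib]

theorem funext_of_periodic {a b : ℕ → ℂ} {N : ℕ} (hN : 0 < N) (ha : ∀ m, a (m + N) = a m)
    (hb : ∀ m, b (m + N) = b m) (h : ∀ m < N, a m = b m) (m : ℕ) : a m = b m := by
  rw [← Function.Periodic.map_mod_nat ha m, ← Function.Periodic.map_mod_nat hb m]
  exact h _ (Nat.mod_lt _ hN)

theorem character_add {N : ℕ} (χ : DirichletCharacter ℂ N) (m : ℕ) :
    χ ((m + N : ℕ) : ZMod N) = χ (m : ZMod N) := by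
  rw [Nat.cast_add, ZMod.natCast_self, add_zero]

namespace TorusPoint

variable {t : TorusPoint ℂ}

theorem s_add {N : ℕ} (h : t.x ^ N = 1) (m : ℕ) : t.s (m + N) = t.s m := by
  have hxi : t.xi ^ N = 1 := by
    have := t.mul_inv_pow N
    rwa [h, one_mul] at this
  simp only [s, pow_add, h, hxi, mul_one]

theorem s_zero : t.s 0 = 0 := by simp [s]

end TorusPoint

theorem exists_torusPoint {N : ℕ} (hN : 1 < N) :
    ∃ t : TorusPoint ℂ, t.x = Complex.exp (2 * Real.pi * Complex.I / N) ∧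
      IsPrimitiveRoot t.x N := by
  have h := Complex.isPrimitiveRoot_exp N (by omega)
  exact ⟨TorusPoint.ofNe _ (Complex.exp_ne_zero _) (h.ne_one hN), rfl, h⟩

/-- The coefficients j s(m) and the character are both periodic, so a finite table compares them.
The first two conclusions serve the comparison with the cusp Eisenstein series, the third the
character formula. -/
theorem extremalQ_d3_eq {t : TorusPoint ℂ} (h : t.x ^ 2 + t.x + 1 = 0) :
    extremalQ Case.d3 = C (18 * t.j) * t.J₂ ∧ 18 * t.j * t.j₂ = 1 ∧
      extremalQ Case.d3 = C 1 + lambert fun m => -9 * chi3 (m : ZMod 3) * (m : ℂ) ^ 2 := by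
  have hx : t.x ^ 3 = 1 := by linear_combination (t.x - 1) * h
  have hxi : t.xi = t.x ^ 2 := by linear_combination t.x ^ 2 * t.mul_inv - t.xi * hx
  have hj : 12 * t.j ^ 2 = -1 := by
    have := TorusPoint.j_cyclic t t t (by linear_combination hx)
    linear_combination this
  have h1 : 18 * t.j * t.s 1 = -9 := by
    have := t.j_mul_s_one
    rw [hxi] at this
    linear_combination 9 * this - 9 * h
  have h2 : t.s 2 = -t.s 1 := by
    simp only [TorusPoint.s, hxi]
    linear_combination -t.x * hx
  have hc : 18 * t.j * t.j₂ = 1 := by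
    rw [TorusPoint.j₂]
    linear_combination 9 * t.j ^ 2 * t.four_mul_j₁ + (3 * t.j ^ 2 - 1) * hj
  have key : ∀ m : ℕ, 18 * t.j * t.s m = -9 * chi3 (m : ZMod 3) := by
    refine funext_of_periodic three_pos (fun m => by rw [TorusPoint.s_add hx])
      (fun m => by rw [character_add]) fun m hm => ?_
    have h0 : chi3 0 = 0 := MulChar.map_zero _
    interval_cases m
    · simp [TorusPoint.s_zero, h0]
    · simp [h1]
    · simp [h2, h1, chi3_two]
  have hE := TorusPoint.extremalQ_d3 h
  refine ⟨hE, hc, ?_⟩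
  rw [hE, TorusPoint.J₂, mul_add, ← map_mul, hc, C_mul_lambert]
  congr 2
  funext m
  linear_combination (m : ℂ) ^ 2 * key m

theorem extremalQ_d4_eq {t : TorusPoint ℂ} (h : t.x ^ 2 = -1) :
    extremalQ Case.d4 = C (4 * t.j) * t.J₂ ∧ 4 * t.j * t.j₂ = 1 ∧
      extremalQ Case.d4 = C 1 + lambert fun m => -4 * chi4 (m : ZMod 4) * (m : ℂ) ^ 2 := by
  have hx : t.x ^ 4 = 1 := by linear_combination (t.x ^ 2 - 1) * h
  have hxi : t.xi = -t.x := by linear_combination t.xi * h - t.x * t.mul_inv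
  obtain ⟨t', ht'⟩ : ∃ t' : TorusPoint ℂ, t'.x = -1 :=
    ⟨TorusPoint.ofNe (-1) (by norm_num) (by norm_num), rfl⟩
  have hj' : t'.j = 0 := by
    rw [← TorusPoint.constantCoeff_J₀, (TorusPoint.isHalf_J ht').1, map_zero]
  have hj : 4 * t.j ^ 2 = -1 := by
    have := TorusPoint.j_cyclic t t t' (by rw [ht']; linear_combination -h)
    rw [hj'] at this
    linear_combination this
  have h1 : 4 * t.j * t.s 1 = -4 := by
    have := t.j_mul_s_one
    rw [hxi] at this
    linear_combination 2 * this
  have h2 : t.s 2 = 0 := by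
    simp only [TorusPoint.s, hxi]
    ring
  have h3 : t.s 3 = -t.s 1 := by
    simp only [TorusPoint.s, hxi]
    linear_combination 2 * t.x * h
  have hc : 4 * t.j * t.j₂ = 1 := by
    rw [TorusPoint.j₂]
    linear_combination 2 * t.j ^ 2 * t.four_mul_j₁ + (2 * t.j ^ 2 - 1) * hj
  have key : ∀ m : ℕ, 4 * t.j * t.s m = -4 * chi4 (m : ZMod 4) := by
    refine funext_of_periodic four_pos (fun m => by rw [TorusPoint.s_add hx])
      (fun m => by rw [character_add]) fun m hm => ?_
    interval_cases m
    · simp [TorusPoint.s_zero, chi4_zero]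
    · simp [h1]
    · simp [h2, chi4_two]
    · simp [h3, h1, chi4_three]
  have hE := TorusPoint.extremalQ_d4 h ht'
  refine ⟨hE, hc, ?_⟩
  rw [hE, TorusPoint.J₂, mul_add, ← map_mul, hc, C_mul_lambert]
  congr 2
  funext m
  linear_combination (m : ℂ) ^ 2 * key m

theorem j_level_five {t t' : TorusPoint ℂ} (h : t.x ^ 4 + t.x ^ 3 + t.x ^ 2 + t.x + 1 = 0)
    (h' : t'.x = t.x ^ 2) : 4 * t.j ^ 2 - 8 * (t.j * t'.j) = -1 ∧
      4 * t'.j ^ 2 + 8 * (t.j * t'.j) = -1 := by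
  have hx5 : t.x ^ 5 = 1 := by linear_combination (t.x - 1) * h
  constructor
  · have := TorusPoint.j_cyclic t t t'.symm (by
      change t.x * t.x * t'.xi = 1
      rw [← pow_two, ← h', t'.mul_inv])
    change 4 * (t.j * t.j + t.j * -t'.j + -t'.j * t.j) = -1 at this
    linear_combination this
  · have := TorusPoint.j_cyclic t' t' t (by rw [h']; linear_combination hx5)
    linear_combination this

/-- The coefficients found for level five are thus the negatives of the constant terms of the two
J₂. Hence E₅ has constant term -(j₂² + j₂'²), which is 1 by `j₂_sq_level_five`. -/
theorem j₂_level_five {t t' : TorusPoint ℂ} (h : t.x ^ 4 + t.x ^ 3 + t.x ^ 2 + t.x + 1 = 0)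
    (h' : t'.x = t.x ^ 2) : t.j₂ = -(7 * t.j + t'.j) / 5 ∧ t'.j₂ = -(7 * t'.j - t.j) / 5 := by
  obtain ⟨ha, hb⟩ := j_level_five h h'
  have r1 : 20 * t.j ^ 2 * t'.j + 2 * t.j + t'.j = 0 := by
    linear_combination t'.j * ha + 2 * t.j * hb
  have r2 : 20 * t.j * t'.j ^ 2 + t.j - 2 * t'.j = 0 := by
    linear_combination t.j * hb - 2 * t'.j * ha
  rw [TorusPoint.j₂, TorusPoint.j₂]
  constructor
  · linear_combination (1 / 2 : ℂ) * t.j * t.four_mul_j₁ + (1 / 2 : ℂ) * t.j * ha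
      + (1 / 5 : ℂ) * r1
  · linear_combination (1 / 2 : ℂ) * t'.j * t'.four_mul_j₁ + (1 / 2 : ℂ) * t'.j * hb
      - (1 / 5 : ℂ) * r2

theorem j₂_sq_level_five {t t' : TorusPoint ℂ}
    (h : t.x ^ 4 + t.x ^ 3 + t.x ^ 2 + t.x + 1 = 0) (h' : t'.x = t.x ^ 2) :
    t.j₂ ^ 2 + t'.j₂ ^ 2 = -1 := by
  obtain ⟨ha, hb⟩ := j_level_five h h'
  obtain ⟨h1, h2⟩ := j₂_level_five h h'
  rw [h1, h2]
  linear_combination (1 / 4 : ℂ) * (ha + hb) * 2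

theorem extremalQ_d5_eq {t t' : TorusPoint ℂ} (h : t.x ^ 4 + t.x ^ 3 + t.x ^ 2 + t.x + 1 = 0)
    (h' : t'.x = t.x ^ 2) :
    extremalQ Case.d5 = C 1 + lambert fun m => ((-1 + Complex.I / 2) * chi5 (m : ZMod 5) +
      (-1 - Complex.I / 2) * chi5bar (m : ZMod 5)) * (m : ℂ) ^ 2 := by
  have hx : t.x ^ 5 = 1 := by linear_combination (t.x - 1) * h
  have hx' : t'.x ^ 5 = 1 := by
    rw [h']
    linear_combination (t.x ^ 5 + 1) * hx
  have hxi : t.xi = t.x ^ 4 := by linear_combination t.x ^ 4 * t.mul_inv - t.xi * hx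
  have hxi' : t'.xi = t.x ^ 3 := by
    have := t'.mul_inv
    rw [h'] at this
    linear_combination t.x ^ 3 * this - t'.xi * hx
  obtain ⟨h1, h2⟩ := j₂_level_five h h'
  have hsq := j₂_sq_level_five h h'
  have e1 := TorusPoint.two_mul_j_mul_s_add t t'.symm t (by
    change t.x * t'.xi * t.x = 1
    rw [hxi']
    linear_combination hx) one_pos
  have e2 := TorusPoint.two_mul_j_mul_s_add t' t t' (by rw [h']; linear_combination hx) one_pos
  change 2 * (-t'.j) * (t.s 1 + t.s 1) = _ at e1
  rw [Finset.Ico_self, Finset.sum_empty] at e1 e2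
  have e3 := t.j_mul_s_one
  have e4 := t'.j_mul_s_one
  simp only [TorusPoint.c, pow_one, hxi, hxi', h'] at e1 e2 e3 e4
  set S := t.s 1 with hS
  set S' := t'.s 1 with hS'
  have v2 : t.s 2 = S' := by
    simp only [hS', TorusPoint.s, hxi, hxi', h']
    linear_combination -t.x ^ 3 * hx
  have v3 : t.s 3 = -S' := by
    simp only [hS', TorusPoint.s, hxi, hxi', h']
    linear_combination -(t.x ^ 7 + t.x ^ 2) * hx
  have v4 : t.s 4 = -S := by
    simp only [hS, TorusPoint.s, hxi]
    linear_combination -(t.x ^ 11 + t.x ^ 6 + t.x) * hx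
  have v2' : t'.s 2 = -S := by
    simp only [hS, TorusPoint.s, hxi, hxi', h']
    linear_combination -t.x * hx
  have v3' : t'.s 3 = S := by
    simp only [hS, TorusPoint.s, hxi, hxi', h']
    linear_combination (t.x - t.x ^ 4) * hx
  have v4' : t'.s 4 = -S' := by
    simp only [hS', TorusPoint.s, hxi', h']
    linear_combination (t.x ^ 3 - t.x ^ 7 - t.x ^ 2) * hx
  -- The numbers -2 and -1 are the values at m = 1 and m = 2 of the stated combination of the two
  -- quartic characters; oddness gives m = 4 and m = 3.
  have a1 : (7 * t.j + t'.j) / 5 * S + (7 * t'.j - t.j) / 5 * S' = -2 := by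
    linear_combination (1 / 10 : ℂ) * (7 * e3 + 7 * e4 - (1 / 2) * e1 - (1 / 2) * e2) - (4 / 5) * h
  have a2 : (7 * t.j + t'.j) / 5 * S' - (7 * t'.j - t.j) / 5 * S = -1 := by
    linear_combination (1 / 10 : ℂ) * ((7 / 2) * e2 + (7 / 2) * e1 + e3 + e4) + (3 / 5) * h
  have hI := Complex.I_mul_I
  have key : ∀ m : ℕ, (7 * t.j + t'.j) / 5 * t.s m + (7 * t'.j - t.j) / 5 * t'.s m =
      (-1 + Complex.I / 2) * chi5 (m : ZMod 5) +
      (-1 - Complex.I / 2) * chi5bar (m : ZMod 5) := by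
    refine funext_of_periodic (N := 5) (by norm_num)
      (fun m => by rw [TorusPoint.s_add hx, TorusPoint.s_add hx'])
      (fun m => by rw [character_add, character_add]) fun m hm => ?_
    obtain ⟨c0, c1, c2, c3, c4⟩ := chi5_apply
    obtain ⟨d0, d1, d2, d3, d4⟩ := chi5bar_apply
    interval_cases m
    · simp only [TorusPoint.s_zero, Nat.cast_zero, c0, d0]
      ring
    · simp only [Nat.cast_one, c1, d1, ← hS, ← hS', a1]
      ring
    · simp only [Nat.cast_ofNat, c2, d2, v2, v2']
      linear_combination a2 - hI
    · simp only [Nat.cast_ofNat, c3, d3, v3, v3']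
      linear_combination -a2 + hI
    · simp only [Nat.cast_ofNat, c4, d4, v4, v4']
      linear_combination -a1
  have hc : (7 * t.j + t'.j) / 5 * t.j₂ + (7 * t'.j - t.j) / 5 * t'.j₂ = 1 := by
    linear_combination -hsq + t.j₂ * h1 + t'.j₂ * h2
  rw [TorusPoint.extremalQ_d5 h h', TorusPoint.J₂, TorusPoint.J₂, mul_add, mul_add, ← map_mul,
    ← map_mul, C_mul_lambert, C_mul_lambert, add_add_add_comm, ← map_add, hc, lambert_add]
  congr 2
  funext m
  linear_combination (m : ℂ) ^ 2 * key m

/-- The coefficients of the Lambert series of level six. -/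
def levelSixCoeff (m : ℕ) : ℂ :=
  -chi3 (m : ZMod 3) - if 2 ∣ m then 2 * chi3 ((m / 2 : ℕ) : ZMod 3) else 0

theorem extremalQ_d6_eq {t : TorusPoint ℂ} (h : t.x ^ 2 - t.x + 1 = 0) {d : Case}
    (hd : d.degree = 6) :
    extremalQ d = C (2 / 3 * t.j) * t.J₂ ∧ 2 / 3 * t.j * t.j₂ = 1 ∧
      extremalQ d = C 1 + lambert fun m => levelSixCoeff m * (m : ℂ) ^ 2 := by
  have hx3 : t.x ^ 3 = -1 := by linear_combination (t.x + 1) * h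
  have hx : t.x ^ 6 = 1 := by linear_combination (t.x ^ 3 - 1) * hx3
  have hxi : t.xi = -t.x ^ 2 := by linear_combination -t.x ^ 2 * t.mul_inv + t.xi * hx3
  obtain ⟨t'', ht''⟩ : ∃ t' : TorusPoint ℂ, t'.x = -1 :=
    ⟨TorusPoint.ofNe (-1) (by norm_num) (by norm_num), rfl⟩
  obtain ⟨t', ht'⟩ : ∃ t' : TorusPoint ℂ, t'.x = t.x ^ 2 := by
    refine ⟨TorusPoint.ofNe (t.x ^ 2) (fun h0 => ?_) (fun h0 => ?_), rfl⟩
    · rw [h0, pow_eq_zero_iff two_ne_zero |>.1 h0] at h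
      norm_num at h
    · have h2 : t.x = 2 := by linear_combination h0 - h
      rw [h2] at h
      norm_num at h
  have hj' : t''.j = 0 := by
    rw [← TorusPoint.constantCoeff_J₀, (TorusPoint.isHalf_J ht'').1, map_zero]
  have hj : 4 * t.j ^ 2 = -3 := by
    have g1 := TorusPoint.j_cyclic t' t' t' (by rw [ht']; linear_combination hx)
    have g2 := TorusPoint.j_cyclic t t' t'' (by rw [ht', ht'']; linear_combination -hx3)
    rw [hj'] at g2
    have g3 : t'.j * (12 * t'.j - 4 * t.j) = 0 := by linear_combination g1 - g2
    rcases mul_eq_zero.1 g3 with g | g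
    · rw [g] at g1
      norm_num at g1
    · linear_combination 3 * g2 - t.j * g
  have hc : 2 / 3 * t.j * t.j₂ = 1 := by
    rw [TorusPoint.j₂]
    linear_combination (1 / 3 : ℂ) * t.j ^ 2 * t.four_mul_j₁ + ((1 / 3) * t.j ^ 2 - 1 / 3) * hj
  have hE : extremalQ d = C (2 / 3 * t.j) * t.J₂ := by
    obtain ⟨g1, g2⟩ := TorusPoint.extremalQ_d6 h ht' ht''
    cases d with
    | d6I => exact g1
    | d6II => exact g2
    | _ => exact absurd hd (by decide)
  refine ⟨hE, hc, ?_⟩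
  have s1 : 2 / 3 * t.j * t.s 1 = -1 := by
    have := t.j_mul_s_one
    rw [hxi] at this
    linear_combination (1 / 3 : ℂ) * (this + h)
  have s2 : t.s 2 = t.s 1 := by
    simp only [TorusPoint.s, hxi]
    linear_combination -t.x * hx3
  have s3 : t.s 3 = 0 := by
    simp only [TorusPoint.s, hxi]
    linear_combination t.x ^ 3 * hx3
  have s4 : t.s 4 = -t.s 1 := by
    simp only [TorusPoint.s, hxi]
    linear_combination t.x * hx3 - t.x ^ 2 * hx
  have s5 : t.s 5 = -t.s 1 := by
    simp only [TorusPoint.s, hxi]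
    linear_combination (t.x ^ 2 + t.x) * hx3 + t.x ^ 4 * hx
  have key : ∀ m : ℕ, 2 / 3 * t.j * t.s m = levelSixCoeff m := by
    refine funext_of_periodic (N := 6) (by norm_num) (fun m => by rw [TorusPoint.s_add hx])
      (fun m => ?_) fun m hm => ?_
    · have g1 : (m + 6) / 2 = m / 2 + 3 := by omega
      have g2 : 2 ∣ m + 6 ↔ 2 ∣ m := by omega
      rw [levelSixCoeff, levelSixCoeff, g1, character_add, show m + 6 = m + 3 + 3 by rfl,
        character_add, character_add]
      simp only [show m + 3 + 3 = m + 6 by rfl, g2]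
    · have h0 : chi3 0 = 0 := MulChar.map_zero _
      have h3 : chi3 3 = 0 := h0
      have h4 : chi3 4 = 1 := map_one chi3
      have h5 : chi3 5 = -1 := chi3_two
      interval_cases m <;> simp only [levelSixCoeff]
      · simp [TorusPoint.s_zero, h0]
      · simp [s1]
      · simp [s1, s2, chi3_two]
        norm_num
      · simp [s3, h3]
      · simp [s4, s1, h4, chi3_two]
        norm_num
      · simp [s5, s1, h5]
  rw [hE, TorusPoint.J₂, mul_add, ← map_mul, hc, C_mul_lambert]
  congr 2
  funext m
  linear_combination (m : ℂ) ^ 2 * key m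

/-! ### The extremal functions as combinations of Eisenstein series -/

theorem normalizedEisenstein_eq {N : ℕ} [NeZero N] (ψ : DirichletCharacter ℂ N) (n : ℕ) (τ : ℍ) :
    normalizedEisenstein 3 (1 : DirichletCharacter ℂ 1) ψ n τ = 1 / 2 * ψ.LFunction (-2) +
      ∑' m : ℕ+, ψ (m : ℕ) * (m : ℂ) ^ 2 *
        ((qOf τ ^ n) ^ (m : ℕ) / (1 - (qOf τ ^ n) ^ (m : ℕ))) := by
  rw [normalizedEisenstein, if_pos rfl, mul_one, show (1 : ℂ) - (3 : ℕ) = -2 by norm_num]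
  congr 1
  refine tsum_congr fun m => ?_
  simp only [Finset.Icc_self, Finset.sum_singleton, Nat.cast_one, map_one, one_mul, ← pow_mul]
  rw [mul_comm n]

theorem hasSum_of_eq_C_add_lambert {E : ℂ⟦X⟧} {c : ℂ} {g : ℕ → ℂ} {B : ℝ} {k : ℕ} {r : ℂ}
    (hE : E = C c + lambert g) (hg : ∀ m, ‖g m‖ ≤ B * m ^ k) (hr : ‖r‖ < 1) :
    HasSum (fun n : ℕ => coeff n E * r ^ n)
      (c + ∑' m : ℕ+, g m * (r ^ (m : ℕ) / (1 - r ^ (m : ℕ)))) := by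
  rw [← tsum_lambert hg hr]
  have h0 : HasSum (fun n : ℕ => coeff n (C c : ℂ⟦X⟧) * r ^ n) c := by
    convert! hasSum_single 0 (f := fun n : ℕ => coeff n (C c : ℂ⟦X⟧) * r ^ n) ?_ using 1
    · simp
    · intro n hn
      rw [coeff_C, if_neg hn, zero_mul]
  simpa only [hE, map_add, add_mul] using h0.add (hasSum_lambert hg hr)

theorem summable_lambert_pnat {g : ℕ → ℂ} {B : ℝ} {k : ℕ} {r : ℂ}
    (hg : ∀ m, ‖g m‖ ≤ B * m ^ k) (hr : ‖r‖ < 1) :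
    Summable fun m : ℕ+ => g m * (r ^ (m : ℕ) / (1 - r ^ (m : ℕ))) := by
  refine (summable_lambert hg hr).prod.congr fun m => ?_
  exact tsum_lambert_fiber hr m

theorem norm_mul_sq_le {a : ℂ} {B : ℝ} (ha : ‖a‖ ≤ B) (m : ℕ) :
    ‖a * (m : ℂ) ^ 2‖ ≤ B * (m : ℝ) ^ 2 := by
  rw [norm_mul, norm_pow, Complex.norm_natCast]
  gcongr

theorem norm_character_mul_sq_le {N : ℕ} (χ : DirichletCharacter ℂ N) (a : ℂ) (m : ℕ) :
    ‖a * χ (m : ZMod N) * (m : ℂ) ^ 2‖ ≤ ‖a‖ * (m : ℝ) ^ 2 := by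
  refine norm_mul_sq_le ?_ m
  rw [norm_mul]
  exact mul_le_of_le_one_right (norm_nonneg _) (χ.norm_le_one _)

/-! ### Choice of torsion points and convergence on the unit disc -/

theorem exists_level_three : ∃ t : TorusPoint ℂ,
    t.x = Complex.exp (2 * Real.pi * Complex.I / 3) ∧ t.x ^ 2 + t.x + 1 = 0 := by
  obtain ⟨t, ht, hp⟩ := exists_torusPoint (N := 3) (by norm_num)
  refine ⟨t, by exact_mod_cast ht, ?_⟩
  have h1 : t.x - 1 ≠ 0 := sub_ne_zero.2 (hp.ne_one (by norm_num))
  refine mul_left_cancel₀ h1 ?_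
  linear_combination hp.pow_eq_one

theorem exists_level_four : ∃ t : TorusPoint ℂ,
    t.x = Complex.exp (2 * Real.pi * Complex.I / 4) ∧ t.x ^ 2 = -1 := by
  obtain ⟨t, ht, hp⟩ := exists_torusPoint (N := 4) (by norm_num)
  refine ⟨t, by exact_mod_cast ht, ?_⟩
  have h1 : t.x ^ 2 - 1 ≠ 0 := sub_ne_zero.2 (hp.pow_ne_one_of_pos_of_lt (by norm_num) (by norm_num))
  refine mul_left_cancel₀ h1 ?_
  linear_combination hp.pow_eq_one

theorem exists_level_five : ∃ t t' : TorusPoint ℂ,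
    t.x = Complex.exp (2 * Real.pi * Complex.I / 5) ∧
      t.x ^ 4 + t.x ^ 3 + t.x ^ 2 + t.x + 1 = 0 ∧ t'.x = t.x ^ 2 := by
  obtain ⟨t, ht, hp⟩ := exists_torusPoint (N := 5) (by norm_num)
  have h1 : t.x - 1 ≠ 0 := sub_ne_zero.2 (hp.ne_one (by norm_num))
  refine ⟨t, TorusPoint.ofNe (t.x ^ 2) (pow_ne_zero 2 (hp.ne_zero (by norm_num)))
    (hp.pow_ne_one_of_pos_of_lt (by norm_num) (by norm_num)), by exact_mod_cast ht, ?_, rfl⟩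
  refine mul_left_cancel₀ h1 ?_
  linear_combination hp.pow_eq_one

theorem exists_level_six : ∃ t : TorusPoint ℂ,
    t.x = Complex.exp (2 * Real.pi * Complex.I / 6) ∧ t.x ^ 2 - t.x + 1 = 0 := by
  obtain ⟨t, ht, hp⟩ := exists_torusPoint (N := 6) (by norm_num)
  refine ⟨t, by exact_mod_cast ht, ?_⟩
  have h1 : t.x ^ 3 - 1 ≠ 0 := sub_ne_zero.2 (hp.pow_ne_one_of_pos_of_lt (by norm_num) (by norm_num))
  have h2 : t.x ^ 2 - 1 ≠ 0 := sub_ne_zero.2 (hp.pow_ne_one_of_pos_of_lt (by norm_num) (by norm_num))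
  have h3 : t.x + 1 ≠ 0 := fun h => h2 (by linear_combination (t.x - 1) * h)
  refine mul_left_cancel₀ (mul_ne_zero h1 h3) ?_
  linear_combination hp.pow_eq_one

theorem hasSum_d3 {r : ℂ} (hr : ‖r‖ < 1) :
    HasSum (fun n : ℕ => coeff n (extremalQ Case.d3) * r ^ n)
      (1 + ∑' m : ℕ+, -9 * chi3 ((m : ℕ) : ZMod 3) * ((m : ℕ) : ℂ) ^ 2 *
        (r ^ (m : ℕ) / (1 - r ^ (m : ℕ)))) := by
  obtain ⟨t, -, ht⟩ := exists_level_three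
  exact hasSum_of_eq_C_add_lambert (extremalQ_d3_eq ht).2.2 (norm_character_mul_sq_le _ _) hr

theorem hasSum_d4 {r : ℂ} (hr : ‖r‖ < 1) :
    HasSum (fun n : ℕ => coeff n (extremalQ Case.d4) * r ^ n)
      (1 + ∑' m : ℕ+, -4 * chi4 ((m : ℕ) : ZMod 4) * ((m : ℕ) : ℂ) ^ 2 *
        (r ^ (m : ℕ) / (1 - r ^ (m : ℕ)))) := by
  obtain ⟨t, -, ht⟩ := exists_level_four
  exact hasSum_of_eq_C_add_lambert (extremalQ_d4_eq ht).2.2 (norm_character_mul_sq_le _ _) hr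

theorem hasSum_d5 {r : ℂ} (hr : ‖r‖ < 1) :
    HasSum (fun n : ℕ => coeff n (extremalQ Case.d5) * r ^ n)
      (1 + ∑' m : ℕ+, ((-1 + Complex.I / 2) * chi5 ((m : ℕ) : ZMod 5) +
        (-1 - Complex.I / 2) * chi5bar ((m : ℕ) : ZMod 5)) * ((m : ℕ) : ℂ) ^ 2 *
        (r ^ (m : ℕ) / (1 - r ^ (m : ℕ)))) := by
  obtain ⟨t, t', -, ht, ht'⟩ := exists_level_five
  refine hasSum_of_eq_C_add_lambert (extremalQ_d5_eq ht ht')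
    (B := ‖-1 + Complex.I / 2‖ + ‖-1 - Complex.I / 2‖) (fun m => norm_mul_sq_le ?_ m) hr
  refine (norm_add_le _ _).trans (add_le_add ?_ ?_) <;> rw [norm_mul]
  · exact mul_le_of_le_one_right (norm_nonneg _) (chi5.norm_le_one _)
  · exact mul_le_of_le_one_right (norm_nonneg _) (chi5bar.norm_le_one _)

theorem norm_levelSixCoeff_le (m : ℕ) : ‖levelSixCoeff m‖ ≤ 3 := by
  have h1 := chi3.norm_le_one (m : ZMod 3)
  have h2 := chi3.norm_le_one ((m / 2 : ℕ) : ZMod 3)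
  rw [levelSixCoeff]
  refine (norm_sub_le _ _).trans ?_
  rw [norm_neg]
  split_ifs
  · rw [norm_mul, Complex.norm_ofNat]
    linarith
  · rw [norm_zero]
    linarith

theorem hasSum_d6 {d : Case} (hd : d.degree = 6) {r : ℂ} (hr : ‖r‖ < 1) :
    HasSum (fun n : ℕ => coeff n (extremalQ d) * r ^ n)
      (1 + ∑' m : ℕ+, levelSixCoeff m * ((m : ℕ) : ℂ) ^ 2 *
        (r ^ (m : ℕ) / (1 - r ^ (m : ℕ)))) := by
  obtain ⟨t, -, ht⟩ := exists_level_six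
  exact hasSum_of_eq_C_add_lambert (extremalQ_d6_eq ht hd).2.2
    (fun m => norm_mul_sq_le (norm_levelSixCoeff_le m) m) hr

theorem hasSum_d8 {r : ℂ} (hr : ‖r‖ < 1) :
    HasSum (fun n : ℕ => coeff n (extremalQ Case.d8) * r ^ n)
      (1 + ∑' m : ℕ+, -4 * chi4 ((m : ℕ) : ZMod 4) * ((m : ℕ) : ℂ) ^ 2 *
        ((r ^ 2) ^ (m : ℕ) / (1 - (r ^ 2) ^ (m : ℕ)))) := by
  have hr2 : ‖r ^ 2‖ < 1 := by
    rw [norm_pow]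
    exact pow_lt_one₀ (norm_nonneg _) hr two_ne_zero
  have h := hasSum_d4 hr2
  have hi : Function.Injective fun n : ℕ => 2 * n := fun a b hab => by
    simpa using hab
  rw [← hi.hasSum_iff]
  · have e : (fun n : ℕ => coeff n (extremalQ Case.d8) * r ^ n) ∘ (fun n : ℕ => 2 * n) =
        fun n : ℕ => coeff n (extremalQ Case.d4) * (r ^ 2) ^ n := by
      funext n
      rw [Function.comp_apply, extremalQ_d8, coeff_subst_X_pow two_ne_zero,
        if_pos (dvd_mul_right 2 n), Nat.mul_div_cancel_left n two_pos, pow_mul,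
        Algebra.algebraMap_self_apply]
    rw [e]
    exact h
  · intro n hn
    rw [extremalQ_d8, coeff_subst_X_pow two_ne_zero, if_neg, zero_mul]
    rintro ⟨k, rfl⟩
    exact hn ⟨k, rfl⟩

theorem summable_extremal (d : Case) (τ : ℍ) :
    Summable fun n : ℕ => coeff n (extremalQ d) * qOf τ ^ n := by
  have hq := norm_qOf_lt_one τ
  cases d with
  | d3 => exact (hasSum_d3 hq).summable
  | d4 => exact (hasSum_d4 hq).summable
  | d5 => exact (hasSum_d5 hq).summable
  | d6I => exact (hasSum_d6 rfl hq).summable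
  | d6II => exact (hasSum_d6 rfl hq).summable
  | d8 => exact (hasSum_d8 hq).summable

theorem extremal_d3 (τ : ℍ) : extremal Case.d3 τ =
    -9 * normalizedEisenstein 3 (1 : DirichletCharacter ℂ 1) chi3 1 τ := by
  rw [extremal, (hasSum_d3 (norm_qOf_lt_one τ)).tsum_eq, normalizedEisenstein_eq, LFunction_chi3,
    mul_add, ← tsum_mul_left]
  simp only [mul_assoc, pow_one]
  norm_num

theorem extremal_d4 (τ : ℍ) : extremal Case.d4 τ =
    -4 * normalizedEisenstein 3 (1 : DirichletCharacter ℂ 1) chi4 1 τ := by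
  rw [extremal, (hasSum_d4 (norm_qOf_lt_one τ)).tsum_eq, normalizedEisenstein_eq, LFunction_chi4,
    mul_add, ← tsum_mul_left]
  simp only [mul_assoc, pow_one]
  norm_num

theorem extremal_d8 (τ : ℍ) : extremal Case.d8 τ =
    -4 * normalizedEisenstein 3 (1 : DirichletCharacter ℂ 1) chi4 2 τ := by
  rw [extremal, (hasSum_d8 (norm_qOf_lt_one τ)).tsum_eq, normalizedEisenstein_eq, LFunction_chi4,
    mul_add, ← tsum_mul_left]
  simp only [mul_assoc]
  norm_num

theorem norm_character_sq_le {N : ℕ} (χ : DirichletCharacter ℂ N) (m : ℕ) :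
    ‖χ (m : ZMod N) * (m : ℂ) ^ 2‖ ≤ 1 * (m : ℝ) ^ 2 :=
  norm_mul_sq_le (χ.norm_le_one _) m

theorem extremal_d5 (τ : ℍ) : extremal Case.d5 τ =
    (-1 + Complex.I / 2) * normalizedEisenstein 3 (1 : DirichletCharacter ℂ 1) chi5 1 τ
      + (-1 - Complex.I / 2) *
        normalizedEisenstein 3 (1 : DirichletCharacter ℂ 1) chi5bar 1 τ := by
  have hq := norm_qOf_lt_one τ
  have h1 := summable_lambert_pnat (norm_character_sq_le chi5) hq
  have h2 := summable_lambert_pnat (norm_character_sq_le chi5bar) hq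
  have h : ∑' m : ℕ+, ((-1 + Complex.I / 2) * chi5 ((m : ℕ) : ZMod 5) +
        (-1 - Complex.I / 2) * chi5bar ((m : ℕ) : ZMod 5)) * ((m : ℕ) : ℂ) ^ 2 *
        (qOf τ ^ (m : ℕ) / (1 - qOf τ ^ (m : ℕ))) =
      (-1 + Complex.I / 2) * ∑' m : ℕ+, chi5 ((m : ℕ) : ZMod 5) * ((m : ℕ) : ℂ) ^ 2 *
        (qOf τ ^ (m : ℕ) / (1 - qOf τ ^ (m : ℕ))) +
      (-1 - Complex.I / 2) * ∑' m : ℕ+, chi5bar ((m : ℕ) : ZMod 5) * ((m : ℕ) : ℂ) ^ 2 *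
        (qOf τ ^ (m : ℕ) / (1 - qOf τ ^ (m : ℕ))) := by
    rw [← tsum_mul_left, ← tsum_mul_left, ← (h1.mul_left _).tsum_add (h2.mul_left _)]
    exact tsum_congr fun m => by ring
  rw [extremal, (hasSum_d5 hq).tsum_eq, normalizedEisenstein_eq, normalizedEisenstein_eq,
    LFunction_chi5, LFunction_chi5bar, h]
  simp only [pow_one]
  linear_combination (1 / 5 : ℂ) * Complex.I_mul_I

theorem extremal_d6 {d : Case} (hd : d.degree = 6) (τ : ℍ) : extremal d τ =
    -normalizedEisenstein 3 (1 : DirichletCharacter ℂ 1) chi3 1 τ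
      - 8 * normalizedEisenstein 3 (1 : DirichletCharacter ℂ 1) chi3 2 τ := by
  have hq := norm_qOf_lt_one τ
  have hq2 : ‖qOf τ ^ 2‖ < 1 := by
    rw [norm_pow]
    exact pow_lt_one₀ (norm_nonneg _) hq two_ne_zero
  have h1 := summable_lambert_pnat (norm_character_sq_le chi3) hq
  have h2 := summable_lambert_pnat (norm_character_sq_le chi3) hq2
  set F : ℕ+ → ℂ := fun m => (if 2 ∣ (m : ℕ) then 2 * chi3 (((m : ℕ) / 2 : ℕ) : ZMod 3) else 0) *
    ((m : ℕ) : ℂ) ^ 2 * (qOf τ ^ (m : ℕ) / (1 - qOf τ ^ (m : ℕ))) with hF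
  have hi : Function.Injective fun m : ℕ+ => 2 * m := fun a b hab => mul_left_cancel hab
  -- Only even indices 2m contribute, and 2 χ(m)(2m)² = 8 χ(m) m² produces the factor 8.
  have h3 : HasSum F (8 * ∑' m : ℕ+, chi3 ((m : ℕ) : ZMod 3) * ((m : ℕ) : ℂ) ^ 2 *
        ((qOf τ ^ 2) ^ (m : ℕ) / (1 - (qOf τ ^ 2) ^ (m : ℕ)))) := by
    rw [← hi.hasSum_iff]
    · convert! h2.hasSum.mul_left 8 using 1
      funext m
      have e : ((2 * m : ℕ+) : ℕ) = 2 * (m : ℕ) := rfl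
      simp only [hF, Function.comp_apply, e, dvd_mul_right, if_true,
        Nat.mul_div_cancel_left _ two_pos, pow_mul, Nat.cast_mul, Nat.cast_ofNat]
      ring
    · intro m hm
      simp only [hF]
      rw [if_neg, zero_mul, zero_mul]
      rintro ⟨k, hk⟩
      refine hm ⟨⟨k, ?_⟩, ?_⟩
      · have := m.pos
        omega
      · exact PNat.eq hk.symm
  have h : ∑' m : ℕ+, levelSixCoeff m * ((m : ℕ) : ℂ) ^ 2 *
        (qOf τ ^ (m : ℕ) / (1 - qOf τ ^ (m : ℕ))) =
      -(∑' m : ℕ+, chi3 ((m : ℕ) : ZMod 3) * ((m : ℕ) : ℂ) ^ 2 *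
        (qOf τ ^ (m : ℕ) / (1 - qOf τ ^ (m : ℕ)))) -
      8 * ∑' m : ℕ+, chi3 ((m : ℕ) : ZMod 3) * ((m : ℕ) : ℂ) ^ 2 *
        ((qOf τ ^ 2) ^ (m : ℕ) / (1 - (qOf τ ^ 2) ^ (m : ℕ))) := by
    rw [← h3.tsum_eq, ← tsum_neg, ← h1.neg.tsum_sub h3.summable]
    refine tsum_congr fun m => ?_
    simp only [hF, levelSixCoeff]
    ring
  rw [extremal, (hasSum_d6 hd hq).tsum_eq, normalizedEisenstein_eq, normalizedEisenstein_eq,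
    LFunction_chi3, h]
  simp only [pow_one]
  ring

section

open Filter Topology

/-! ### Lipschitz sums -/

/-- The sum of `(z + n) ^ (-3)` over all integers `n`. -/
def lipschitz (z : ℂ) : ℂ := ∑' n : ℤ, 1 / (z + n) ^ 3

/-- The constant in the Lipschitz formula of weight three. -/
def lipschitzConst : ℂ := (-2 * Real.pi * Complex.I) ^ 3 / 2

theorem lipschitzConst_ne_zero : lipschitzConst ≠ 0 := by
  have := Real.pi_ne_zero
  simp [lipschitzConst, Complex.I_ne_zero, this]

theorem lipschitz_neg (z : ℂ) : lipschitz (-z) = -lipschitz z := by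
  rw [lipschitz, lipschitz, ← (Equiv.neg ℤ).tsum_eq, ← tsum_neg]
  refine tsum_congr fun n => ?_
  rw [Equiv.neg_apply, Int.cast_neg, ← neg_add, Odd.neg_pow (by decide), div_neg]

theorem lipschitz_upper (z : ℍ) : lipschitz z = lipschitzConst *
    ∑' n : ℕ+, (n : ℂ) ^ 2 * Complex.exp (2 * Real.pi * Complex.I * z) ^ (n : ℕ) := by
  have := EisensteinSeries.qExpansion_identity_pnat (k := 2) one_le_two z
  simpa [lipschitz, lipschitzConst] using this

theorem hasSum_sq_mul_geometric {r : ℂ} (hr : ‖r‖ < 1) :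
    HasSum (fun n : ℕ => (n : ℂ) ^ 2 * r ^ n) (r * (1 + r) / (1 - r) ^ 3) := by
  have h1 : 1 - r ≠ 0 := by
    intro h
    rw [← sub_eq_zero.1 h, norm_one] at hr
    exact lt_irrefl _ hr
  have h := (((hasSum_choose_mul_geometric_of_norm_lt_one 2 hr).mul_left 2).sub
    ((hasSum_choose_mul_geometric_of_norm_lt_one 1 hr).mul_left 3)).add
    (hasSum_geometric_of_norm_lt_one hr)
  convert! h using 1
  · funext n
    rw [Nat.cast_choose_two, Nat.choose_one_right]
    push_cast
    ring
  · field_simp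
    ring

theorem summable_lipschitz (z : ℂ) : Summable fun n : ℤ => 1 / (z + n) ^ 3 := by
  have := EisensteinSeries.linear_right_summable z 1 (k := 3) (by norm_num)
  refine this.congr fun n => ?_
  rw [Int.cast_one, one_mul, one_div]
  rfl

/-- Moving vertically away from the real point x only increases the distance to the integers, so the
terms at x dominate uniformly. -/
theorem continuous_lipschitz_vertical {x : ℝ} (hx : ∀ n : ℤ, x ≠ n) :
    Continuous fun ε : ℝ => lipschitz (x + ε * Complex.I) := by
  have hne : ∀ (n : ℤ) (ε : ℝ), (x : ℂ) + ε * Complex.I + n ≠ 0 := by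
    intro n ε h
    have := congrArg Complex.re h
    simp at this
    refine hx (-n) ?_
    push_cast
    linarith
  refine continuous_tsum (u := fun n : ℤ => ‖1 / ((x : ℂ) + n) ^ 3‖) (fun n => ?_)
    (summable_lipschitz x).norm fun n ε => ?_
  · refine continuous_const.div (by fun_prop) fun ε => pow_ne_zero 3 (hne n ε)
  · rw [norm_div, norm_div, norm_pow, norm_pow]
    have h0 := hne n 0
    rw [Complex.ofReal_zero, zero_mul, add_zero] at h0
    have : ‖(x : ℂ) + n‖ ≤ ‖(x : ℂ) + ε * Complex.I + n‖ := by
      have e1 : (x : ℂ) + n = ((x + n : ℝ) : ℂ) := by push_cast; rfl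
      rw [e1, Complex.norm_real, Real.norm_eq_abs]
      refine le_trans (le_of_eq ?_) (Complex.abs_re_le_norm _)
      simp
    have h1 : 0 < ‖(x : ℂ) + n‖ := norm_pos_iff.2 h0
    gcongr

/-- The value of the Lipschitz sum on the real line. -/
theorem lipschitz_ofReal {x : ℝ} (hx : ∀ n : ℤ, x ≠ n) {t : TorusPoint ℂ}
    (ht : t.x = Complex.exp (2 * Real.pi * Complex.I * x)) :
    lipschitz x = lipschitzConst * t.j₂ := by
  -- On the real line |e| = 1 and ∑ n² eⁿ diverges. Its closed form e(1 + e)/(1 - e)³ is still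
  -- continuous there, so the Lipschitz formula is extended by letting ε tend to 0 from above.
  set e : ℝ → ℂ := fun ε => Complex.exp (2 * Real.pi * Complex.I * (x + ε * Complex.I)) with he
  have he0 : e 0 = t.x := by simp [he, ht]
  have hc : Continuous e := by fun_prop
  have h1 : 1 - e 0 ≠ 0 := by rw [he0]; exact t.isUnit_one_sub.ne_zero
  have hR : ContinuousAt (fun ε => lipschitzConst * (e ε * (1 + e ε) / (1 - e ε) ^ 3)) 0 := by
    refine continuousAt_const.mul (ContinuousAt.div ?_ ?_ (pow_ne_zero 3 h1))
    · exact (hc.mul (continuous_const.add hc)).continuousAt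
    · exact ((continuous_const.sub hc).pow 3).continuousAt
  have hL := (continuous_lipschitz_vertical hx).continuousAt (x := 0)
  have hEq : ∀ᶠ ε : ℝ in 𝓝[>] (0 : ℝ), lipschitz (x + ε * Complex.I) =
      lipschitzConst * (e ε * (1 + e ε) / (1 - e ε) ^ 3) := by
    filter_upwards [self_mem_nhdsWithin] with ε hε
    have him : 0 < ((x : ℂ) + ε * Complex.I).im := by simpa using hε
    have h := lipschitz_upper ⟨_, him⟩
    have hn : ‖e ε‖ < 1 := UpperHalfPlane.norm_exp_two_pi_I_lt_one ⟨_, him⟩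
    have hs := hasSum_sq_mul_geometric hn
    rw [← hs.tsum_eq, ← tsum_zero_pnat_eq_tsum_nat hs.summable]
    simpa using h
  have h2 := tendsto_nhds_unique_of_eventuallyEq (hL.tendsto.mono_left nhdsWithin_le_nhds)
    (hR.tendsto.mono_left nhdsWithin_le_nhds) hEq
  rw [he0] at h2
  have h3 : t.j₂ = t.x * (1 + t.x) / (1 - t.x) ^ 3 := by
    have hu := t.isUnit_one_sub.ne_zero
    rw [eq_div_iff (pow_ne_zero 3 hu), TorusPoint.j₂]
    have := t.two_mul_j
    have h4 := t.four_mul_j₁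
    have h5 : t.j₁ * (1 - t.x) ^ 2 = t.x := by
      linear_combination (1 / 4 : ℂ) * (1 - t.x) ^ 2 * h4
        + (1 / 4 : ℂ) * (2 * t.j * (1 - t.x) + (1 + t.x)) * this
    linear_combination (2 * t.j * (1 - t.x)) * h5 + t.x * this
  rw [h3, ← h2]
  simp

end

section

open EisensteinSeries

/-! ### Sums over lattices -/

theorem tsum_lambert_swap {g : ℕ → ℂ} {B : ℝ} {k : ℕ} {r : ℂ} (hg : ∀ m, ‖g m‖ ≤ B * m ^ k)
    (hr : ‖r‖ < 1) : ∑' b : ℕ+, ∑' m : ℕ+, g m * r ^ (m * b : ℕ) =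
      ∑' c : ℕ+ × ℕ+, g c.1 * r ^ (c.1 * c.2 : ℕ) := by
  have h := summable_lambert hg hr
  rw [h.tsum_prod]
  exact Summable.tsum_comm (f := fun m b : ℕ+ => g m * r ^ (m * b : ℕ)) h

theorem norm_sq_mul_le {a : ℕ → ℂ} {B : ℝ} (ha : ∀ m, ‖a m‖ ≤ B) (m : ℕ) :
    ‖(m : ℂ) ^ 2 * a m‖ ≤ B * (m : ℝ) ^ 2 := by
  rw [mul_comm]
  exact norm_mul_sq_le (ha m) m

/-- The value at `τ` of the series `J₂` of a torus point. -/
def TorusPoint.value (t : TorusPoint ℂ) (τ : ℍ) : ℂ :=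
  t.j₂ + ∑' c : ℕ+ × ℕ+, (((c.1 : ℕ) : ℂ) ^ 2 * t.s c.1) * qOf τ ^ (c.1 * c.2 : ℕ)

theorem norm_xi {t : TorusPoint ℂ} (h : ‖t.x‖ = 1) : ‖t.xi‖ = 1 := by
  have := congrArg norm t.mul_inv
  rwa [norm_mul, h, one_mul, norm_one] at this

theorem norm_s_le {t : TorusPoint ℂ} (h : ‖t.x‖ = 1) (m : ℕ) : ‖t.s m‖ ≤ 2 := by
  refine (norm_sub_le _ _).trans ?_
  rw [norm_pow, norm_pow, h, norm_xi h, one_pow]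
  norm_num

theorem hasSum_J₂ {t : TorusPoint ℂ} (h : ‖t.x‖ = 1) (τ : ℍ) :
    HasSum (fun n : ℕ => coeff n t.J₂ * qOf τ ^ n) (t.value τ) := by
  have hb := norm_sq_mul_le (norm_s_le h)
  rw [TorusPoint.value, tsum_lambert hb (norm_qOf_lt_one τ)]
  exact hasSum_of_eq_C_add_lambert rfl hb (norm_qOf_lt_one τ)

/-- The row c = 0 gives the constant term j₂, positive c give the part with x^m by the Lipschitz
formula, and negative c give minus the part with x^(-m) because the Lipschitz sum is odd. -/
theorem tsum_lipschitz {x : ℝ} (hx : ∀ n : ℤ, x ≠ n) {t : TorusPoint ℂ}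
    (ht : t.x = Complex.exp (2 * Real.pi * Complex.I * x)) (τ : ℍ)
    (hs : Summable fun c : ℤ => lipschitz (c * τ + x)) :
    ∑' c : ℤ, lipschitz (c * τ + x) = lipschitzConst * t.value τ := by
  have hxi : t.xi = Complex.exp (2 * Real.pi * Complex.I * (-x : ℝ)) := by
    have h1 : t.x * Complex.exp (2 * Real.pi * Complex.I * (-x : ℝ)) = 1 := by
      rw [ht, ← Complex.exp_add, ← Complex.exp_zero]
      congr 1
      push_cast
      ring
    linear_combination -t.xi * h1 + Complex.exp (2 * Real.pi * Complex.I * (-x : ℝ)) * t.mul_inv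
  have hn : ‖t.x‖ = 1 := by
    rw [ht, show 2 * Real.pi * Complex.I * x = ((2 * Real.pi * x : ℝ) : ℂ) * Complex.I by
      push_cast; ring, Complex.norm_exp_ofReal_mul_I]
  have key : ∀ (y : ℝ) (c : ℕ+), lipschitz ((c : ℕ) * τ + y) = lipschitzConst * ∑' m : ℕ+,
      (((m : ℕ) : ℂ) ^ 2 * Complex.exp (2 * Real.pi * Complex.I * y) ^ (m : ℕ)) *
        qOf τ ^ (m * c : ℕ) := by
    intro y c
    have him : 0 < (((c : ℕ) : ℂ) * τ + y).im := by
      have := c.pos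
      have h2 := τ.im_pos
      simp
      positivity
    have h := lipschitz_upper ⟨_, him⟩
    refine h.trans ?_
    congr 1
    refine tsum_congr fun m => ?_
    rw [mul_assoc (((m : ℕ) : ℂ) ^ 2)]
    congr 1
    rw [qOf, mul_comm (m : ℕ), pow_mul, ← mul_pow, ← Complex.exp_nat_mul _ (c : ℕ), ← Complex.exp_add]
    congr 2
    simp only
    ring
  have hq := norm_qOf_lt_one τ
  have b1 := norm_sq_mul_le (a := fun m => t.x ^ m) (B := 1) fun m => by
    rw [norm_pow, hn, one_pow]
  have b2 := norm_sq_mul_le (a := fun m => t.xi ^ m) (B := 1) fun m => by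
    rw [norm_pow, norm_xi hn, one_pow]
  have f1 : ∀ c : ℕ+, lipschitz (((c : ℕ) : ℤ) * τ + x) = lipschitzConst * ∑' m : ℕ+,
      (((m : ℕ) : ℂ) ^ 2 * t.x ^ (m : ℕ)) * qOf τ ^ (m * c : ℕ) := by
    intro c
    rw [Int.cast_natCast, key, ht]
  have f2 : ∀ c : ℕ+, lipschitz ((-((c : ℕ) : ℤ) : ℤ) * τ + x) = -(lipschitzConst * ∑' m : ℕ+,
      (((m : ℕ) : ℂ) ^ 2 * t.xi ^ (m : ℕ)) * qOf τ ^ (m * c : ℕ)) := by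
    intro c
    rw [hxi, ← key, ← lipschitz_neg]
    congr 1
    push_cast
    ring
  rw [tsum_int_eq_zero_add_tsum_pnat hs]
  simp only [f1, f2]
  rw [tsum_neg, tsum_mul_left, tsum_mul_left, tsum_lambert_swap b1 hq, tsum_lambert_swap b2 hq,
    Int.cast_zero, zero_mul, zero_add, lipschitz_ofReal hx ht, TorusPoint.value]
  have h3 : ∑' c : ℕ+ × ℕ+, (((c.1 : ℕ) : ℂ) ^ 2 * t.s c.1) * qOf τ ^ (c.1 * c.2 : ℕ) =
      ∑' c : ℕ+ × ℕ+, (((c.1 : ℕ) : ℂ) ^ 2 * t.x ^ (c.1 : ℕ)) * qOf τ ^ (c.1 * c.2 : ℕ) -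
      ∑' c : ℕ+ × ℕ+, (((c.1 : ℕ) : ℂ) ^ 2 * t.xi ^ (c.1 : ℕ)) * qOf τ ^ (c.1 * c.2 : ℕ) := by
    rw [← (summable_lambert b1 hq).tsum_sub (summable_lambert b2 hq)]
    refine tsum_congr fun c => ?_
    rw [TorusPoint.s]
    ring
  rw [h3]
  ring

theorem tsum_int_eq_sum_residues (N : ℕ) [NeZero N] {f : ℤ → ℂ} (hf : Summable f) :
    ∑' a, f a = ∑ j ∈ Finset.range N, ∑' n : ℤ, f (n * N + j) := by
  set e : Fin N × ℤ ≃ ℤ := (Equiv.prodComm _ _).trans (Int.divModEquiv N).symm with he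
  have h : Summable fun p => f (e p) := e.summable_iff.2 hf
  rw [← e.tsum_eq f, Summable.tsum_prod h, tsum_fintype,
    ← Fin.sum_univ_eq_sum_range fun j => ∑' n : ℤ, f (n * N + j)]
  rfl

theorem eisSummand_three (v : Fin 2 → ℤ) (τ : ℍ) :
    eisSummand 3 v τ = 1 / ((v 0 : ℂ) * τ + v 1) ^ 3 := by
  rw [eisSummand, zpow_neg, one_div]
  rfl

theorem summable_pair (τ : ℍ) : Summable fun p : ℤ × ℤ => 1 / ((p.1 : ℂ) * τ + p.2) ^ 3 := by
  refine (summable_prod_eisSummand le_rfl τ).congr fun p => ?_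
  exact eisSummand_three _ τ

/-- Multiplying by N places the terms on the sublattice coset of pairs (cN, nN + j), a subfamily of
an absolutely convergent lattice sum. -/
theorem summable_lipschitz_torsion (N : ℕ) [NeZero N] (j : ℕ) (τ : ℍ) :
    Summable fun c : ℤ => lipschitz (c * τ + ((j / N : ℝ) : ℂ)) := by
  have hN : (N : ℂ) ≠ 0 := Nat.cast_ne_zero.2 (NeZero.ne N)
  have hN' : (N : ℤ) ≠ 0 := Nat.cast_ne_zero.2 (NeZero.ne N)
  have hi : Function.Injective fun p : ℤ × ℤ => ((p.1 * N, p.2 * N + j) : ℤ × ℤ) := by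
    rintro ⟨a, b⟩ ⟨c, d⟩ h
    simp only [Prod.mk.injEq, add_left_inj] at h
    rw [mul_left_injective₀ hN' h.1, mul_left_injective₀ hN' h.2]
  have h := (((summable_pair τ).comp_injective hi).mul_left ((N : ℂ) ^ 3)).prod
  refine h.congr fun c => ?_
  refine tsum_congr fun n => ?_
  simp only [Function.comp_apply]
  push_cast
  have : (c : ℂ) * N * τ + (n * N + j) = N * (c * τ + j / N + n) := by
    field_simp
    ring
  rw [this, mul_pow]
  field_simp

/-- The weight that selects the vectors `(c, a)` with `c` divisible by `N` and weights them by a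
function of `a` modulo `N`. -/
def weight {N : ℕ} (φ : ZMod N → ℂ) (v : Fin 2 → ℤ) : ℂ :=
  if ((v 0 : ℤ) : ZMod N) = 0 then φ ((v 1 : ℤ) : ZMod N) else 0

theorem exists_bound {N : ℕ} [NeZero N] (φ : ZMod N → ℂ) : ∃ B, ∀ a, ‖φ a‖ ≤ B :=
  ⟨∑ a, ‖φ a‖, fun a => Finset.single_le_sum (f := fun a => ‖φ a‖)
    (fun _ _ => norm_nonneg _) (Finset.mem_univ a)⟩

theorem summable_weight {N : ℕ} [NeZero N] (φ : ZMod N → ℂ) (τ : ℍ) :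
    Summable fun v => ‖weight φ v * eisSummand 3 v τ‖ := by
  obtain ⟨B, hB⟩ := exists_bound φ
  have h := (summable_norm_eisSummand (k := 3) le_rfl τ).mul_left B
  refine Summable.of_nonneg_of_le (fun _ => norm_nonneg _) (fun v => ?_) h
  rw [norm_mul]
  refine mul_le_mul_of_nonneg_right ?_ (norm_nonneg _)
  rw [weight]
  split_ifs
  · exact hB _
  · rw [norm_zero]
    exact (norm_nonneg _).trans (hB 0)

/-- With a = nN + j, the factor N³ comes out of each term and the sum over n is a Lipschitz sum at
cτ + j/N. -/
theorem tsum_weight {N : ℕ} [NeZero N] (φ : ZMod N → ℂ) (τ : ℍ) :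
    ∑' v, weight φ v * eisSummand 3 v τ = ∑ j ∈ Finset.range N, φ j * (((N : ℂ) ^ 3)⁻¹ *
      ∑' c : ℤ, lipschitz (c * τ + ((j / N : ℝ) : ℂ))) := by
  have hN : (N : ℂ) ≠ 0 := Nat.cast_ne_zero.2 (NeZero.ne N)
  have hN' : (N : ℤ) ≠ 0 := Nat.cast_ne_zero.2 (NeZero.ne N)
  set i : ℤ × ℤ → (Fin 2 → ℤ) := fun p => ![p.1 * N, p.2] with hi
  have hinj : Function.Injective i := by
    rintro ⟨a, b⟩ ⟨c, d⟩ h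
    have h0 := congrFun h 0
    have h1 := congrFun h 1
    simp only [hi, Matrix.cons_val_zero, Matrix.cons_val_one] at h0 h1
    rw [mul_left_injective₀ hN' h0, h1]
  have hsupp : Function.support (fun v => weight φ v * eisSummand 3 v τ) ⊆ Set.range i := by
    intro v hv
    have h0 : ((v 0 : ℤ) : ZMod N) = 0 := by
      by_contra h
      refine hv ?_
      simp only [weight, if_neg h, zero_mul]
    obtain ⟨c, hc⟩ := (ZMod.intCast_zmod_eq_zero_iff_dvd _ _).1 h0
    refine ⟨(c, v 1), ?_⟩
    funext k
    fin_cases k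
    · simp [hi, hc, mul_comm]
    · simp [hi]
  have hs : Summable fun p => weight φ (i p) * eisSummand 3 (i p) τ :=
    (summable_weight φ τ).of_norm.comp_injective hinj
  have hval : ∀ p : ℤ × ℤ, weight φ (i p) * eisSummand 3 (i p) τ =
      φ (p.2 : ZMod N) * (1 / ((p.1 : ℂ) * N * τ + p.2) ^ 3) := by
    intro p
    rw [eisSummand_three, weight]
    simp [hi]
  rw [← hinj.tsum_eq hsupp, Summable.tsum_prod hs]
  have hrow : ∀ c : ℤ, ∑' a : ℤ, weight φ (i (c, a)) * eisSummand 3 (i (c, a)) τ =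
      ∑ j ∈ Finset.range N, φ j * (((N : ℂ) ^ 3)⁻¹ * lipschitz (c * τ + ((j / N : ℝ) : ℂ))) := by
    intro c
    rw [tsum_int_eq_sum_residues N (hs.prod_factor c)]
    refine Finset.sum_congr rfl fun j _ => ?_
    rw [lipschitz, ← tsum_mul_left, ← tsum_mul_left]
    refine tsum_congr fun n => ?_
    rw [hval]
    push_cast
    rw [ZMod.natCast_self, mul_zero, zero_add]
    have : (c : ℂ) * N * τ + (n * N + j) = N * (c * τ + j / N + n) := by
      field_simp
      ring
    rw [this, mul_pow, one_div, mul_inv, one_div]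
  simp only [hrow]
  rw [Summable.tsum_finsetSum]
  · simp only [tsum_mul_left]
  · intro j _
    exact ((summable_lipschitz_torsion N j τ).mul_left _).mul_left _

end

section

open EisensteinSeries CongruenceSubgroup

/-! ### The Eisenstein series of the cusp at infinity -/

/-- The weighted sum over primitive vectors. -/
def primitiveSum {N : ℕ} (φ : ZMod N → ℂ) (τ : ℍ) : ℂ :=
  ∑' v : gammaSet 1 1 0, weight φ v * eisSummand 3 v τ

/-- If g is a unit modulo N, divisibility of the first entry is unaffected; otherwise both sides
vanish because the character does. -/
theorem weight_smul {N : ℕ} [NeZero N] (χ : DirichletCharacter ℂ N) (g : ℕ) (v : Fin 2 → ℤ) :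
    weight χ (g • v) = χ (g : ZMod N) * weight χ v := by
  simp only [weight, Pi.smul_apply, nsmul_eq_mul, Int.cast_mul, Int.cast_natCast, map_mul]
  by_cases hg : IsUnit (g : ZMod N)
  · simp only [hg.mul_right_eq_zero]
    split_ifs <;> simp
  · rw [χ.map_nonunit hg]
    simp

/-- The value at `3` of the L-function of a character. -/
def lThree {N : ℕ} (χ : DirichletCharacter ℂ N) : ℂ := ∑' g : ℕ, χ (g : ZMod N) * ((g : ℂ) ^ 3)⁻¹

theorem summable_lThree {N : ℕ} (χ : DirichletCharacter ℂ N) :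
    Summable fun g : ℕ => ‖χ (g : ZMod N) * ((g : ℂ) ^ 3)⁻¹‖ := by
  have h : Summable fun g : ℕ => ((g : ℝ) ^ 3)⁻¹ := Real.summable_nat_pow_inv.2 (by norm_num)
  refine Summable.of_nonneg_of_le (fun _ => norm_nonneg _) (fun g => ?_) h
  rw [norm_mul, norm_inv, norm_pow, Complex.norm_natCast]
  exact mul_le_of_le_one_left (by positivity) (χ.norm_le_one _)

/-- Every nonzero vector is its gcd times a primitive vector; the hypothesis a 0 = 0 disposes of the
zero vector. -/
theorem tsum_eq_mul_tsum_primitive {F : (Fin 2 → ℤ) → ℂ} {a : ℕ → ℂ}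
    (ha0 : a 0 = 0) (hF : Summable fun v => ‖F v‖)
    (h : ∀ (b : ℕ) (v : gammaSet 1 b 0), F v = a b * F (divIntMap b v)) :
    ∑' v, F v = (∑' b, a b) * ∑' v : gammaSet 1 1 0, F v := by
  have hs : Summable fun v : Σ r : ℕ, gammaSet 1 r 0 => F v.2 :=
    (gammaSetDivGcdSigmaEquiv.symm.summable_iff.2 hF.of_norm).congr fun v => by
      simp only [Function.comp_apply, gammaSetDivGcdSigmaEquiv_symm_eq]
  have e1 : ∑' v, F v = ∑' v : Σ r : ℕ, gammaSet 1 r 0, F v.2 := by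
    rw [← gammaSetDivGcdSigmaEquiv.symm.tsum_eq]
    simp only [gammaSetDivGcdSigmaEquiv_symm_eq]
  rw [e1, hs.tsum_sigma, ← tsum_mul_right]
  refine tsum_congr fun b => ?_
  rw [tsum_congr (h b), tsum_mul_left]
  rcases Nat.eq_zero_or_pos b with hb | hb
  · rw [hb, ha0, zero_mul, zero_mul]
  · have : NeZero b := ⟨hb.ne'⟩
    congr 1
    exact (gammaSetDivGcdEquiv b).tsum_eq fun v : gammaSet 1 1 0 => F v

theorem tsum_weight_eq_mul {N : ℕ} [NeZero N] (χ : DirichletCharacter ℂ N) (τ : ℍ) :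
    ∑' v, weight χ v * eisSummand 3 v τ = lThree χ * primitiveSum χ τ := by
  refine tsum_eq_mul_tsum_primitive (F := fun v => weight χ v * eisSummand 3 v τ)
    (by simp) (summable_weight χ τ) fun b v => ?_
  have h1 := eisSummand_of_gammaSet_eq_divIntMap 3 τ v
  have h2 : weight χ (v : Fin 2 → ℤ) = χ (b : ZMod N) * weight χ (divIntMap b v) := by
    conv_lhs => rw [gammaSet_eq_gcd_mul_divIntMap v.2]
    exact weight_smul χ b _
  rw [h1, h2]
  have h3 : (b : ℂ) ^ (3 : ℤ) = (b : ℂ) ^ 3 := rfl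
  rw [h3]
  ring

/-- For odd χ the function χ(a) a^(-3) is even, so twice L(3, χ) is a sum over all integers. Sorted
by residues it is the row c = 0 of the weighted lattice sum, which lets the transcendental constants
cancel later. -/
theorem two_mul_lThree {N : ℕ} [NeZero N] (hN : 1 < N) (χ : DirichletCharacter ℂ N)
    (hχ : χ.Odd) : 2 * lThree χ =
      ∑ j ∈ Finset.range N, χ (j : ZMod N) * (((N : ℂ) ^ 3)⁻¹ * lipschitz ((j / N : ℝ) : ℂ)) := by
  have hN0 : (N : ℂ) ≠ 0 := Nat.cast_ne_zero.2 (NeZero.ne N)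
  have : Nontrivial (ZMod N) := ZMod.nontrivial_iff.2 hN.ne'
  set f : ℤ → ℂ := fun a => χ (a : ZMod N) * (((a : ℂ)) ^ 3)⁻¹ with hf
  have hfe : f.Even := by
    intro a
    simp only [hf]
    rw [Int.cast_neg, ← neg_one_mul, map_mul, hχ, Int.cast_neg, Odd.neg_pow (by decide), inv_neg]
    ring
  have hfs : Summable f := by
    have h := (summable_lipschitz 0).norm
    refine Summable.of_norm_bounded h fun a => ?_
    rw [norm_mul, zero_add, one_div]
    exact mul_le_of_le_one_left (norm_nonneg _) (χ.norm_le_one _)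
  have h0 : f 0 = 0 := by
    simp only [hf]
    rw [Int.cast_zero, MulChar.map_zero, zero_mul]
  have h1 := tsum_int_eq_zero_add_two_mul_tsum_pnat hfe hfs
  have h2 : ∑' n : ℕ+, f (n : ℕ) = lThree χ := by
    have h3 := tsum_zero_pnat_eq_tsum_nat (f := fun g : ℕ => χ (g : ZMod N) * ((g : ℂ) ^ 3)⁻¹)
      (summable_lThree χ).of_norm
    rw [lThree, ← h3]
    simp [hf]
  rw [h0, zero_add, tsum_int_eq_sum_residues N hfs] at h1
  rw [← h2, two_mul, ← two_nsmul, ← h1]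
  refine Finset.sum_congr rfl fun j _ => ?_
  rw [lipschitz, ← tsum_mul_left, ← tsum_mul_left]
  refine tsum_congr fun n => ?_
  simp only [hf]
  push_cast
  rw [ZMod.natCast_self, mul_zero, zero_add]
  have : (n : ℂ) * N + j = N * (j / N + n) := by
    field_simp
    ring
  rw [this, mul_pow, mul_inv, one_div]

/-- The bijection `(a, c) ↦ (-c, a)`. -/
def pairEquiv : ℤ × ℤ ≃ (Fin 2 → ℤ) where
  toFun p := ![-p.2, p.1]
  invFun v := (v 1, -v 0)
  left_inv p := by simp
  right_inv v := by
    funext i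
    fin_cases i <;> simp

theorem cuspEisenstein_eq (N : ℕ) (τ : ℍ) :
    cuspEisenstein N 3 τ = eisensteinSeries (N := N) ![0, 1] 3 τ := by
  have h : ∀ p : ℤ × ℤ, (IsCoprime p.1 p.2 ∧ p.1 ≡ 1 [ZMOD N] ∧ p.2 ≡ 0 [ZMOD N]) ↔
      pairEquiv p ∈ gammaSet N 1 ![0, 1] := by
    intro p
    rw [gammaSet, Set.mem_ofPred_eq, Int.isCoprime_iff_gcd_eq_one, ← ZMod.intCast_eq_intCast_iff,
      ← ZMod.intCast_eq_intCast_iff, funext_iff, Fin.forall_fin_two]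
    simp only [pairEquiv, Equiv.coe_fn_mk, Function.comp_apply, Matrix.cons_val_zero,
      Matrix.cons_val_one, Int.cast_neg, neg_eq_zero, Int.cast_one, Int.cast_zero, Int.neg_gcd]
    rw [Int.gcd_comm]
    tauto
  rw [cuspEisenstein, eisensteinSeries, ← (pairEquiv.subtypeEquiv h).tsum_eq]
  refine tsum_congr fun p => ?_
  rw [eisSummand_three]
  simp [pairEquiv]

theorem primitiveSum_add {N : ℕ} [NeZero N] (φ ψ : ZMod N → ℂ) (τ : ℍ) :
    primitiveSum (φ + ψ) τ = primitiveSum φ τ + primitiveSum ψ τ := by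
  have h : ∀ φ : ZMod N → ℂ, Summable fun v : gammaSet 1 1 0 => weight φ v * eisSummand 3 v τ :=
    fun φ => (summable_weight φ τ).of_norm.subtype (gammaSet 1 1 0)
  rw [primitiveSum, primitiveSum, primitiveSum, ← (h φ).tsum_add (h ψ)]
  refine tsum_congr fun v => ?_
  simp only [weight, Pi.add_apply]
  split_ifs <;> ring

theorem primitiveSum_smul {N : ℕ} (a : ℂ) (φ : ZMod N → ℂ) (τ : ℍ) :
    primitiveSum (a • φ) τ = a * primitiveSum φ τ := by
  rw [primitiveSum, primitiveSum, ← tsum_mul_left]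
  refine tsum_congr fun v => ?_
  simp only [weight, Pi.smul_apply, smul_eq_mul]
  split_ifs <;> ring

/-- The weight three is odd, so replacing v by -v changes the sign of the summand. -/
theorem primitiveSum_neg_arg {N : ℕ} (φ : ZMod N → ℂ) (τ : ℍ) :
    primitiveSum (fun a => φ (-a)) τ = -primitiveSum φ τ := by
  have h : ∀ v : Fin 2 → ℤ, v ∈ gammaSet 1 1 0 ↔ Equiv.neg (Fin 2 → ℤ) v ∈ gammaSet 1 1 0 := by
    intro v
    simp [mem_gammaSet_one, IsCoprime.neg_neg_iff]
  rw [primitiveSum, primitiveSum, ← ((Equiv.neg (Fin 2 → ℤ)).subtypeEquiv h).tsum_eq, ← tsum_neg]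
  refine tsum_congr fun v => ?_
  simp only [Equiv.subtypeEquiv_apply, Equiv.neg_apply, eisSummand_three, weight, Pi.neg_apply,
    Int.cast_neg, neg_neg, neg_eq_zero]
  rw [show -((v : Fin 2 → ℤ) 0 : ℂ) * τ + -((v : Fin 2 → ℤ) 1 : ℂ) =
    -(((v : Fin 2 → ℤ) 0 : ℂ) * τ + ((v : Fin 2 → ℤ) 1 : ℂ)) by ring, Odd.neg_pow (by decide),
    div_neg]
  ring

theorem primitiveSum_single {N : ℕ} [NeZero N] (τ : ℍ) :
    primitiveSum (Pi.single (1 : ZMod N) (1 : ℂ)) τ = cuspEisenstein N 3 τ := by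
  rw [cuspEisenstein_eq, eisensteinSeries, primitiveSum,
    tsum_subtype (gammaSet 1 1 0) fun v => weight (Pi.single (1 : ZMod N) (1 : ℂ)) v *
      eisSummand 3 v τ, tsum_subtype (gammaSet N 1 ![0, 1]) fun v => eisSummand 3 v τ]
  refine tsum_congr fun v => ?_
  have hm : v ∈ gammaSet N 1 ![0, 1] ↔ v ∈ gammaSet 1 1 0 ∧ ((v 0 : ℤ) : ZMod N) = 0 ∧
      ((v 1 : ℤ) : ZMod N) = 1 := by
    rw [gammaSet_one_mem_iff, gammaSet, Set.mem_ofPred_eq, funext_iff, Fin.forall_fin_two]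
    simp only [Function.comp_apply, Matrix.cons_val_zero, Matrix.cons_val_one]
    tauto
  by_cases h1 : v ∈ gammaSet 1 1 0
  · by_cases h2 : ((v 0 : ℤ) : ZMod N) = 0
    · by_cases h3 : ((v 1 : ℤ) : ZMod N) = 1
      · rw [Set.indicator_of_mem h1, Set.indicator_of_mem (hm.2 ⟨h1, h2, h3⟩), weight, if_pos h2,
          h3, Pi.single_eq_same, one_mul]
      · rw [Set.indicator_of_mem h1, Set.indicator_of_notMem (fun h => h3 (hm.1 h).2.2), weight,
          if_pos h2, Pi.single_eq_of_ne h3, zero_mul]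
    · rw [Set.indicator_of_mem h1, Set.indicator_of_notMem (fun h => h2 (hm.1 h).2.1), weight,
        if_neg h2, zero_mul]
  · rw [Set.indicator_of_notMem h1, Set.indicator_of_notMem fun h => h1 (hm.1 h).1]

/-- The odd function supported at `1` and `-1`. -/
theorem primitiveSum_odd {N : ℕ} [NeZero N] (τ : ℍ) {φ : ZMod N → ℂ}
    (hφ : ∀ a, φ a = (if a = 1 then 1 else 0) - if a = -1 then 1 else 0) :
    primitiveSum φ τ = 2 * cuspEisenstein N 3 τ := by
  have e : φ = Pi.single (1 : ZMod N) (1 : ℂ) +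
      (-1 : ℂ) • fun a => (Pi.single (1 : ZMod N) (1 : ℂ) : ZMod N → ℂ) (-a) := by
    funext a
    rw [hφ]
    simp only [Pi.add_apply, Pi.smul_apply, smul_eq_mul, Pi.single_apply, neg_eq_iff_eq_neg]
    ring
  rw [e, primitiveSum_add, primitiveSum_smul, primitiveSum_neg_arg, primitiveSum_single]
  ring

/-- The modular form given by the Eisenstein series of the cusp at infinity. -/
theorem exists_modularForm (N : ℕ) [NeZero N] :
    ∃ F : ModularForm ((Gamma1 N).map (Matrix.SpecialLinearGroup.mapGL ℝ)) 3,
      ∀ τ : ℍ, F τ = cuspEisenstein N 3 τ := by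
  refine ⟨{
    toFun := eisensteinSeriesSIF (N := N) ![0, 1] 3
    slash_action_eq' := ?_
    holo' := eisensteinSeriesSIF_mdifferentiable le_rfl _
    bdd_at_cusps' := ?_ }, fun τ => (cuspEisenstein_eq N τ).symm⟩
  · rintro A ⟨A, hA, rfl⟩
    obtain ⟨-, h1, h2⟩ := (Gamma1_mem N A).1 hA
    -- The slash action multiplies the residue vector (0, 1) by A on the right, giving the bottom
    -- row of A, which is (0, 1) modulo N.
    have h : SlashAction.map (3 : ℤ) A (⇑(eisensteinSeriesSIF (N := N) ![0, 1] 3)) =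
        ⇑(eisensteinSeriesSIF (N := N) ![0, 1] 3) := by
      change SlashAction.map (3 : ℤ) A (eisensteinSeries (N := N) ![0, 1] 3) =
        eisensteinSeries (N := N) ![0, 1] 3
      rw [eisensteinSeries_slash_apply]
      congr 1
      funext i
      fin_cases i
      · simpa [Matrix.vecMul, Matrix.vecHead, Matrix.vecTail] using h2
      · simpa [Matrix.vecMul, Matrix.vecHead, Matrix.vecTail] using h1
    simpa [Matrix.SpecialLinearGroup.mapGL, ← ModularForm.SL_slash] using h
  · intro c hc
    rw [Subgroup.IsArithmetic.isCusp_iff_isCusp_SL2Z] at hc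
    rw [OnePoint.isBoundedAt_iff_forall_SL2Z hc]
    exact fun γ hγ => isBoundedAtImInfty_eisensteinSeriesSIF _ le_rfl γ

end

/-! ### The extremal functions as Eisenstein series of the cusp at infinity -/

theorem TorusPoint.j₂_symm (t : TorusPoint ℂ) : t.symm.j₂ = -t.j₂ := by
  simp [symm, j₂]

theorem TorusPoint.value_symm (t : TorusPoint ℂ) (τ : ℍ) : t.symm.value τ = -t.value τ := by
  have h : ∀ m, t.symm.s m = -t.s m := fun m => (neg_sub _ _).symm
  simp only [value, j₂_symm, h, mul_neg, neg_mul, tsum_neg]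
  ring

theorem div_ne_intCast {j N : ℕ} (hj : 0 < j) (hjN : j < N) (n : ℤ) : (j / N : ℝ) ≠ n := by
  have hN : (0 : ℝ) < N := Nat.cast_pos.2 (hj.trans hjN)
  rw [Ne, div_eq_iff hN.ne']
  intro h
  have h1 : (j : ℤ) = n * N := by exact_mod_cast h
  have h2 : (N : ℤ) ∣ j := ⟨n, by rw [h1, mul_comm]⟩
  exact Nat.not_dvd_of_pos_of_lt hj hjN (Int.natCast_dvd_natCast.1 h2)

/-- The values of the torus point with `N`-torsion parameter `j` and of its inverse. -/
theorem lipschitz_torsion {N j k : ℕ} [NeZero N] (hj : 0 < j) (hk : 0 < k) (hjk : j + k = N)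
    {t : TorusPoint ℂ} (ht : t.x = Complex.exp (2 * Real.pi * Complex.I * (j / N : ℝ))) :
    lipschitz ((j / N : ℝ) : ℂ) = lipschitzConst * t.j₂ ∧
    lipschitz ((k / N : ℝ) : ℂ) = -(lipschitzConst * t.j₂) ∧
    ∀ τ : ℍ, ∑' c : ℤ, lipschitz (c * τ + ((j / N : ℝ) : ℂ)) = lipschitzConst * t.value τ ∧
      ∑' c : ℤ, lipschitz (c * τ + ((k / N : ℝ) : ℂ)) = -(lipschitzConst * t.value τ) := by
  have hN : (N : ℂ) ≠ 0 := Nat.cast_ne_zero.2 (NeZero.ne N)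
  have hj' := div_ne_intCast (N := N) hj (by omega)
  have hk' := div_ne_intCast (N := N) hk (by omega)
  have ht' : t.symm.x = Complex.exp (2 * Real.pi * Complex.I * (k / N : ℝ)) := by
    have h1 : t.x * Complex.exp (2 * Real.pi * Complex.I * (k / N : ℝ)) = 1 := by
      rw [ht, ← Complex.exp_add, ← Complex.exp_two_pi_mul_I]
      congr 1
      have h2 : (j : ℂ) + k = N := by exact_mod_cast hjk
      push_cast
      field_simp
      rw [h2]
    change t.xi = _
    linear_combination -t.xi * h1 + Complex.exp (2 * Real.pi * Complex.I * (k / N : ℝ)) * t.mul_inv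
  refine ⟨lipschitz_ofReal hj' ht, ?_, fun τ =>
    ⟨tsum_lipschitz hj' ht τ (summable_lipschitz_torsion N j τ), ?_⟩⟩
  · rw [lipschitz_ofReal hk' ht', TorusPoint.j₂_symm, mul_neg]
  · rw [tsum_lipschitz hk' ht' τ (summable_lipschitz_torsion N k τ), TorusPoint.value_symm, mul_neg]

theorem sum_range_odd {N : ℕ} (hN : 1 < N) (F : ℕ → ℂ) :
    ∑ j ∈ Finset.range N, ((if (j : ZMod N) = 1 then 1 else 0) -
      if (j : ZMod N) = -1 then 1 else 0) * F j = F 1 - F (N - 1) := by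
  have h1 : ∀ j ∈ Finset.range N, (j : ZMod N) = 1 → j = 1 := by
    intro j hj h
    have h2 : ((j : ℕ) : ZMod N) = ((1 : ℕ) : ZMod N) := by rw [h, Nat.cast_one]
    exact Nat.ModEq.eq_of_lt_of_lt ((ZMod.natCast_eq_natCast_iff _ _ _).1 h2)
      (Finset.mem_range.1 hj) hN
  have e : ((N - 1 : ℕ) : ZMod N) = -1 := by
    rw [Nat.cast_sub hN.le, ZMod.natCast_self, Nat.cast_one, zero_sub]
  have h2 : ∀ j ∈ Finset.range N, (j : ZMod N) = -1 → j = N - 1 := by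
    intro j hj h
    rw [← e] at h
    exact Nat.ModEq.eq_of_lt_of_lt ((ZMod.natCast_eq_natCast_iff _ _ _).1 h)
      (Finset.mem_range.1 hj) (by omega)
  simp only [sub_mul, ite_mul, one_mul, zero_mul, Finset.sum_sub_distrib]
  congr 1
  · rw [Finset.sum_eq_single_of_mem 1 (Finset.mem_range.2 hN)
      fun j hj hj1 => if_neg fun h => hj1 (h1 j hj h), if_pos Nat.cast_one]
  · rw [Finset.sum_eq_single_of_mem (N - 1) (Finset.mem_range.2 (by omega))
      fun j hj hj1 => if_neg fun h => hj1 (h2 j hj h), if_pos e]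

/-- For the odd character supported on ±1, both L(3, χ) and the weighted lattice sum are the same
constant multiple of the constant term and of the value of J₂. Cancelling it avoids any evaluation
of L(3, χ). -/
theorem mul_cuspEisenstein {N : ℕ} [NeZero N] (hN : 2 < N) (χ : DirichletCharacter ℂ N)
    (hχ : ∀ a, χ a = (if a = 1 then 1 else 0) - if a = -1 then 1 else 0) {t : TorusPoint ℂ}
    (ht : t.x = Complex.exp (2 * Real.pi * Complex.I / N)) (τ : ℍ) :
    t.j₂ * cuspEisenstein N 3 τ = t.value τ := by
  have hN0 : (N : ℂ) ≠ 0 := Nat.cast_ne_zero.2 (NeZero.ne N)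
  have : Fact (2 < N) := ⟨hN⟩
  have hodd : χ.Odd := by
    rw [DirichletCharacter.Odd, hχ, if_neg ZMod.neg_one_ne_one, if_pos rfl, zero_sub]
  obtain ⟨a1, a2, a3⟩ := lipschitz_torsion (N := N) (j := 1) (k := N - 1) (t := t) one_pos
    (by omega) (by omega) (by rw [ht]; congr 1; push_cast; ring)
  obtain ⟨a4, a5⟩ := a3 τ
  have h1 := two_mul_lThree (by omega) χ hodd
  have h2 := (tsum_weight_eq_mul χ τ).symm.trans (tsum_weight χ τ)
  simp only [hχ] at h1 h2
  rw [sum_range_odd (by omega), a1, a2] at h1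
  rw [sum_range_odd (by omega), a4, a5, primitiveSum_odd τ hχ] at h2
  have h3 : 2 * ((N : ℂ) ^ 3)⁻¹ * lipschitzConst ≠ 0 :=
    mul_ne_zero (mul_ne_zero two_ne_zero (inv_ne_zero (pow_ne_zero 3 hN0))) lipschitzConst_ne_zero
  refine mul_left_cancel₀ h3 ?_
  linear_combination h2 - cuspEisenstein N 3 τ * h1

/-! ### Odd characters of levels three, four and six, and the comparison with the cusp -/

theorem chi3_eq (a : ZMod 3) : chi3 a = (if a = 1 then 1 else 0) - if a = -1 then 1 else 0 := by
  have h : ∀ a : ZMod 3, a = 0 ∨ a = 1 ∨ a = 2 := by decide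
  have e : (-1 : ZMod 3) = 2 := by decide
  have h0 : chi3 0 = 0 := MulChar.map_zero _
  rcases h a with rfl | rfl | rfl
  · rw [h0, e, if_neg (by decide), if_neg (by decide), sub_zero]
  · rw [map_one, e, if_pos rfl, if_neg (by decide), sub_zero]
  · rw [chi3_two, e, if_neg (by decide), if_pos rfl, zero_sub]

theorem chi4_eq (a : ZMod 4) : chi4 a = (if a = 1 then 1 else 0) - if a = -1 then 1 else 0 := by
  have h : ∀ a : ZMod 4, a = 0 ∨ a = 1 ∨ a = 2 ∨ a = 3 := by decide
  have e : (-1 : ZMod 4) = 3 := by decide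
  rcases h a with rfl | rfl | rfl | rfl
  · rw [chi4_zero, e, if_neg (by decide), if_neg (by decide), sub_zero]
  · rw [map_one, e, if_pos rfl, if_neg (by decide), sub_zero]
  · rw [chi4_two, e, if_neg (by decide), if_neg (by decide), sub_zero]
  · rw [chi4_three, e, if_neg (by decide), if_pos rfl, zero_sub]

/-- The units modulo 6 are ±1, and the character induced from level three separates them while
vanishing on the other residues. -/
theorem exists_character_six : ∃ χ : DirichletCharacter ℂ 6,
    ∀ a, χ a = (if a = 1 then 1 else 0) - if a = -1 then 1 else 0 := by
  refine ⟨DirichletCharacter.changeLevel (show 3 ∣ 6 by decide) chi3, fun a => ?_⟩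
  have h : ∀ a : ZMod 6, a = 1 ∨ a = -1 ∨ (¬IsUnit a ∧ a ≠ 1 ∧ a ≠ -1) := by decide
  rcases h a with rfl | rfl | ⟨h1, h2, h3⟩
  · rw [map_one, if_pos rfl, if_neg (by decide), sub_zero]
  · have h1 := DirichletCharacter.changeLevel_eq_cast_of_dvd chi3 (show 3 ∣ 6 by decide) (-1)
    have h2 : ((((-1 : (ZMod 6)ˣ) : ZMod 6)).cast : ZMod 3) = 2 := by decide
    rw [h2, chi3_two, Units.val_neg, Units.val_one] at h1
    rw [h1, if_neg (by decide), if_pos rfl, zero_sub]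
  · rw [MulChar.map_nonunit _ h1, if_neg h2, if_neg h3, sub_zero]

theorem extremal_eq_value {d : Case} {a : ℂ} {t : TorusPoint ℂ} (hE : extremalQ d = C a * t.J₂)
    (ht : ‖t.x‖ = 1) (τ : ℍ) : extremal d τ = a * t.value τ := by
  have h := ((hasSum_J₂ ht τ).mul_left a).tsum_eq
  rw [← h, extremal, hE]
  refine tsum_congr fun n => ?_
  rw [coeff_C_mul, mul_assoc]

theorem norm_exp_torsion (N : ℕ) : ‖Complex.exp (2 * Real.pi * Complex.I / N)‖ = 1 := by
  rw [show 2 * Real.pi * Complex.I / N = ((2 * Real.pi / N : ℝ) : ℂ) * Complex.I by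
    push_cast; ring, Complex.norm_exp_ofReal_mul_I]

theorem extremal_eq_cuspEisenstein {d : Case} {N : ℕ} [NeZero N] (hN : 2 < N)
    {χ : DirichletCharacter ℂ N}
    (hχ : ∀ a, χ a = (if a = 1 then 1 else 0) - if a = -1 then 1 else 0) {t : TorusPoint ℂ}
    (ht : t.x = Complex.exp (2 * Real.pi * Complex.I / N)) {a : ℂ}
    (hE : extremalQ d = C a * t.J₂) (ha : a * t.j₂ = 1) (τ : ℍ) :
    extremal d τ = cuspEisenstein N 3 τ := by
  rw [extremal_eq_value hE (by rw [ht, norm_exp_torsion]), ← mul_cuspEisenstein hN χ hχ ht,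
    ← mul_assoc, ha, one_mul]

/-- Modulo 5 no single character is supported on ±1, but half the sum of the two conjugate odd
characters is. Each gives one linear relation between a primitive sum and the values of J₂ at t and
t'. -/
theorem extremal_d5_eq_cuspEisenstein (τ : ℍ) :
    extremal Case.d5 τ = cuspEisenstein 5 3 τ := by
  obtain ⟨t, t', ht, h, h'⟩ := exists_level_five
  have hn : ‖t.x‖ = 1 := by
    rw [ht]
    exact_mod_cast norm_exp_torsion 5
  have hn' : ‖t'.x‖ = 1 := by rw [h', norm_pow, hn, one_pow]
  obtain ⟨e1, e2⟩ := j₂_level_five h h'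
  have hsq := j₂_sq_level_five h h'
  have hE : extremal Case.d5 τ = -t.j₂ * t.value τ + -t'.j₂ * t'.value τ := by
    have g := (((hasSum_J₂ hn τ).mul_left (-t.j₂)).add
      ((hasSum_J₂ hn' τ).mul_left (-t'.j₂))).tsum_eq
    rw [← g, extremal, TorusPoint.extremalQ_d5 h h']
    refine tsum_congr fun n => ?_
    rw [map_add, coeff_C_mul, coeff_C_mul, e1, e2]
    ring
  obtain ⟨a1, a2, a3⟩ := lipschitz_torsion (N := 5) (j := 1) (k := 4) (t := t) (by norm_num)
    (by norm_num) rfl (by rw [ht]; congr 1; push_cast; ring)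
  obtain ⟨b1, b2, b3⟩ := lipschitz_torsion (N := 5) (j := 2) (k := 3) (t := t') (by norm_num)
    (by norm_num) rfl (by rw [h', ht, ← Complex.exp_nat_mul]; congr 1; push_cast; ring)
  obtain ⟨a4, a5⟩ := a3 τ
  obtain ⟨b4, b5⟩ := b3 τ
  have h0 : ((5 : ℕ) : ℂ) ≠ 0 := by norm_num
  have hκ : (((5 : ℕ) : ℂ) ^ 3)⁻¹ * lipschitzConst ≠ 0 :=
    mul_ne_zero (inv_ne_zero (pow_ne_zero 3 h0)) lipschitzConst_ne_zero
  obtain ⟨c0, c1, c2, c3, c4⟩ := chi5_apply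
  obtain ⟨d0, d1, d2, d3, d4⟩ := chi5bar_apply
  have key : ∀ (χ : DirichletCharacter ℂ 5) (u : ℂ), χ 0 = 0 → χ 2 = u → χ 3 = -u → χ 4 = -1 →
      (t.j₂ + u * t'.j₂) * primitiveSum χ τ = 2 * (t.value τ + u * t'.value τ) := by
    intro χ u z0 z2 z3 z4
    have h1 := two_mul_lThree (by norm_num) χ z4
    have h2 := (tsum_weight_eq_mul χ τ).symm.trans (tsum_weight χ τ)
    have z1 : χ 1 = 1 := map_one χ
    simp only [Finset.sum_range_succ, Finset.sum_range_zero, zero_add] at h1 h2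
    rw [Nat.cast_zero, Nat.cast_one, Nat.cast_ofNat (R := ZMod 5), Nat.cast_ofNat (R := ZMod 5),
      Nat.cast_ofNat (R := ZMod 5), z0, z1, z2, z3, z4] at h1 h2
    rw [a1, a2, b1, b2] at h1
    rw [a4, a5, b4, b5] at h2
    refine mul_left_cancel₀ hκ ?_
    linear_combination h2 - (1 / 2) * primitiveSum χ τ * h1
  have p1 := key chi5 Complex.I c0 c2 c3 c4
  have p2 := key chi5bar (-Complex.I) d0 d2 (by rw [d3, neg_neg]) d4
  have hφ : ∀ a : ZMod 5, ((1 / 2 : ℂ) • ((chi5 : ZMod 5 → ℂ) + (chi5bar : ZMod 5 → ℂ))) a =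
      (if a = 1 then 1 else 0) - if a = -1 then 1 else 0 := by
    intro a
    have hc : ∀ a : ZMod 5, a = 0 ∨ a = 1 ∨ a = 2 ∨ a = 3 ∨ a = 4 := by decide
    have e : (-1 : ZMod 5) = 4 := by decide
    rw [e, Pi.smul_apply, Pi.add_apply, smul_eq_mul]
    rcases hc a with rfl | rfl | rfl | rfl | rfl
    · rw [c0, d0, if_neg (by decide), if_neg (by decide)]
      ring
    · rw [c1, d1, if_pos rfl, if_neg (by decide)]
      ring
    · rw [c2, d2, if_neg (by decide), if_neg (by decide)]
      ring
    · rw [c3, d3, if_neg (by decide), if_neg (by decide)]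
      ring
    · rw [c4, d4, if_neg (by decide), if_pos rfl]
      ring
  have hp := primitiveSum_odd τ hφ
  rw [primitiveSum_smul, primitiveSum_add] at hp
  rw [hE]
  have hI := Complex.I_sq
  set P := primitiveSum chi5 τ
  set Q := primitiveSum chi5bar τ
  -- Each relation is multiplied by the conjugate factor j₂ ∓ i j₂', so that the coefficient of
  -- either primitive sum becomes j₂² + j₂'² = -1.
  linear_combination (1 / 4 : ℂ) * ((t.j₂ - Complex.I * t'.j₂) * p1
    + (t.j₂ + Complex.I * t'.j₂) * p2) - (1 / 2) * (t.j₂ ^ 2 + t'.j₂ ^ 2) * hp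
    - cuspEisenstein 5 3 τ * hsq + ((1 / 4) * t'.j₂ ^ 2 * (P + Q) - t'.value τ * t'.j₂) * hI

theorem extremal_eq (d : Case) (hd : d ≠ Case.d8) (τ : ℍ) :
    extremal d τ = cuspEisenstein d.degree 3 τ := by
  cases d with
  | d3 =>
    obtain ⟨t, ht, h⟩ := exists_level_three
    obtain ⟨h1, h2, -⟩ := extremalQ_d3_eq h
    exact extremal_eq_cuspEisenstein (N := 3) (by norm_num) chi3_eq (by exact_mod_cast ht) h1 h2 τ
  | d4 =>
    obtain ⟨t, ht, h⟩ := exists_level_four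
    obtain ⟨h1, h2, -⟩ := extremalQ_d4_eq h
    exact extremal_eq_cuspEisenstein (N := 4) (by norm_num) chi4_eq (by exact_mod_cast ht) h1 h2 τ
  | d5 => exact extremal_d5_eq_cuspEisenstein τ
  | d6I =>
    obtain ⟨t, ht, h⟩ := exists_level_six
    obtain ⟨χ, hχ⟩ := exists_character_six
    obtain ⟨h1, h2, -⟩ := extremalQ_d6_eq h (d := Case.d6I) rfl
    exact extremal_eq_cuspEisenstein (N := 6) (by norm_num) hχ (by exact_mod_cast ht) h1 h2 τ
  | d6II =>
    obtain ⟨t, ht, h⟩ := exists_level_six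
    obtain ⟨χ, hχ⟩ := exists_character_six
    obtain ⟨h1, h2, -⟩ := extremalQ_d6_eq h (d := Case.d6II) rfl
    exact extremal_eq_cuspEisenstein (N := 6) (by norm_num) hχ (by exact_mod_cast ht) h1 h2 τ
  | d8 => exact absurd rfl hd

end ExtremalFunction

end

theorem mainTheorem10 :
    (∀ (d : Case) (τ : ℍ), Summable fun n : ℕ => coeff n (extremalQ d) * qOf τ ^ n) ∧
    (∀ d : Case, d ≠ Case.d8 →
      (∃ F : ModularForm ((CongruenceSubgroup.Gamma1 d.degree).map
          (Matrix.SpecialLinearGroup.mapGL ℝ)) 3, ∀ τ : ℍ, F τ = extremal d τ) ∧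
      ∀ τ : ℍ, extremal d τ = cuspEisenstein d.degree 3 τ) ∧
    (∀ τ : ℍ, extremal Case.d3 τ =
      -9 * normalizedEisenstein 3 (1 : DirichletCharacter ℂ 1) chi3 1 τ) ∧
    (∀ τ : ℍ, extremal Case.d4 τ =
      -4 * normalizedEisenstein 3 (1 : DirichletCharacter ℂ 1) chi4 1 τ) ∧
    (∀ τ : ℍ, extremal Case.d5 τ =
      (-1 + Complex.I / 2) * normalizedEisenstein 3 (1 : DirichletCharacter ℂ 1) chi5 1 τ
      + (-1 - Complex.I / 2) *
        normalizedEisenstein 3 (1 : DirichletCharacter ℂ 1) chi5bar 1 τ) ∧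
    (∀ d : Case, d.degree = 6 → ∀ τ : ℍ, extremal d τ =
      -normalizedEisenstein 3 (1 : DirichletCharacter ℂ 1) chi3 1 τ
      - 8 * normalizedEisenstein 3 (1 : DirichletCharacter ℂ 1) chi3 2 τ) ∧
    (∀ τ : ℍ, extremal Case.d8 τ =
      -4 * normalizedEisenstein 3 (1 : DirichletCharacter ℂ 1) chi4 2 τ) := by
  refine ⟨summable_extremal, fun d hd => ⟨?_, extremal_eq d hd⟩, extremal_d3, extremal_d4,
    extremal_d5, fun d hd => extremal_d6 hd, extremal_d8⟩
  have : NeZero d.degree := ⟨by cases d <;> decide⟩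
  obtain ⟨F, hF⟩ := exists_modularForm d.degree
  exact ⟨F, fun τ => (hF τ).trans (extremal_eq d hd τ).symm⟩
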